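/- Let $n,d\ge 1$ and $L$ be natural numbers, let $K_0=K_0^*\in\mathbb C^{n\times n}$ and $L_1,\dots,L_d\in\mathbb C^{n\times n}$, and put $$\Gamma[R]=\sum_{\alpha=1}^d\big(L_\alpha R L_\alpha^*+L_\alpha^* R L_\alpha\big),\qquad R\in\mathbb C^{n\times n}.$$ Assume that $\Gamma$ is $L$-flat: there are $c>0$ and a matrix $Z=(z_{kl})\in\{0,1\}^{n\times n}$ with $z_{kk}=1$ for all $k$ and all entries of $Z^L$ strictly positive, such that $$\Gamma[R]\ \ge\ c\sum_{l=1}^n\Big(\sum_{k=1}^n z_{kl}\,r_{kk}\Big)E_{ll}$$ for every positive semidefinite $R=(r_{kl})$, where $E_{ll}$ are the diagonal matrix units. For $z\in\mathbb C_+=\{\operatorname{Im}z>0\}$ let $M(z)\in\mathbb C^{n\times n}$ be the solution of the matrix Dyson equation $$-M(z)^{-1}=zI_n-K_0+\Gamma[M(z)]$$ with positive definite imaginary part $\operatorname{Im}M(z)=\frac1{2i}(M(z)-M(z)^*)$. Put $\rho(z)=\frac1{\pi n}\operatorname{Tr}\operatorname{Im}M(z)$ for $z\in\mathbb C_+$ and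 let $\rho(x)=\lim_{y\downarrow0}\rho(x+iy)$, $x\in\mathbb R$, be the density of states, with support $\operatorname{supp}\rho=\overline{\{x\in\mathbb R:\rho(x)\neq0\}}$. Let $\|\cdot\|$ be the operator norm on $\mathbb C^{n\times n}$ induced by the Euclidean norm on $\mathbb C^n$, and also the norm it induces on linear operators on $\mathbb C^{n\times n}$; for $T\in\mathbb C^{n\times n}$ let $\mathcal C_T[R]=TRT$. Then there is a constant $C>0$, depending only on $n,d,L,K_0,L_1,\dots,L_d$, such that the following hold. (i) For all $z\in\mathbb C_+$, $\|M(z)\|\le C$, and $M(z)$ is invertible with $\|M(z)^{-1}\|\le C(1+|z|)$. (ii) For all $z\in\mathbb C_+$, $C^{-1}\rho(z)I_n\le\operatorname{Im}M(z)\le C\rho(z)I_n$ in the sense of Hermitian matrices. (iii) For all $z\in\mathbb C_+$ the operator $\mathrm{Id}-\mathcal C_{M(z)}\Gamma$ on $\mathbb C^{n\times n}$ is invertible and $$\big\|(\mathrm{Id}-\mathcal C_{M(z)}\Gamma)^{-1}\big\|\le C\Big(1+\frac1{(\rho(z)+\operatorname{dist}(z,\operatorname{supp}\rho))^2}\Big).$$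 (iv) $M$ has a continuous extension to $\mathbb C_+\cup\mathbb R$, which satisfies $\|M(z_1)-M(z_2)\|\le C|z_1-z_2|^{1/3}$ for all $z_1,z_2\in\mathbb C_+\cup\mathbb R$. In particular, the limit defining $\rho(x)$ exists for every $x\in\mathbb R$, it equals $\frac1{\pi n}\operatorname{Tr}\operatorname{Im}M(x)$, and $|\rho(x_1)-\rho(x_2)|\le C|x_1-x_2|^{1/3}$ for all $x_1,x_2\in\mathbb R$. Moreover, the set $\{x\in\mathbb R:\rho(x)>0\}$ is open and $\rho$ is real analytic on it. (v) For every $x_0\in\mathbb R$ with $\rho(x_0)>0$ there are an open neighbourhood $U$ of $x_0$ in $\mathbb C$ and an analytic function $F:U\to\mathbb C^{n\times n}$ with $F(z)=M(z)$ for all $z\in U\cap\mathbb C_+$. -/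

import Mathlib

open Filter
open scoped Topology Matrix Matrix.Norms.L2Operator ComplexOrder

noncomputable section

namespace MDE

/-- Complex `n × n` matrices. Their norm is the spectral norm, that is, the operator norm induced by
the Euclidean norm on `ℂⁿ`. -/
abbrev Mat (n : ℕ) : Type := Matrix (Fin n) (Fin n) ℂ

/-- The imaginary part `(M - M*) / (2i)` of a matrix. -/
def imPart {n : ℕ} (M : Mat n) : Mat n :=
  (2 * Complex.I)⁻¹ • (M - Mᴴ)

/-- The linear map `R ↦ A R B` on `n × n` matrices. -/
def sandwich {n : ℕ} (A B : Mat n) : Mat n →ₗ[ℂ] Mat n :=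
  LinearMap.mulLeftRight ℂ (A, B)

/-- The self-energy operator `Γ[R] = ∑_α (L_α R L_α* + L_α* R L_α)`. -/
def selfEnergy {n d : ℕ} (Ls : Fin d → Mat n) : Mat n →ₗ[ℂ] Mat n :=
  ∑ α, (sandwich (Ls α) (Ls α)ᴴ + sandwich (Ls α)ᴴ (Ls α))

/-- `L`-flatness of an operator `Γ` on matrices: there are a zero-one matrix `Z` with unit diagonal
such that all entries of `Z ^ L` are positive, and a constant `c > 0`, such that
`Γ[R] ≥ c ∑_l (∑_k z_{kl} r_{kk}) E_{ll}` for every positive semidefinite `R`. -/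
def IsFlat {n : ℕ} (Γ : Mat n →ₗ[ℂ] Mat n) (L : ℕ) : Prop :=
  ∃ (Z : Matrix (Fin n) (Fin n) ℕ) (c : ℝ),
    (∀ k l, Z k l = 0 ∨ Z k l = 1) ∧
    (∀ k, Z k k = 1) ∧
    (∀ k l, 0 < (Z ^ L) k l) ∧
    0 < c ∧
    ∀ R : Mat n, R.PosSemidef →
      (Γ R - (c : ℂ) • Matrix.diagonal (fun l => ∑ k, (Z k l : ℂ) * R k k)).PosSemidef

/-- `M` is the solution, on the open upper half-plane, of the matrix Dyson equation
`-M(z)⁻¹ = z - K₀ + Γ[M(z)]` with positive definite imaginary part (which makes `M(z)` invertible).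
The values of `M` outside the open upper half-plane are irrelevant. -/
def IsSolution {n : ℕ} (K₀ : Mat n) (Γ : Mat n →ₗ[ℂ] Mat n) (M : ℂ → Mat n) : Prop :=
  ∀ z : ℂ, 0 < z.im →
    (imPart (M z)).PosDef ∧ -(M z)⁻¹ = z • (1 : Mat n) - K₀ + Γ (M z)

/-- `ρ(z) = π⁻¹ ⟨Im M(z)⟩`, where `⟨T⟩ = n⁻¹ Tr T` is the normalized trace. -/
def rho {n : ℕ} (M : ℂ → Mat n) (z : ℂ) : ℝ :=
  Real.pi⁻¹ * ((n : ℝ)⁻¹ * (imPart (M z)).trace.re)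

/-- The density of states `ρ(x) = lim_{y ↓ 0} ρ(x + iy)` on the real line. -/
def density {n : ℕ} (M : ℂ → Mat n) (x : ℝ) : ℝ :=
  limUnder (𝓝[>] (0 : ℝ)) (fun y : ℝ => rho M ((x : ℂ) + (y : ℂ) * Complex.I))

/-- The support of the density of states, as a subset of the complex plane. -/
def densitySupport {n : ℕ} (M : ℂ → Mat n) : Set ℂ :=
  (fun x : ℝ => (x : ℂ)) '' tsupport (density M)

/-- The stability operator `Id - C_T Γ` on matrices, where `C_T[R] = T R T`. -/
def stability {n : ℕ} (Γ : Mat n →ₗ[ℂ] Mat n) (T : Mat n) : Mat n →L[ℂ] Mat n :=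
  LinearMap.toContinuousLinearMap (LinearMap.id - sandwich T T ∘ₗ Γ)

end MDE

end

noncomputable section

namespace MDE

open scoped MatrixOrder

/-! ### The Loewner order on matrices -/

section Order

variable {n : ℕ} {A B : Mat n} {r s : ℝ}

/-! Write T = M(z), V = Im T and N = Im(-T⁻¹) = Im z + Γ[V]. Taking imaginary parts of T(-T⁻¹)T* =
-T* = T*(-T⁻¹)T gives V = T N T* = T* N T. Flatness bounds N below by a diagonal matrix built from
the diagonal of V. Reading the two identities entrywise gives c|T_{jl}|² ≤ 1, hence the bound on T;
the equation then bounds T⁻¹ (`exists_norm_bounds`). While T⁻¹ stays bounded, every row of T has an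
entry that is not small, so positivity of the entries of Z^L spreads mass over the whole diagonal
and both V and N are comparable to τ = Tr V (`exists_comparable_of_norm_inv_le`). For large |z|, T
is of size 1/|z| and everything is perturbative.

For linear stability write T = Q* U Q with U unitary (`exists_balanced`). Since V and N are
comparable, Q and Q⁻¹ are bounded. The operator Id - C_T Γ becomes 1 - 𝒰F, where 𝒰[X] = U X U is an
isometry for the Hilbert–Schmidt norm and F[X] = Q Γ[Q* X Q] Q* is symmetric and positivity
preserving. With S = Im U one has F[S] = S - (Im z) QQ*, so F is a contraction with S as approximate
top eigenvector, and flatness makes F^{L+1} positivity improving, which yields a spectral gap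
(`norm_hsVec_pow_apply_sq_le`). Thus 1 - 𝒰F can degenerate only if 𝒰 almost fixes S and F almost
preserves its norm. The first is measured by S ~ τ and the second by Im z/τ, so the inverse is
bounded by a constant times min(τ⁻², τ/Im z) (`mul_norm_le_norm_sub_comp`, `exists_stability`).

Since max(τ², Im z/τ) ≥ (Im z)^{2/3} and (Id - C_M Γ)[M'] = M², the derivative is at most of order 1
+ (Im z)^{-2/3} (`exists_norm_deriv_le`), and integration gives the exponent 1/3
(`norm_sub_le_rpow_of_deriv_le`). Away from the support a harmonic barrier bounds ρ · dist by a
multiple of Im z (`im_le_of_im_eq_zero_on_interval`), which turns the second stability bound into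
one in terms of the distance. Analyticity, inside the half-plane and across points of positive
density, is the inverse function theorem for T ↦ K₀ - Γ[T] - T⁻¹ (`exists_analytic_local_inverse`).
Inside, its branch is identified with M by uniqueness (`SolvesAt.unique`); at the boundary,
continuity of the extension does this. -/

lemma posSemidef_of_nonneg (hA : 0 ≤ A) : A.PosSemidef := Matrix.nonneg_iff_posSemidef.1 hA

lemma nonneg_of_posSemidef (hA : A.PosSemidef) : 0 ≤ A := Matrix.nonneg_iff_posSemidef.2 hA

lemma smul_nonneg_of_nonneg (hr : 0 ≤ r) (hA : 0 ≤ A) : 0 ≤ (r : ℂ) • A :=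
  ((posSemidef_of_nonneg hA).smul (by exact_mod_cast hr : (0 : ℂ) ≤ (r : ℂ))).nonneg

lemma smul_le_smul_of_le (hr : 0 ≤ r) (hAB : A ≤ B) : (r : ℂ) • A ≤ (r : ℂ) • B := by
  rw [← sub_nonneg, ← smul_sub]
  exact smul_nonneg_of_nonneg hr (sub_nonneg.2 hAB)

lemma smul_le_smul_of_coeff_le (hrs : r ≤ s) (hA : 0 ≤ A) : (r : ℂ) • A ≤ (s : ℂ) • A := by
  rw [← sub_nonneg, ← sub_smul, ← Complex.ofReal_sub]
  exact smul_nonneg_of_nonneg (sub_nonneg.2 hrs) hA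

lemma mul_mul_conjTranspose_le (hAB : A ≤ B) (Q : Mat n) : Q * A * Qᴴ ≤ Q * B * Qᴴ :=
  star_right_conjugate_le_conjugate hAB Q

lemma conjTranspose_mul_mul_le (hAB : A ≤ B) (Q : Mat n) : Qᴴ * A * Q ≤ Qᴴ * B * Q :=
  star_left_conjugate_le_conjugate hAB Q

lemma algebraMap_eq_smul_one (r : ℝ) : algebraMap ℝ (Mat n) r = (r : ℂ) • (1 : Mat n) := by
  ext i j
  simp [Matrix.algebraMap_matrix_apply, Matrix.one_apply]

lemma le_norm_smul_one (hA : A.IsHermitian) : A ≤ ((‖A‖ : ℝ) : ℂ) • (1 : Mat n) := by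
  rw [← algebraMap_eq_smul_one]
  exact IsSelfAdjoint.le_algebraMap_norm_self hA

lemma norm_le_of_le_smul_one (hA : 0 ≤ A) (hr : 0 ≤ r) (h : A ≤ (r : ℂ) • (1 : Mat n)) :
    ‖A‖ ≤ r :=
  (CStarAlgebra.norm_le_iff_le_algebraMap A hr hA).2 (by rwa [algebraMap_eq_smul_one])

/-- The norm of a Hermitian matrix is the modulus of one of its eigenvalues, and the order bounds
place all eigenvalues between -‖B‖ and ‖B‖. -/
lemma norm_le_norm_of_neg_le_of_le (hA : A.IsHermitian) (h₁ : -B ≤ A) (h₂ : A ≤ B) :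
    ‖A‖ ≤ ‖B‖ := by
  have hB : 0 ≤ B := by
    have h : 0 ≤ B + B := by
      have := add_le_add (neg_le.1 h₁) h₂
      rwa [neg_add_cancel] at this
    have := smul_nonneg_of_nonneg (r := 2⁻¹) (by norm_num) h
    rw [← two_smul ℂ B, smul_smul] at this
    simpa using this
  have hB' := le_norm_smul_one (posSemidef_of_nonneg hB).isHermitian
  have hA' : IsSelfAdjoint A := hA
  cases subsingleton_or_nontrivial (Mat n)
  · rw [Subsingleton.elim A B]
  rcases CStarAlgebra.norm_or_neg_norm_mem_spectrum (a := A) with h | h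
  · have h2 : A ≤ algebraMap ℝ (Mat n) ‖B‖ := by
      rw [algebraMap_eq_smul_one]; exact h₂.trans hB'
    exact (le_algebraMap_iff_spectrum_le).1 h2 _ h
  · have h2 : algebraMap ℝ (Mat n) (-‖B‖) ≤ A := by
      rw [map_neg, algebraMap_eq_smul_one]; exact (neg_le_neg hB').trans h₁
    have := (algebraMap_le_iff_le_spectrum).1 h2 _ h
    linarith

lemma trace_re_nonneg (hA : 0 ≤ A) : 0 ≤ A.trace.re :=
  (Complex.le_def.1 (posSemidef_of_nonneg hA).trace_nonneg).1

lemma trace_re_mono (hAB : A ≤ B) : A.trace.re ≤ B.trace.re := by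
  have := trace_re_nonneg (sub_nonneg.2 hAB)
  rw [Matrix.trace_sub, Complex.sub_re] at this
  linarith

lemma diag_re_nonneg (hA : 0 ≤ A) (i : Fin n) : 0 ≤ (A i i).re :=
  (Complex.le_def.1 ((posSemidef_of_nonneg hA).diag_nonneg (i := i))).1

lemma diag_re_mono (hAB : A ≤ B) (i : Fin n) : (A i i).re ≤ (B i i).re := by
  have := diag_re_nonneg (sub_nonneg.2 hAB) i
  rw [Matrix.sub_apply, Complex.sub_re] at this
  linarith

lemma diag_eq_ofReal (hA : A.IsHermitian) (i : Fin n) : A i i = ((A i i).re : ℂ) :=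
  (Complex.conj_eq_iff_re.1 (hA.apply i i)).symm

lemma norm_le_trace_re (hA : 0 ≤ A) : ‖A‖ ≤ A.trace.re := by
  cases subsingleton_or_nontrivial (Mat n)
  · rw [Subsingleton.elim A 0]; simp
  have hH := (posSemidef_of_nonneg hA).isHermitian
  have h := CStarAlgebra.norm_mem_spectrum_of_nonneg (a := A) hA
  rw [hH.spectrum_real_eq_range_eigenvalues] at h
  obtain ⟨i, hi⟩ := h
  rw [← hi, hH.trace_eq_sum_eigenvalues]
  simp only [Complex.coe_algebraMap, Complex.re_sum, Complex.ofReal_re]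
  exact Finset.single_le_sum (fun j _ => (posSemidef_of_nonneg hA).eigenvalues_nonneg j) (Finset.mem_univ i)

lemma le_trace_smul_one (hA : 0 ≤ A) : A ≤ ((A.trace.re : ℝ) : ℂ) • (1 : Mat n) :=
  (le_norm_smul_one (posSemidef_of_nonneg hA).isHermitian).trans
    (smul_le_smul_of_coeff_le (norm_le_trace_re hA) zero_le_one)

lemma trace_re_le_mul_norm (hA : 0 ≤ A) : A.trace.re ≤ n * ‖A‖ := by
  have := trace_re_mono (le_norm_smul_one (posSemidef_of_nonneg hA).isHermitian)
  rw [Matrix.trace_smul, Matrix.trace_one] at this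
  simpa [mul_comm] using this

lemma mul_conjTranspose_le (Q : Mat n) : Q * Qᴴ ≤ ((‖Q‖ ^ 2 : ℝ) : ℂ) • (1 : Mat n) := by
  rw [← algebraMap_eq_smul_one]
  exact CStarAlgebra.mul_star_le_algebraMap_norm_sq

lemma conjTranspose_mul_le (Q : Mat n) : Qᴴ * Q ≤ ((‖Q‖ ^ 2 : ℝ) : ℂ) • (1 : Mat n) := by
  rw [← algebraMap_eq_smul_one]
  exact CStarAlgebra.star_mul_le_algebraMap_norm_sq

lemma one_le_smul_mul_conjTranspose {Q : Mat n} (hQ : IsUnit Q) :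
    1 ≤ ((‖Q⁻¹‖ ^ 2 : ℝ) : ℂ) • (Q * Qᴴ) := by
  have hd := (Matrix.isUnit_iff_isUnit_det _).1 hQ
  have h := mul_mul_conjTranspose_le (mul_conjTranspose_le Q⁻¹) Q
  have e : Q * (Q⁻¹ * Q⁻¹ᴴ) * Qᴴ = 1 := by
    rw [← Matrix.mul_assoc, Matrix.mul_nonsing_inv _ hd, Matrix.one_mul,
      ← Matrix.conjTranspose_mul, Matrix.mul_nonsing_inv _ hd, Matrix.conjTranspose_one]
  rw [e] at h
  simpa using h

lemma isUnit_conjTranspose {Q : Mat n} (hQ : IsUnit Q) : IsUnit Qᴴ := hQ.star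

lemma one_le_smul_conjTranspose_mul {Q : Mat n} (hQ : IsUnit Q) :
    1 ≤ ((‖Q⁻¹‖ ^ 2 : ℝ) : ℂ) • (Qᴴ * Q) := by
  have := one_le_smul_mul_conjTranspose (isUnit_conjTranspose hQ)
  rwa [← Matrix.conjTranspose_nonsing_inv, Matrix.l2_opNorm_conjTranspose,
    Matrix.conjTranspose_conjTranspose] at this

lemma trace_mul_re_nonneg (hA : 0 ≤ A) (hB : 0 ≤ B) : 0 ≤ (A * B).trace.re := by
  obtain ⟨X, rfl⟩ := CStarAlgebra.nonneg_iff_eq_star_mul_self.mp hA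
  rw [mul_assoc, Matrix.trace_mul_comm, mul_assoc, ← mul_assoc]
  exact trace_re_nonneg (star_right_conjugate_nonneg hB X)

lemma posDef_of_smul_one_le (hr : 0 < r) (h : (r : ℂ) • (1 : Mat n) ≤ A) : A.PosDef := by
  have h1 : ((r : ℂ) • (1 : Mat n)).PosDef :=
    Matrix.PosDef.one.smul (by exact_mod_cast hr : (0 : ℂ) < (r : ℂ))
  have := h1.add_posSemidef h
  rwa [add_sub_cancel] at this

lemma exists_smul_one_le (hA : A.PosDef) : ∃ r : ℝ, 0 < r ∧ (r : ℂ) • (1 : Mat n) ≤ A := by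
  have hu := hA.isUnit
  refine ⟨(1 + ‖A⁻¹‖)⁻¹, by positivity, ?_⟩
  obtain ⟨X, hX⟩ := CStarAlgebra.nonneg_iff_eq_star_mul_self.mp hA.posSemidef.nonneg
  have hXu : IsUnit X := by
    rw [Matrix.isUnit_iff_isUnit_det] at hu ⊢
    rw [hX, Matrix.det_mul] at hu
    exact isUnit_of_mul_isUnit_right hu
  have h4 : (1 : Mat n) ≤ ((1 + ‖A⁻¹‖ : ℝ) : ℂ) • A := by
    have h5 := one_le_smul_conjTranspose_mul hXu
    have h6 : Xᴴ * X = A := hX.symm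
    rw [h6] at h5
    refine h5.trans (smul_le_smul_of_coeff_le ?_ hA.posSemidef.nonneg)
    have h7 : ‖X⁻¹‖ ^ 2 = ‖A⁻¹‖ := by
      rw [hX, Matrix.mul_inv_rev, sq, ← CStarRing.norm_self_mul_star (x := X⁻¹)]
      congr 2
      exact Matrix.conjTranspose_nonsing_inv X
    rw [h7]; linarith
  have h5 := smul_le_smul_of_le (r := (1 + ‖A⁻¹‖)⁻¹) (by positivity) h4
  rwa [smul_smul, ← Complex.ofReal_mul, inv_mul_cancel₀ (by positivity), Complex.ofReal_one,
    one_smul] at h5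

end Order

/-! ### Imaginary part and self-energy -/

section Basic

variable {n d : ℕ}

lemma imPart_isHermitian (M : Mat n) : (imPart M).IsHermitian := by
  rw [Matrix.IsHermitian, imPart, Matrix.conjTranspose_smul, Matrix.conjTranspose_sub,
    Matrix.conjTranspose_conjTranspose, ← neg_sub M, smul_neg, ← neg_smul]
  congr 1
  simp

lemma imPart_add (A B : Mat n) : imPart (A + B) = imPart A + imPart B := by
  rw [imPart, imPart, imPart, ← smul_add, Matrix.conjTranspose_add]
  congr 1; abel

lemma imPart_sub (A B : Mat n) : imPart (A - B) = imPart A - imPart B := by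
  rw [imPart, imPart, imPart, ← smul_sub, Matrix.conjTranspose_sub]
  congr 1; abel

lemma imPart_of_isHermitian {A : Mat n} (hA : A.IsHermitian) : imPart A = 0 := by
  rw [imPart, hA.eq, sub_self, smul_zero]

lemma imPart_smul_one (z : ℂ) : imPart (z • (1 : Mat n)) = (z.im : ℂ) • (1 : Mat n) := by
  rw [imPart, Matrix.conjTranspose_smul, Matrix.conjTranspose_one, ← sub_smul, smul_smul]
  congr 1
  have h : z - star z = 2 * Complex.I * z.im := by
    rw [Complex.star_def, Complex.sub_conj]; push_cast; ring
  rw [h, ← mul_assoc, inv_mul_cancel₀ (by simp), one_mul]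

lemma imPart_mul_mul_conjTranspose (M Q : Mat n) : imPart (Q * M * Qᴴ) = Q * imPart M * Qᴴ := by
  simp only [imPart, Matrix.conjTranspose_mul, Matrix.conjTranspose_conjTranspose,
    Matrix.mul_smul, Matrix.smul_mul, Matrix.mul_sub, Matrix.sub_mul, Matrix.mul_assoc]

lemma imPart_conjTranspose_mul_mul (M Q : Mat n) : imPart (Qᴴ * M * Q) = Qᴴ * imPart M * Q := by
  have := imPart_mul_mul_conjTranspose M Qᴴ
  rwa [Matrix.conjTranspose_conjTranspose] at this

lemma imPart_conjTranspose (M : Mat n) : imPart Mᴴ = -imPart M := by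
  rw [imPart, imPart, Matrix.conjTranspose_conjTranspose, ← smul_neg, neg_sub]

lemma imPart_neg (M : Mat n) : imPart (-M) = -imPart M := by
  rw [imPart, imPart, Matrix.conjTranspose_neg, ← smul_neg]
  congr 1; abel

lemma re_add_I_smul_imPart (M : Mat n) :
    M = (2 : ℂ)⁻¹ • (M + Mᴴ) + Complex.I • imPart M := by
  rw [imPart, smul_smul]
  have : Complex.I * (2 * Complex.I)⁻¹ = 2⁻¹ := by
    rw [mul_inv]; field_simp
  rw [this, ← smul_add, add_add_sub_cancel, ← two_smul ℂ M, smul_smul]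
  norm_num

lemma trace_imPart_re (M : Mat n) : (imPart M).trace.re = M.trace.im := by
  rw [imPart, Matrix.trace_smul, Matrix.trace_sub, Matrix.trace_conjTranspose, Complex.star_def,
    Complex.sub_conj, smul_eq_mul]
  have : (2 * Complex.I)⁻¹ * ((2 * M.trace.im : ℝ) * Complex.I) = (M.trace.im : ℂ) := by
    push_cast; field_simp
  rw [this, Complex.ofReal_re]

lemma norm_imPart_le (M : Mat n) : ‖imPart M‖ ≤ ‖M‖ := by
  rw [imPart, norm_smul]
  have h := norm_sub_le M Mᴴ
  rw [Matrix.l2_opNorm_conjTranspose] at h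
  have : ‖(2 * Complex.I)⁻¹‖ = 2⁻¹ := by simp
  rw [this]; linarith

lemma sandwich_apply (A B R : Mat n) : sandwich A B R = A * R * B := rfl

lemma selfEnergy_apply (Ls : Fin d → Mat n) (R : Mat n) :
    selfEnergy Ls R = ∑ α, (Ls α * R * (Ls α)ᴴ + (Ls α)ᴴ * R * Ls α) := by
  simp [selfEnergy, sandwich_apply]

variable (Ls : Fin d → Mat n)

lemma selfEnergy_nonneg {R : Mat n} (hR : 0 ≤ R) : 0 ≤ selfEnergy Ls R := by
  rw [selfEnergy_apply]
  refine Finset.sum_nonneg fun α _ => add_nonneg ?_ ?_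
  · exact star_right_conjugate_nonneg hR (Ls α)
  · exact star_left_conjugate_nonneg hR (Ls α)

lemma selfEnergy_conjTranspose (R : Mat n) : selfEnergy Ls Rᴴ = (selfEnergy Ls R)ᴴ := by
  simp only [selfEnergy_apply, Matrix.conjTranspose_sum, Matrix.conjTranspose_add,
    Matrix.conjTranspose_mul, Matrix.conjTranspose_conjTranspose, Matrix.mul_assoc]

lemma imPart_selfEnergy (R : Mat n) : imPart (selfEnergy Ls R) = selfEnergy Ls (imPart R) := by
  rw [imPart, imPart, map_smul, map_sub, selfEnergy_conjTranspose]

lemma trace_selfEnergy_mul (X Y : Mat n) :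
    (selfEnergy Ls X * Y).trace = (X * selfEnergy Ls Y).trace := by
  simp only [selfEnergy_apply, Finset.sum_mul, Finset.mul_sum, Matrix.trace_sum, Matrix.add_mul,
    Matrix.mul_add, Matrix.trace_add]
  refine Finset.sum_congr rfl fun α _ => ?_
  rw [add_comm]
  congr 1
  · rw [Matrix.mul_assoc, Matrix.mul_assoc, Matrix.trace_mul_comm]
    simp only [Matrix.mul_assoc]
  · rw [Matrix.mul_assoc, Matrix.mul_assoc, Matrix.trace_mul_comm]
    simp only [Matrix.mul_assoc]

lemma selfEnergy_conj (Q X : Mat n) :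
    selfEnergy (fun α => Q * Ls α * Qᴴ) X = Q * selfEnergy Ls (Qᴴ * X * Q) * Qᴴ := by
  simp only [selfEnergy_apply, Finset.mul_sum, Finset.sum_mul, Matrix.conjTranspose_mul,
    Matrix.conjTranspose_conjTranspose, Matrix.mul_add, Matrix.add_mul, Matrix.mul_assoc]

lemma exists_norm_apply_le (Γ : Mat n →ₗ[ℂ] Mat n) : ∃ g : ℝ, 0 < g ∧ ∀ X, ‖Γ X‖ ≤ g * ‖X‖ := by
  refine ⟨‖LinearMap.toContinuousLinearMap Γ‖ + 1, by positivity, fun X => ?_⟩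
  have := (LinearMap.toContinuousLinearMap Γ).le_opNorm X
  rw [LinearMap.coe_toContinuousLinearMap'] at this
  nlinarith [norm_nonneg X]

end Basic

/-! ### The Dyson equation at a single spectral parameter -/

/-- `T` solves the matrix Dyson equation at the spectral parameter `z`. -/
def SolvesAt {n : ℕ} (K₀ : Mat n) (Γ : Mat n →ₗ[ℂ] Mat n) (z : ℂ) (T : Mat n) : Prop :=
  (imPart T).PosDef ∧ -T⁻¹ = z • (1 : Mat n) - K₀ + Γ T

/-- The imaginary part `Im z + Γ[Im T]` of `-T⁻¹` for a solution `T` of the Dyson equation. -/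
def invIm {n : ℕ} (Γ : Mat n →ₗ[ℂ] Mat n) (z : ℂ) (T : Mat n) : Mat n :=
  (z.im : ℂ) • (1 : Mat n) + Γ (imPart T)

/-- A kernel vector x of T makes both x*Tx and x*T*x vanish, hence also the quadratic form of Im T
at x. -/
lemma isUnit_of_imPart_posDef {n : ℕ} {T : Mat n} (h : (imPart T).PosDef) : IsUnit T := by
  rw [← Matrix.mulVec_injective_iff_isUnit]
  refine (injective_iff_map_eq_zero (Matrix.mulVecLin T)).2 fun x hx => ?_
  by_contra hx0
  have hx' : T *ᵥ x = 0 := hx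
  have hpos := h.dotProduct_mulVec_pos hx0
  have h1 : star x ⬝ᵥ Tᴴ *ᵥ x = 0 := by
    rw [Matrix.dotProduct_mulVec, ← Matrix.star_mulVec, hx', star_zero, zero_dotProduct]
  rw [imPart, Matrix.smul_mulVec, Matrix.sub_mulVec, hx', zero_sub, dotProduct_smul,
    dotProduct_neg, h1] at hpos
  simp at hpos

section Solution

variable {n d : ℕ} {K₀ : Mat n} {Ls : Fin d → Mat n} {z : ℂ} {T : Mat n}

lemma imPart_neg_inv (hK₀ : K₀.IsHermitian) (h : SolvesAt K₀ (selfEnergy Ls) z T) :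
    imPart (-T⁻¹) = invIm (selfEnergy Ls) z T := by
  rw [h.2, imPart_add, imPart_sub, imPart_smul_one, imPart_of_isHermitian hK₀, sub_zero,
    imPart_selfEnergy, invIm]

/-- Imaginary part of T(-T⁻¹)T* = -T*, with Im(-T⁻¹) read off the equation. Together with its mirror
image below, this is the source of all the a priori bounds. -/
lemma imPart_eq_mul_invIm_mul (hK₀ : K₀.IsHermitian) (h : SolvesAt K₀ (selfEnergy Ls) z T) :
    imPart T = T * invIm (selfEnergy Ls) z T * Tᴴ := by
  have hd := (Matrix.isUnit_iff_isUnit_det _).1 (isUnit_of_imPart_posDef h.1)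
  rw [← imPart_neg_inv hK₀ h, ← imPart_mul_mul_conjTranspose, Matrix.mul_neg,
    Matrix.mul_nonsing_inv _ hd, Matrix.neg_mul, Matrix.one_mul, imPart_neg, imPart_conjTranspose,
    neg_neg]

lemma imPart_eq_conjTranspose_mul_invIm_mul (hK₀ : K₀.IsHermitian)
    (h : SolvesAt K₀ (selfEnergy Ls) z T) :
    imPart T = Tᴴ * invIm (selfEnergy Ls) z T * T := by
  have hd := (Matrix.isUnit_iff_isUnit_det _).1 (isUnit_of_imPart_posDef h.1)
  rw [← imPart_neg_inv hK₀ h, ← imPart_conjTranspose_mul_mul, Matrix.mul_assoc, Matrix.neg_mul,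
    Matrix.nonsing_inv_mul _ hd, Matrix.mul_neg, Matrix.mul_one, imPart_neg, imPart_conjTranspose,
    neg_neg]

end Solution

/-! ### Flatness and entrywise bounds -/

section Entries

variable {n : ℕ}

lemma conj_diagonal_diag_re (Q : Mat n) (w : Fin n → ℝ) (l : Fin n) :
    ((Q * Matrix.diagonal (fun j => (w j : ℂ)) * Qᴴ) l l).re = ∑ j, ‖Q l j‖ ^ 2 * w j := by
  rw [Matrix.mul_apply, Complex.re_sum]
  refine Finset.sum_congr rfl fun j _ => ?_
  rw [Matrix.mul_diagonal, Matrix.conjTranspose_apply, mul_right_comm, Complex.star_def,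
    Complex.mul_conj', ← Complex.ofReal_pow, ← Complex.ofReal_mul, Complex.ofReal_re]

lemma trace_conjTranspose_mul_self_re (A : Mat n) :
    (Aᴴ * A).trace.re = ∑ j, ∑ i, ‖A i j‖ ^ 2 := by
  simp only [Matrix.trace, Matrix.diag_apply, Matrix.mul_apply, Matrix.conjTranspose_apply,
    Complex.re_sum]
  refine Finset.sum_congr rfl fun j _ => Finset.sum_congr rfl fun i _ => ?_
  rw [Complex.star_def, Complex.conj_mul', ← Complex.ofReal_pow, Complex.ofReal_re]

lemma norm_le_of_entry_le {A : Mat n} {b : ℝ} (hb : 0 ≤ b) (h : ∀ i j, ‖A i j‖ ≤ b) :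
    ‖A‖ ≤ n * b := by
  have h1 : ‖A‖ * ‖A‖ ≤ (n * b) * (n * b) := by
    rw [← CStarRing.norm_star_mul_self]
    refine (norm_le_trace_re (star_mul_self_nonneg A)).trans ?_
    rw [Matrix.star_eq_conjTranspose, trace_conjTranspose_mul_self_re]
    calc ∑ j, ∑ i, ‖A i j‖ ^ 2 ≤ ∑ _j : Fin n, ∑ _i : Fin n, b ^ 2 := by
          gcongr with j _ i _; exact h i j
      _ = (n * b) * (n * b) := by simp; ring
  exact abs_le_of_sq_le_sq' (by nlinarith) (by positivity) |>.2

lemma norm_entry_le_norm (A : Mat n) (i j : Fin n) : ‖A i j‖ ≤ ‖A‖ := by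
  have h1 := diag_re_mono (conjTranspose_mul_le A) j
  have h2 : ((Aᴴ * A) j j).re = ∑ i, ‖A i j‖ ^ 2 := by
    rw [Matrix.mul_apply, Complex.re_sum]
    refine Finset.sum_congr rfl fun i _ => ?_
    rw [Matrix.conjTranspose_apply, Complex.star_def, Complex.conj_mul', ← Complex.ofReal_pow,
      Complex.ofReal_re]
  have h3 : ‖A i j‖ ^ 2 ≤ ∑ i, ‖A i j‖ ^ 2 :=
    Finset.single_le_sum (f := fun i => ‖A i j‖ ^ 2) (fun _ _ => by positivity)
      (Finset.mem_univ i)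
  rw [h2, Matrix.smul_apply, Matrix.one_apply_eq, smul_eq_mul, mul_one, Complex.ofReal_re] at h1
  exact (sq_le_sq₀ (norm_nonneg _) (norm_nonneg _)).1 (h3.trans h1)

/-- Otherwise the diagonal entry of T T⁻¹ in row j would have modulus below 1. -/
lemma exists_le_norm_entry {T : Mat n} (hT : IsUnit T) {K : ℝ} (hK : 0 < K) (h : ‖T⁻¹‖ ≤ K)
    (j : Fin n) : ∃ l, (n * K)⁻¹ ≤ ‖T j l‖ := by
  by_contra! hlt
  have hn : 0 < n := j.pos
  have hd := (Matrix.isUnit_iff_isUnit_det _).1 hT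
  have h1 : (T * T⁻¹) j j = 1 := by rw [Matrix.mul_nonsing_inv _ hd, Matrix.one_apply_eq]
  have h2 : ‖(T * T⁻¹) j j‖ < 1 := by
    rw [Matrix.mul_apply]
    calc ‖∑ l, T j l * T⁻¹ l j‖ ≤ ∑ l, ‖T j l‖ * ‖T⁻¹ l j‖ := by
          refine (norm_sum_le _ _).trans (le_of_eq ?_)
          simp
      _ ≤ ∑ l, ‖T j l‖ * K := by
          gcongr with l _
          exact (norm_entry_le_norm _ _ _).trans h
      _ < ∑ _l : Fin n, (n * K)⁻¹ * K := by
          refine Finset.sum_lt_sum_of_nonempty ⟨j, Finset.mem_univ j⟩ fun l _ => ?_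
          exact mul_lt_mul_of_pos_right (hlt l) hK
      _ = 1 := by
          simp only [Finset.sum_const, Finset.card_univ, Fintype.card_fin, nsmul_eq_mul]
          field_simp
  rw [h1, norm_one] at h2
  exact lt_irrefl _ h2

/-- The weights `∑ k, z_{kl} r_{kk}` that appear in the definition of flatness. -/
def flatWeight (Z : Matrix (Fin n) (Fin n) ℕ) (A : Mat n) (l : Fin n) : ℝ :=
  ∑ k, (Z k l : ℝ) * (A k k).re

/-- The flatness estimate with a given pattern `Z` and constant `c`. -/
structure FlatWith (Γ : Mat n →ₗ[ℂ] Mat n) (Z : Matrix (Fin n) (Fin n) ℕ) (c : ℝ) : Prop where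
  one_diag : ∀ k, Z k k = 1
  pos : 0 < c
  le : ∀ A : Mat n, 0 ≤ A → (c : ℂ) • Matrix.diagonal (fun l => (flatWeight Z A l : ℂ)) ≤ Γ A

lemma IsFlat.exists_flatWith {Γ : Mat n →ₗ[ℂ] Mat n} {L : ℕ} (h : IsFlat Γ L) :
    ∃ Z c, FlatWith Γ Z c ∧ ∀ k l, 0 < (Z ^ L) k l := by
  obtain ⟨Z, c, -, h2, h3, h4, h5⟩ := h
  refine ⟨Z, c, ⟨h2, h4, fun A hA => ?_⟩, h3⟩
  have h6 := h5 A (posSemidef_of_nonneg hA)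
  refine (le_of_eq ?_).trans (Matrix.le_iff.2 h6)
  congr 2
  ext l
  rw [flatWeight, Complex.ofReal_sum]
  refine Finset.sum_congr rfl fun k _ => ?_
  rw [Complex.ofReal_mul, ← diag_eq_ofReal (posSemidef_of_nonneg hA).isHermitian]
  simp

lemma flatWeight_nonneg (Z : Matrix (Fin n) (Fin n) ℕ) {A : Mat n} (hA : 0 ≤ A) (l : Fin n) :
    0 ≤ flatWeight Z A l :=
  Finset.sum_nonneg fun k _ => mul_nonneg (Nat.cast_nonneg _) (diag_re_nonneg hA k)

lemma diag_le_flatWeight {Γ : Mat n →ₗ[ℂ] Mat n} {Z : Matrix (Fin n) (Fin n) ℕ} {c : ℝ}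
    (hf : FlatWith Γ Z c) {A : Mat n} (hA : 0 ≤ A) (l : Fin n) :
    (A l l).re ≤ flatWeight Z A l := by
  have : (A l l).re = (Z l l : ℝ) * (A l l).re := by rw [hf.one_diag]; simp
  rw [this]
  exact Finset.single_le_sum (f := fun k => (Z k l : ℝ) * (A k k).re)
    (fun k _ => mul_nonneg (Nat.cast_nonneg _) (diag_re_nonneg hA k)) (Finset.mem_univ l)

lemma smul_one_le_diagonal {w : Fin n → ℝ} {r : ℝ} (h : ∀ l, r ≤ w l) :
    (r : ℂ) • (1 : Mat n) ≤ Matrix.diagonal (fun l => (w l : ℂ)) := by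
  rw [← Matrix.diagonal_one, ← Matrix.diagonal_smul, ← sub_nonneg, Matrix.diagonal_sub]
  refine nonneg_of_posSemidef (Matrix.PosSemidef.diagonal fun l => ?_)
  simpa using h l

/-- Iterating an entrywise lower bound by the pattern `Z`. -/
lemma pow_mul_sum_le_of_step (Z : Matrix (Fin n) (Fin n) ℕ) {δ : ℝ} (hδ : 0 ≤ δ)
    (u : ℕ → Fin n → ℝ) (h : ∀ m j, δ * ∑ k, (Z k j : ℝ) * u m k ≤ u (m + 1) j) (m : ℕ) :
    ∀ j, δ ^ m * ∑ k, ((Z ^ m) k j : ℝ) * u 0 k ≤ u m j := by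
  induction m with
  | zero => intro j; simp [Matrix.one_apply]
  | succ m ih =>
    intro j
    refine le_trans (le_of_eq ?_) ((mul_le_mul_of_nonneg_left (Finset.sum_le_sum fun k _ =>
      mul_le_mul_of_nonneg_left (ih k) (Nat.cast_nonneg _)) hδ).trans (h m j))
    have : ∀ k, (((Z ^ (m + 1)) k j : ℕ) : ℝ) = ∑ i, ((Z ^ m) k i : ℝ) * (Z i j : ℝ) := by
      intro k; rw [pow_succ, Matrix.mul_apply]; push_cast; rfl
    simp only [this, Finset.sum_mul, Finset.mul_sum]
    rw [Finset.sum_comm]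
    refine Finset.sum_congr rfl fun i _ => Finset.sum_congr rfl fun k _ => ?_
    ring

/-- After L steps every index reaches every other, because the entries of Z^L are positive integers
and hence at least 1. -/
lemma pow_mul_sum_le {Z : Matrix (Fin n) (Fin n) ℕ} {L : ℕ} (hZ : ∀ k l, 0 < (Z ^ L) k l)
    {δ : ℝ} (hδ : 0 ≤ δ) (u : ℕ → Fin n → ℝ) (hu : ∀ k, 0 ≤ u 0 k)
    (h : ∀ m j, δ * ∑ k, (Z k j : ℝ) * u m k ≤ u (m + 1) j) (j : Fin n) :
    δ ^ L * ∑ k, u 0 k ≤ u L j := by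
  refine le_trans ?_ (pow_mul_sum_le_of_step Z hδ u h L j)
  refine mul_le_mul_of_nonneg_left (Finset.sum_le_sum fun k _ => ?_) (by positivity)
  have : (1 : ℝ) ≤ ((Z ^ L) k j : ℕ) := by exact_mod_cast hZ k j
  nlinarith [hu k]

end Entries

/-! ### Bounds on solutions -/

section Bounds

variable {n d : ℕ} {K₀ : Mat n} {Ls : Fin d → Mat n} {Z : Matrix (Fin n) (Fin n) ℕ} {c : ℝ}
  {z : ℂ} {T : Mat n}

lemma flat_le_invIm (hf : FlatWith (selfEnergy Ls) Z c) (hz : 0 < z.im)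
    (h : (imPart T).PosDef) :
    (c : ℂ) • Matrix.diagonal (fun l => (flatWeight Z (imPart T) l : ℂ)) ≤
      invIm (selfEnergy Ls) z T := by
  refine (hf.le _ (nonneg_of_posSemidef h.posSemidef)).trans ?_
  exact le_add_of_nonneg_left (smul_nonneg_of_nonneg hz.le zero_le_one)

lemma mul_entry_sq_le_left (hK₀ : K₀.IsHermitian) (hf : FlatWith (selfEnergy Ls) Z c)
    (hz : 0 < z.im) (h : SolvesAt K₀ (selfEnergy Ls) z T) (l j : Fin n) :
    c * (‖T l j‖ ^ 2 * flatWeight Z (imPart T) j) ≤ (imPart T l l).re := by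
  have h1 := diag_re_mono (mul_mul_conjTranspose_le (flat_le_invIm hf hz h.1) T) l
  rw [← imPart_eq_mul_invIm_mul hK₀ h, Matrix.mul_smul, Matrix.smul_mul, Matrix.smul_apply,
    smul_eq_mul, Complex.re_ofReal_mul, conj_diagonal_diag_re] at h1
  refine le_trans (mul_le_mul_of_nonneg_left ?_ hf.pos.le) h1
  exact Finset.single_le_sum (f := fun j => ‖T l j‖ ^ 2 * flatWeight Z (imPart T) j)
    (fun j _ => mul_nonneg (by positivity)
      (flatWeight_nonneg Z (nonneg_of_posSemidef h.1.posSemidef) j)) (Finset.mem_univ j)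

lemma mul_entry_sq_le_right (hK₀ : K₀.IsHermitian) (hf : FlatWith (selfEnergy Ls) Z c)
    (hz : 0 < z.im) (h : SolvesAt K₀ (selfEnergy Ls) z T) (l j : Fin n) :
    c * (‖T j l‖ ^ 2 * flatWeight Z (imPart T) j) ≤ (imPart T l l).re := by
  have h1 := diag_re_mono (conjTranspose_mul_mul_le (flat_le_invIm hf hz h.1) T) l
  have h2 := conj_diagonal_diag_re Tᴴ (flatWeight Z (imPart T)) l
  rw [Matrix.conjTranspose_conjTranspose] at h2
  rw [← imPart_eq_conjTranspose_mul_invIm_mul hK₀ h, Matrix.mul_smul, Matrix.smul_mul,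
    Matrix.smul_apply, smul_eq_mul, Complex.re_ofReal_mul, h2] at h1
  refine le_trans (mul_le_mul_of_nonneg_left ?_ hf.pos.le) h1
  have := Finset.single_le_sum (f := fun j => ‖Tᴴ l j‖ ^ 2 * flatWeight Z (imPart T) j)
    (fun j _ => mul_nonneg (by positivity)
      (flatWeight_nonneg Z (nonneg_of_posSemidef h.1.posSemidef) j)) (Finset.mem_univ j)
  simpa only [Matrix.conjTranspose_apply, norm_star] using this

/-- The two identities for Im T bound the diagonal entries at j and l by each other, both times with
the factor c|T_{jl}|². A factor above 1 would be contradictory, since both entries are positive. -/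
lemma entry_sq_le (hK₀ : K₀.IsHermitian) (hf : FlatWith (selfEnergy Ls) Z c)
    (hz : 0 < z.im) (h : SolvesAt K₀ (selfEnergy Ls) z T) (j l : Fin n) :
    c * ‖T j l‖ ^ 2 ≤ 1 := by
  have hV := nonneg_of_posSemidef h.1.posSemidef
  have hl : 0 < (imPart T l l).re := (Complex.lt_def.1 (h.1.diag_pos (i := l))).1
  have hj : 0 < (imPart T j j).re := (Complex.lt_def.1 (h.1.diag_pos (i := j))).1
  have h1 := mul_entry_sq_le_right hK₀ hf hz h l j
  have h2 := mul_entry_sq_le_left hK₀ hf hz h j l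
  have h3 := diag_le_flatWeight hf hV j
  have h4 := diag_le_flatWeight hf hV l
  set t := ‖T j l‖ ^ 2 with ht
  have ht0 : 0 ≤ c * t := mul_nonneg hf.pos.le (by positivity)
  have h5 : c * t * (imPart T j j).re ≤ (imPart T l l).re := by
    nlinarith [mul_le_mul_of_nonneg_left h3 ht0]
  have h6 : c * t * (imPart T l l).re ≤ (imPart T j j).re := by
    nlinarith [mul_le_mul_of_nonneg_left h4 ht0]
  by_contra! hlt
  nlinarith

lemma norm_one_le_one : ‖(1 : Mat n)‖ ≤ 1 :=
  norm_le_of_le_smul_one zero_le_one zero_le_one (by simp)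

lemma norm_inv_le_of_solvesAt {C g : ℝ} (hg : ∀ X, ‖selfEnergy Ls X‖ ≤ g * ‖X‖) (hg0 : 0 ≤ g)
    (h : SolvesAt K₀ (selfEnergy Ls) z T) (hT : ‖T‖ ≤ C) :
    ‖T⁻¹‖ ≤ ‖z‖ + (‖K₀‖ + g * C) := by
  rw [← norm_neg, h.2]
  have h1 : ‖z • (1 : Mat n)‖ ≤ ‖z‖ := by
    rw [norm_smul]
    exact mul_le_of_le_one_right (norm_nonneg _) norm_one_le_one
  have h2 := (hg T).trans (mul_le_mul_of_nonneg_left hT hg0)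
  linarith [norm_add_le (z • (1 : Mat n) - K₀) (selfEnergy Ls T), norm_sub_le (z • (1 : Mat n)) K₀]

/-- Multiplying the equation by T gives zT = -1 + (K₀ - Γ[T])T. This is what forces T to decay like
1/|z| at infinity. -/
lemma norm_mul_norm_le_of_solvesAt {C g : ℝ} (hg : ∀ X, ‖selfEnergy Ls X‖ ≤ g * ‖X‖)
    (hg0 : 0 ≤ g) (h : SolvesAt K₀ (selfEnergy Ls) z T) (hT : ‖T‖ ≤ C) :
    ‖z‖ * ‖T‖ ≤ 1 + (‖K₀‖ + g * C) * ‖T‖ := by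
  have hd := (Matrix.isUnit_iff_isUnit_det _).1 (isUnit_of_imPart_posDef h.1)
  have h0 : z • T = -1 + (K₀ - selfEnergy Ls T) * T := by
    have h1 : z • (1 : Mat n) = -T⁻¹ + (K₀ - selfEnergy Ls T) := by rw [h.2]; abel
    have h2 := congrArg (· * T) h1
    simpa [Matrix.add_mul, Matrix.nonsing_inv_mul _ hd] using h2
  rw [← norm_smul, h0]
  have h2 := (hg T).trans (mul_le_mul_of_nonneg_left hT hg0)
  refine (norm_add_le _ _).trans (add_le_add (by rw [norm_neg]; exact norm_one_le_one) ?_)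
  refine (norm_mul_le _ _).trans (mul_le_mul_of_nonneg_right ?_ (norm_nonneg _))
  linarith [norm_sub_le K₀ (selfEnergy Ls T)]

/-- Solutions of the Dyson equation are bounded, and their inverses grow at most linearly. -/
lemma exists_norm_bounds (hK₀ : K₀.IsHermitian) (hf : FlatWith (selfEnergy Ls) Z c) :
    ∃ C : ℝ, 0 < C ∧ ∀ z T, 0 < z.im → SolvesAt K₀ (selfEnergy Ls) z T →
      ‖T‖ ≤ C ∧ ‖T⁻¹‖ ≤ ‖z‖ + C ∧ ‖z‖ * ‖T‖ ≤ 1 + C * ‖T‖ := by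
  obtain ⟨g, hg0, hg⟩ := exists_norm_apply_le (selfEnergy Ls)
  set C₁ : ℝ := n * Real.sqrt (1 / c)
  have hC₁ : 0 ≤ C₁ := by positivity
  refine ⟨C₁ + (‖K₀‖ + g * C₁) + 1, by positivity, fun z T hz h => ?_⟩
  have hB : 0 ≤ ‖K₀‖ + g * C₁ := by positivity
  have h1 : ‖T‖ ≤ C₁ := by
    refine norm_le_of_entry_le (Real.sqrt_nonneg _) fun i j => Real.le_sqrt_of_sq_le ?_
    rw [le_div_iff₀ hf.pos, mul_comm]
    exact entry_sq_le hK₀ hf hz h i j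
  have h2 := norm_inv_le_of_solvesAt hg hg0.le h h1
  have h3 := norm_mul_norm_le_of_solvesAt hg hg0.le h h1
  refine ⟨by linarith, by linarith, h3.trans ?_⟩
  have h4 : (‖K₀‖ + g * C₁) * ‖T‖ ≤ (C₁ + (‖K₀‖ + g * C₁) + 1) * ‖T‖ :=
    mul_le_mul_of_nonneg_right (by linarith) (norm_nonneg T)
  linarith

/-- For bounded inverse, all diagonal entries of `Im T` are comparable to the trace. -/
lemma exists_mul_trace_le_diag {L : ℕ} (hK₀ : K₀.IsHermitian) (hf : FlatWith (selfEnergy Ls) Z c)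
    (hZ : ∀ k l, 0 < (Z ^ L) k l) (hn : 0 < n) {K : ℝ} (hK : 0 < K) :
    ∃ a : ℝ, 0 < a ∧ ∀ z T, 0 < z.im → SolvesAt K₀ (selfEnergy Ls) z T → ‖T⁻¹‖ ≤ K →
      ∀ l, a * (imPart T).trace.re ≤ (imPart T l l).re := by
  have hn' : (0 : ℝ) < n := by exact_mod_cast hn
  have hc := hf.pos
  set t : ℝ := c * ((n * K)⁻¹) ^ 2 with ht
  have ht0 : 0 < t := by positivity
  refine ⟨(t * t) ^ L, by positivity, fun z T hz h hT l => ?_⟩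
  have hV := nonneg_of_posSemidef h.1.posSemidef
  have htr : (imPart T).trace.re = ∑ k, (imPart T k k).re := by
    simp [Matrix.trace]
  rw [htr]
  -- The iterated sequence is constant. A single step passes from j through a large entry T j i and
  -- back: v_i ≥ t w_j by one identity and v_j ≥ t v_i by the other, so t² is the cost of one step.
  refine pow_mul_sum_le hZ (by positivity) (fun _ k => (imPart T k k).re)
    (fun k => diag_re_nonneg hV k) (fun _ j => ?_) l
  obtain ⟨i, hi⟩ := exists_le_norm_entry (isUnit_of_imPart_posDef h.1) hK hT j
  have h1 := mul_entry_sq_le_right hK₀ hf hz h i j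
  have h2 := mul_entry_sq_le_left hK₀ hf hz h j i
  have h3 := diag_le_flatWeight hf hV i
  have hw := flatWeight_nonneg Z hV j
  have hw' := flatWeight_nonneg Z hV i
  have hvi := diag_re_nonneg hV i
  have hi2 : t ≤ c * ‖T j i‖ ^ 2 := by rw [ht]; gcongr
  change t * t * flatWeight Z (imPart T) j ≤ (imPart T j j).re
  calc t * t * flatWeight Z (imPart T) j = t * (t * flatWeight Z (imPart T) j) := by ring
    _ ≤ t * (c * ‖T j i‖ ^ 2 * flatWeight Z (imPart T) j) := by gcongr
    _ ≤ t * (imPart T i i).re := by gcongr; linarith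
    _ ≤ c * ‖T j i‖ ^ 2 * (imPart T i i).re := by gcongr
    _ ≤ c * ‖T j i‖ ^ 2 * flatWeight Z (imPart T) i := by gcongr
    _ ≤ (imPart T j j).re := by linarith

/-- For bounded inverse, `Im T` and `Im (-T⁻¹)` are comparable to the trace of `Im T`. -/
lemma exists_comparable_of_norm_inv_le {L : ℕ} (hK₀ : K₀.IsHermitian)
    (hf : FlatWith (selfEnergy Ls) Z c) (hZ : ∀ k l, 0 < (Z ^ L) k l) (hn : 0 < n)
    {K : ℝ} (hK : 0 < K) :
    ∃ a b : ℝ, 0 < a ∧ 0 < b ∧ ∀ z T, 0 < z.im → SolvesAt K₀ (selfEnergy Ls) z T → ‖T⁻¹‖ ≤ K →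
      ((a * (imPart T).trace.re : ℝ) : ℂ) • (1 : Mat n) ≤ imPart T ∧
      ((a * (imPart T).trace.re : ℝ) : ℂ) • (1 : Mat n) ≤ invIm (selfEnergy Ls) z T ∧
      invIm (selfEnergy Ls) z T ≤ ((b * (imPart T).trace.re : ℝ) : ℂ) • (1 : Mat n) := by
  obtain ⟨a, ha, hdiag⟩ := exists_mul_trace_le_diag hK₀ hf hZ hn hK
  have hc := hf.pos
  -- With N = `invIm`: flatness gives N ≥ caτ; then Im T = T N T* ≥ caτ/K², and N = T⁻¹ (Im T) T⁻¹*
  -- ≤ K²τ.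
  refine ⟨min (c * a) ((K ^ 2)⁻¹ * (c * a)), K ^ 2, by positivity, by positivity,
    fun z T hz h hT => ?_⟩
  have hu := isUnit_of_imPart_posDef h.1
  have hd := (Matrix.isUnit_iff_isUnit_det _).1 hu
  have hV := nonneg_of_posSemidef h.1.posSemidef
  set τ := (imPart T).trace.re with hτ
  have hτ0 : 0 ≤ τ := trace_re_nonneg hV
  have hN : ((c * a * τ : ℝ) : ℂ) • (1 : Mat n) ≤ invIm (selfEnergy Ls) z T := by
    refine le_trans ?_ (flat_le_invIm hf hz h.1)
    rw [mul_assoc, Complex.ofReal_mul, mul_smul]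
    refine smul_le_smul_of_le hc.le (smul_one_le_diagonal fun l => ?_)
    exact (hdiag z T hz h hT l).trans (diag_le_flatWeight hf hV l)
  refine ⟨?_, ?_, ?_⟩
  · have h1 := mul_mul_conjTranspose_le hN T
    rw [← imPart_eq_mul_invIm_mul hK₀ h, Matrix.mul_smul, Matrix.mul_one, Matrix.smul_mul] at h1
    refine le_trans ?_ h1
    have h3 : (1 : Mat n) ≤ ((K ^ 2 : ℝ) : ℂ) • (T * Tᴴ) := by
      refine (one_le_smul_mul_conjTranspose hu).trans (smul_le_smul_of_coeff_le ?_
        (mul_star_self_nonneg T))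
      gcongr
    have h4 := smul_le_smul_of_le (r := (K ^ 2)⁻¹ * (c * a) * τ) (by positivity) h3
    refine (smul_le_smul_of_coeff_le ?_ zero_le_one).trans (h4.trans (le_of_eq ?_))
    · gcongr; exact min_le_right _ _
    · rw [smul_smul, ← Complex.ofReal_mul]
      congr 2
      field_simp
  · refine (smul_le_smul_of_coeff_le ?_ zero_le_one).trans hN
    gcongr; exact min_le_left _ _
  · have h1 : invIm (selfEnergy Ls) z T = T⁻¹ * imPart T * T⁻¹ᴴ := by
      rw [imPart_eq_mul_invIm_mul hK₀ h, ← Matrix.mul_assoc, ← Matrix.mul_assoc,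
        Matrix.nonsing_inv_mul _ hd, Matrix.one_mul, Matrix.mul_assoc,
        ← Matrix.conjTranspose_mul, Matrix.nonsing_inv_mul _ hd, Matrix.conjTranspose_one,
        Matrix.mul_one]
    rw [h1]
    refine (mul_mul_conjTranspose_le (le_trace_smul_one hV) T⁻¹).trans ?_
    rw [Matrix.mul_smul, Matrix.mul_one, Matrix.smul_mul]
    refine (smul_le_smul_of_le hτ0 (mul_conjTranspose_le T⁻¹)).trans ?_
    rw [smul_smul, ← Complex.ofReal_mul]
    refine smul_le_smul_of_coeff_le ?_ zero_le_one
    rw [mul_comm]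
    gcongr

/-- For small solutions, `Im T` is bounded below by its trace. -/
lemma exists_mul_trace_le_of_norm_large (hK₀ : K₀.IsHermitian)
    (hf : FlatWith (selfEnergy Ls) Z c) :
    ∃ a R : ℝ, 0 < a ∧ 0 < R ∧ ∀ z T, 0 < z.im → SolvesAt K₀ (selfEnergy Ls) z T → R ≤ ‖z‖ →
      ((a * (imPart T).trace.re : ℝ) : ℂ) • (1 : Mat n) ≤ imPart T ∧ ‖z‖ * ‖T‖ ≤ 2 := by
  obtain ⟨g, hg0, hg⟩ := exists_norm_apply_le (selfEnergy Ls)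
  obtain ⟨C, hC, hb⟩ := exists_norm_bounds hK₀ hf
  -- Beyond this radius |z|‖T‖ ≤ 2 and 8g ≤ |z|², so the Γ term can be absorbed and |z|²‖Im T‖ ≤ 8
  -- Im z. From below, Im T ≥ Im z/(4|z|²). Comparing the two with the trace costs the factor 32n.
  refine ⟨(32 * (n + 1))⁻¹, 2 * C + (8 * g + 1), by positivity, by positivity,
    fun z T hz h hR => ?_⟩
  obtain ⟨h1, h2, h3⟩ := hb z T hz h
  have hV := nonneg_of_posSemidef h.1.posSemidef
  have hu := isUnit_of_imPart_posDef h.1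
  have hx : 0 < ‖z‖ := by linarith
  have hzT : ‖z‖ * ‖T‖ ≤ 2 := by nlinarith [norm_nonneg T]
  refine ⟨?_, hzT⟩
  have hup : ‖z‖ ^ 2 * ‖imPart T‖ ≤ 8 * z.im := by
    have e1 : ‖imPart T‖ ≤ ‖T‖ * (z.im + g * ‖imPart T‖) * ‖T‖ := by
      conv_lhs => rw [imPart_eq_mul_invIm_mul hK₀ h]
      refine (norm_mul_le _ _).trans ?_
      rw [Matrix.l2_opNorm_conjTranspose]
      gcongr
      refine (norm_mul_le _ _).trans ?_
      gcongr
      refine (norm_add_le _ _).trans (add_le_add ?_ (hg _))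
      rw [norm_smul, Complex.norm_real, Real.norm_of_nonneg hz.le]
      exact mul_le_of_le_one_right hz.le norm_one_le_one
    have e2 : ‖z‖ ^ 2 * ‖imPart T‖ ≤ 4 * (z.im + g * ‖imPart T‖) := by
      calc ‖z‖ ^ 2 * ‖imPart T‖ ≤ ‖z‖ ^ 2 * (‖T‖ * (z.im + g * ‖imPart T‖) * ‖T‖) := by gcongr
        _ = (‖z‖ * ‖T‖) ^ 2 * (z.im + g * ‖imPart T‖) := by ring
        _ ≤ 2 ^ 2 * (z.im + g * ‖imPart T‖) := by gcongr
        _ = 4 * (z.im + g * ‖imPart T‖) := by ring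
    have e3 : 8 * g * ‖imPart T‖ ≤ ‖z‖ ^ 2 * ‖imPart T‖ := by
      gcongr
      nlinarith
    linarith
  have hlow : ((z.im : ℝ) : ℂ) • (1 : Mat n) ≤ ((‖T⁻¹‖ ^ 2 : ℝ) : ℂ) • imPart T := by
    have e1 : ((z.im : ℝ) : ℂ) • (1 : Mat n) ≤ invIm (selfEnergy Ls) z T :=
      le_add_of_nonneg_right (selfEnergy_nonneg Ls hV)
    have e2 := mul_mul_conjTranspose_le e1 T
    rw [← imPart_eq_mul_invIm_mul hK₀ h, Matrix.mul_smul, Matrix.mul_one, Matrix.smul_mul] at e2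
    have e3 := smul_le_smul_of_le hz.le (one_le_smul_mul_conjTranspose hu)
    refine e3.trans ?_
    rw [smul_comm]
    exact smul_le_smul_of_le (by positivity) e2
  have hinv : ‖T⁻¹‖ ^ 2 ≤ 4 * ‖z‖ ^ 2 := by
    have : ‖T⁻¹‖ ≤ 2 * ‖z‖ := by linarith
    calc ‖T⁻¹‖ ^ 2 ≤ (2 * ‖z‖) ^ 2 := by gcongr
      _ = 4 * ‖z‖ ^ 2 := by ring
  have h4 : ((z.im : ℝ) : ℂ) • (1 : Mat n) ≤ ((4 * ‖z‖ ^ 2 : ℝ) : ℂ) • imPart T :=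
    hlow.trans (smul_le_smul_of_coeff_le hinv hV)
  have h5 := smul_le_smul_of_le (r := (4 * ‖z‖ ^ 2)⁻¹) (by positivity) h4
  rw [smul_smul, smul_smul, ← Complex.ofReal_mul, ← Complex.ofReal_mul,
    inv_mul_cancel₀ (by positivity), Complex.ofReal_one, one_smul] at h5
  refine le_trans (smul_le_smul_of_coeff_le ?_ zero_le_one) h5
  have h6 := trace_re_le_mul_norm hV
  rw [inv_mul_eq_div, inv_mul_eq_div, div_le_div_iff₀ (by positivity) (by positivity)]
  calc (imPart T).trace.re * (4 * ‖z‖ ^ 2) ≤ n * ‖imPart T‖ * (4 * ‖z‖ ^ 2) := by gcongr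
    _ = 4 * n * (‖z‖ ^ 2 * ‖imPart T‖) := by ring
    _ ≤ 4 * n * (8 * z.im) := by gcongr
    _ ≤ z.im * (32 * (n + 1)) := by nlinarith

/-- `Im T` is bounded below by a multiple of its trace. -/
lemma exists_mul_trace_smul_one_le {L : ℕ} (hK₀ : K₀.IsHermitian)
    (hf : FlatWith (selfEnergy Ls) Z c) (hZ : ∀ k l, 0 < (Z ^ L) k l) (hn : 0 < n) :
    ∃ a : ℝ, 0 < a ∧ ∀ z T, 0 < z.im → SolvesAt K₀ (selfEnergy Ls) z T →
      ((a * (imPart T).trace.re : ℝ) : ℂ) • (1 : Mat n) ≤ imPart T := by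
  obtain ⟨C, hC, hb⟩ := exists_norm_bounds hK₀ hf
  obtain ⟨a₁, R, ha₁, hR, h₁⟩ := exists_mul_trace_le_of_norm_large hK₀ hf
  obtain ⟨a₂, b, ha₂, -, h₂⟩ := exists_comparable_of_norm_inv_le hK₀ hf hZ hn
    (show 0 < R + C by positivity)
  refine ⟨min a₁ a₂, lt_min ha₁ ha₂, fun z T hz h => ?_⟩
  have hτ := trace_re_nonneg (nonneg_of_posSemidef h.1.posSemidef)
  rcases le_total R ‖z‖ with hle | hle
  · refine (smul_le_smul_of_coeff_le ?_ zero_le_one).trans (h₁ z T hz h hle).1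
    gcongr; exact min_le_left _ _
  · refine (smul_le_smul_of_coeff_le ?_ zero_le_one).trans
      (h₂ z T hz h ((hb z T hz h).2.1.trans (by linarith))).1
    gcongr; exact min_le_right _ _

end Bounds

/-! ### Balanced polar decomposition -/

section Polar

variable {n : ℕ}

lemma isUnit_sqrt {A : Mat n} (hA : A.PosDef) : IsUnit (CFC.sqrt A) := by
  have h := CFC.sqrt_mul_sqrt_self A (nonneg_of_posSemidef hA.posSemidef)
  have hu := hA.isUnit
  rw [← h, Matrix.isUnit_iff_isUnit_det, Matrix.det_mul] at hu
  exact (Matrix.isUnit_iff_isUnit_det _).2 (isUnit_of_mul_isUnit_left hu)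

lemma sqrt_isHermitian (A : Mat n) : (CFC.sqrt A).IsHermitian :=
  (posSemidef_of_nonneg (CFC.sqrt_nonneg A)).isHermitian

lemma sqrt_posDef {A : Mat n} (hA : A.PosDef) : (CFC.sqrt A).PosDef :=
  (posSemidef_of_nonneg (CFC.sqrt_nonneg A)).posDef_iff_isUnit.2 (isUnit_sqrt hA)

lemma commute_sqrt {A B : Mat n} (h : Commute A B) : Commute (CFC.sqrt A) B :=
  h.cfcₙ_nnreal NNReal.sqrt

/-- A matrix with positive definite imaginary part is congruent to a unitary matrix. -/
lemma exists_balanced_polar {T : Mat n} (h : (imPart T).PosDef) :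
    ∃ Q U : Mat n, IsUnit Q ∧ U * Uᴴ = 1 ∧ Uᴴ * U = 1 ∧ T = Qᴴ * U * Q := by
  set v := CFC.sqrt (imPart T) with hv
  have hvu : IsUnit v := isUnit_sqrt h
  have hvd := (Matrix.isUnit_iff_isUnit_det _).1 hvu
  have hvH : vᴴ = v := sqrt_isHermitian _
  have hvv : v * v = imPart T := CFC.sqrt_mul_sqrt_self _ (nonneg_of_posSemidef h.posSemidef)
  set A : Mat n := (2 : ℂ)⁻¹ • (T + Tᴴ) with hA
  have hAH : Aᴴ = A := by
    rw [hA, Matrix.conjTranspose_smul, Matrix.conjTranspose_add, Matrix.conjTranspose_conjTranspose,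
      add_comm]
    simp
  -- With v = (Im T)^{1/2} one has T = v(B + i)v, B Hermitian. The normal matrix P = B + i has
  -- modulus `W₂` = (1 + B²)^{1/2}; its polar decomposition is split evenly as P = W U W with W =
  -- `W₂`^{1/2}, and Q = W v.
  set B : Mat n := v⁻¹ * A * v⁻¹ with hB
  have hBH : Bᴴ = B := by
    rw [hB, Matrix.conjTranspose_mul, Matrix.conjTranspose_mul, Matrix.conjTranspose_nonsing_inv,
      hvH, hAH, Matrix.mul_assoc]
  set D : Mat n := 1 + B * B with hD
  have hDpos : D.PosDef := by
    refine Matrix.PosDef.one.add_posSemidef ?_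
    have := Matrix.posSemidef_conjTranspose_mul_self B
    rwa [hBH] at this
  have hcD : Commute D B := (Commute.one_left B).add_left ((Commute.refl B).mul_left (Commute.refl B))
  set W₂ := CFC.sqrt D with hW₂
  have hW₂pos : W₂.PosDef := sqrt_posDef hDpos
  have hW₂d := (Matrix.isUnit_iff_isUnit_det _).1 hW₂pos.isUnit
  have hcW₂ : Commute W₂ B := commute_sqrt hcD
  have hW₂W₂ : W₂ * W₂ = D := CFC.sqrt_mul_sqrt_self _ (nonneg_of_posSemidef hDpos.posSemidef)
  set W := CFC.sqrt W₂ with hW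
  have hWu : IsUnit W := isUnit_sqrt hW₂pos
  have hWd := (Matrix.isUnit_iff_isUnit_det _).1 hWu
  have hcW : Commute W B := commute_sqrt hcW₂
  have hWH : Wᴴ = W := sqrt_isHermitian _
  have hWW : W * W = W₂ := CFC.sqrt_mul_sqrt_self _ (nonneg_of_posSemidef hW₂pos.posSemidef)
  set P : Mat n := B + Complex.I • (1 : Mat n) with hP
  have hcWP : Commute W P := hcW.add_right ((Commute.one_right W).smul_right _)
  have hcW₂P : Commute W₂ P := hcW₂.add_right ((Commute.one_right W₂).smul_right _)
  have hPP : P * Pᴴ = W₂ * W₂ := by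
    rw [hW₂W₂, hP, hD, Matrix.conjTranspose_add, hBH, Matrix.conjTranspose_smul,
      Matrix.conjTranspose_one, Matrix.add_mul, Matrix.mul_add, Matrix.mul_add]
    simp [smul_smul]
    abel
  have hinvP : W₂⁻¹ * P = P * W₂⁻¹ := by
    have h1 : W₂⁻¹ * (W₂ * P) * W₂⁻¹ = W₂⁻¹ * (P * W₂) * W₂⁻¹ := by rw [hcW₂P.eq]
    rw [Matrix.nonsing_inv_mul_cancel_left _ _ hW₂d, Matrix.mul_assoc, Matrix.mul_assoc P,
      Matrix.mul_nonsing_inv _ hW₂d, Matrix.mul_one] at h1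
    exact h1.symm
  have hU : P * W₂⁻¹ * (P * W₂⁻¹)ᴴ = 1 := by
    rw [← hinvP, Matrix.conjTranspose_mul, Matrix.conjTranspose_nonsing_inv,
      hW₂pos.isHermitian.eq, Matrix.mul_assoc, ← Matrix.mul_assoc P, hPP,
      Matrix.mul_nonsing_inv_cancel_right _ _ hW₂d, Matrix.nonsing_inv_mul _ hW₂d]
  refine ⟨W * v, P * W₂⁻¹, hWu.mul hvu, hU, mul_eq_one_comm.1 hU, ?_⟩
  have hWinv : W₂⁻¹ = W⁻¹ * W⁻¹ := by rw [← hWW, Matrix.mul_inv_rev]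
  have h1 : W * (P * W₂⁻¹) * W = P := by
    rw [← Matrix.mul_assoc, hcWP.eq, hWinv, Matrix.mul_assoc, Matrix.mul_assoc P,
      Matrix.nonsing_inv_mul_cancel_right _ _ hWd, Matrix.mul_nonsing_inv _ hWd, Matrix.mul_one]
  calc T = A + Complex.I • imPart T := re_add_I_smul_imPart T
    _ = v * P * v := by
      have hvBv : v * B * v = A := by
        rw [hB, Matrix.mul_assoc v⁻¹, Matrix.mul_nonsing_inv_cancel_left _ _ hvd,
          Matrix.nonsing_inv_mul_cancel_right _ _ hvd]
      rw [hP, Matrix.mul_add, Matrix.add_mul, hvBv, Matrix.mul_smul v Complex.I, Matrix.mul_one,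
        Matrix.smul_mul, hvv]
    _ = v * (W * (P * W₂⁻¹) * W) * v := by rw [h1]
    _ = (W * v)ᴴ * (P * W₂⁻¹) * (W * v) := by
      rw [Matrix.conjTranspose_mul, hvH, hWH]
      simp only [Matrix.mul_assoc]

end Polar

/-! ### The Hilbert–Schmidt inner product and positive contractions -/

section Hilbert

/-- Symmetry and Cauchy–Schwarz: the norms along an orbit form a log-convex sequence. The map e
carries the inner product, because the norm on the matrix space itself is the operator norm. -/
lemma norm_pow_succ_apply_sq_le {V E : Type*} [AddCommGroup V] [Module ℂ V]
    [NormedAddCommGroup E] [InnerProductSpace ℂ E] (e : V →ₗ[ℂ] E) (H : Module.End ℂ V)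
    (hsym : ∀ x y, inner ℂ (e (H x)) (e y) = inner ℂ (e x) (e (H y))) (x : V) (k : ℕ) :
    ‖e ((H ^ (k + 1)) x)‖ ^ 2 ≤ ‖e ((H ^ k) x)‖ * ‖e ((H ^ (k + 2)) x)‖ := by
  have h1 : (inner ℂ (e ((H ^ (k + 1)) x)) (e ((H ^ (k + 1)) x)) : ℂ) =
      inner ℂ (e ((H ^ k) x)) (e ((H ^ (k + 2)) x)) := by
    have h2 : ∀ m, (H ^ (m + 1)) x = H ((H ^ m) x) := fun m => by
      rw [pow_succ']; rfl
    conv_lhs => rw [h2 k, hsym]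
    rw [← h2 k, ← h2 (k + 1)]
  calc ‖e ((H ^ (k + 1)) x)‖ ^ 2 = ‖inner ℂ (e ((H ^ k) x)) (e ((H ^ (k + 2)) x))‖ := by
        rw [← h1, inner_self_eq_norm_sq_to_K, norm_pow]; simp
    _ ≤ _ := norm_inner_le_norm _ _

/-- A symmetric operator contracts by the exponential growth rate of its orbits. -/
lemma norm_apply_le_of_norm_pow_apply_le {V E : Type*} [AddCommGroup V] [Module ℂ V]
    [NormedAddCommGroup E] [InnerProductSpace ℂ E] (e : V →ₗ[ℂ] E) (H : Module.End ℂ V)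
    (hsym : ∀ x y, inner ℂ (e (H x)) (e y) = inner ℂ (e x) (e (H y))) {q C : ℝ} (hq : 0 ≤ q)
    (x : V) (h : ∀ k : ℕ, ‖e ((H ^ k) x)‖ ≤ C * q ^ k) : ‖e (H x)‖ ≤ q * ‖e x‖ := by
  have hconv := norm_pow_succ_apply_sq_le e H hsym x
  by_contra! hlt
  have h0 : 0 < ‖e x‖ := by
    refine lt_of_le_of_ne (norm_nonneg _) fun h0 => ?_
    have h2 := hconv 0
    simp only [zero_add, pow_one, pow_zero, Module.End.one_apply, ← h0, zero_mul] at h2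
    rw [← h0, mul_zero] at hlt
    nlinarith
  -- By log-convexity successive ratios do not decrease, so an initial ratio r > q would force
  -- growth at least like r^k, against the assumed C q^k.
  obtain ⟨r, hr, hre⟩ : ∃ r, q < r ∧ r * ‖e x‖ = ‖e (H x)‖ :=
    ⟨‖e (H x)‖ / ‖e x‖, by rwa [lt_div_iff₀ h0], by field_simp⟩
  have hr0 : 0 < r := hq.trans_lt hr
  have hgrow : ∀ k, 0 < ‖e ((H ^ k) x)‖ ∧ r * ‖e ((H ^ k) x)‖ ≤ ‖e ((H ^ (k + 1)) x)‖ := by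
    intro k
    induction k with
    | zero => simpa [hre] using h0
    | succ k ih =>
      have hpos : 0 < ‖e ((H ^ (k + 1)) x)‖ := (mul_pos hr0 ih.1).trans_le ih.2
      refine ⟨hpos, ?_⟩
      refine le_of_mul_le_mul_left ?_ ih.1
      calc ‖e ((H ^ k) x)‖ * (r * ‖e ((H ^ (k + 1)) x)‖)
          = r * ‖e ((H ^ k) x)‖ * ‖e ((H ^ (k + 1)) x)‖ := by ring
        _ ≤ ‖e ((H ^ (k + 1)) x)‖ * ‖e ((H ^ (k + 1)) x)‖ := by gcongr; exact ih.2
        _ ≤ _ := by rw [← sq]; exact hconv k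
  have hpow : ∀ k, r ^ k * ‖e x‖ ≤ ‖e ((H ^ k) x)‖ := by
    intro k
    induction k with
    | zero => simp
    | succ k ih =>
      refine le_trans ?_ (hgrow k).2
      rw [pow_succ', mul_assoc]
      gcongr
  rcases hq.eq_or_lt with rfl | hq0
  · have h2 := (hpow 1).trans (h 1)
    simp only [pow_one, mul_zero] at h2
    nlinarith [mul_pos hr0 h0]
  · obtain ⟨k, hk⟩ := pow_unbounded_of_one_lt (C / ‖e x‖) ((one_lt_div hq0).2 hr)
    have h2 := (hpow k).trans (h k)
    rw [div_pow, div_lt_div_iff₀ h0 (by positivity)] at hk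
    linarith

end Hilbert

section HilbertSchmidt

variable {n : ℕ}

/-- The entries of a matrix as a vector of a Euclidean space, whose norm is the Hilbert–Schmidt
norm of the matrix. -/
def hsVec : Mat n →ₗ[ℂ] EuclideanSpace ℂ (Fin n × Fin n) where
  toFun X := WithLp.toLp 2 fun p => X p.1 p.2
  map_add' _ _ := rfl
  map_smul' _ _ := rfl

lemma inner_hsVec (X Y : Mat n) : inner ℂ (hsVec X) (hsVec Y) = (Xᴴ * Y).trace := by
  simp only [PiLp.inner_apply, hsVec, Fintype.sum_prod_type,
    Matrix.trace, Matrix.diag_apply, Matrix.mul_apply, Matrix.conjTranspose_apply]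
  rw [Finset.sum_comm]
  refine Finset.sum_congr rfl fun j _ => Finset.sum_congr rfl fun i _ => ?_
  rw [RCLike.inner_apply, mul_comm]; rfl

lemma norm_hsVec_sq (X : Mat n) : ‖hsVec X‖ ^ 2 = (Xᴴ * X).trace.re := by
  rw [← inner_hsVec, ← inner_self_eq_norm_sq (𝕜 := ℂ)]; rfl

lemma norm_le_norm_hsVec (X : Mat n) : ‖X‖ ≤ ‖hsVec X‖ := by
  refine (sq_le_sq₀ (norm_nonneg _) (norm_nonneg _)).1 ?_
  rw [norm_hsVec_sq, sq, ← CStarRing.norm_star_mul_self]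
  exact norm_le_trace_re (star_mul_self_nonneg X)

lemma norm_hsVec_le (X : Mat n) : ‖hsVec X‖ ≤ n * ‖X‖ := by
  refine (sq_le_sq₀ (norm_nonneg _) (by positivity)).1 ?_
  rw [norm_hsVec_sq, mul_pow, sq ‖X‖, ← CStarRing.norm_star_mul_self]
  refine (trace_re_le_mul_norm (star_mul_self_nonneg X)).trans ?_
  gcongr
  rcases Nat.eq_zero_or_pos n with rfl | hn
  · simp
  · have : (1 : ℝ) ≤ n := by exact_mod_cast hn
    nlinarith

lemma norm_hsVec_mul_unitary {U : Mat n} (hU : U * Uᴴ = 1) (X : Mat n) :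
    ‖hsVec (X * U)‖ = ‖hsVec X‖ := by
  refine (sq_eq_sq₀ (norm_nonneg _) (norm_nonneg _)).1 ?_
  rw [norm_hsVec_sq, norm_hsVec_sq, Matrix.conjTranspose_mul, Matrix.trace_mul_comm,
    Matrix.mul_assoc, ← Matrix.mul_assoc U, hU, Matrix.one_mul, Matrix.trace_mul_comm]

lemma norm_hsVec_unitary_mul {U : Mat n} (hU : Uᴴ * U = 1) (X : Mat n) :
    ‖hsVec (U * X)‖ = ‖hsVec X‖ := by
  refine (sq_eq_sq₀ (norm_nonneg _) (norm_nonneg _)).1 ?_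
  rw [norm_hsVec_sq, norm_hsVec_sq, Matrix.conjTranspose_mul, Matrix.mul_assoc,
    ← Matrix.mul_assoc Uᴴ, hU, Matrix.one_mul]

lemma inner_hsVec_selfEnergy {d : ℕ} (Ls : Fin d → Mat n) (X Y : Mat n) :
    inner ℂ (hsVec (selfEnergy Ls X)) (hsVec Y) =
      inner ℂ (hsVec X) (hsVec (selfEnergy Ls Y)) := by
  rw [inner_hsVec, inner_hsVec, ← selfEnergy_conjTranspose, trace_selfEnergy_mul]

/-- A positive definite S is an order unit for the Hermitian matrices. This supplies the initial
bound that a positivity preserving map then propagates. -/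
lemma exists_order_bound {S : Mat n} (hS : S.PosDef) {X : Mat n} (hX : X.IsHermitian) :
    ∃ t : ℝ, 0 ≤ t ∧ -((t : ℂ) • S) ≤ X ∧ X ≤ (t : ℂ) • S := by
  obtain ⟨r, hr, hrS⟩ := exists_smul_one_le hS
  have h1 := smul_le_smul_of_le (r := ‖X‖ * r⁻¹) (by positivity) hrS
  rw [smul_smul, ← Complex.ofReal_mul, inv_mul_cancel_right₀ hr.ne'] at h1
  refine ⟨‖X‖ * r⁻¹, by positivity, ?_, (le_norm_smul_one hX).trans h1⟩
  have h2 := le_norm_smul_one hX.neg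
  rw [norm_neg] at h2
  exact neg_le.1 (h2.trans h1)

/-- A positivity preserving symmetric operator contracts as it does on some positive definite
matrix. -/
lemma norm_hsVec_apply_le {H : Module.End ℂ (Mat n)} (hpos : ∀ R, 0 ≤ R → 0 ≤ H R)
    (hsym : ∀ X Y, inner ℂ (hsVec (H X)) (hsVec Y) = inner ℂ (hsVec X) (hsVec (H Y)))
    {S : Mat n} (hS : S.PosDef) {q : ℝ} (hq : 0 ≤ q) (hHS : H S ≤ (q : ℂ) • S) (X : Mat n) :
    ‖hsVec (H X)‖ ≤ q * ‖hsVec X‖ := by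
  have hmono : ∀ A B, A ≤ B → H A ≤ H B := fun A B h => by
    rw [← sub_nonneg, ← map_sub]; exact hpos _ (sub_nonneg.2 h)
  have hS0 := nonneg_of_posSemidef hS.posSemidef
  have key : ∀ Y : Mat n, Y.IsHermitian →
      ∃ C : ℝ, ∀ k : ℕ, ‖hsVec ((H ^ k) Y)‖ ≤ C * q ^ k := by
    intro Y hY
    obtain ⟨t, ht, h1, h2⟩ := exists_order_bound hS hY
    refine ⟨n * (t * ‖S‖), fun k => ?_⟩
    -- Order bounds by multiples of S shrink by q at each step. They only give C q^k with a constant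
    -- depending on Y; symmetry of H removes that constant at the end.
    have h3 : -(((t * q ^ k : ℝ) : ℂ) • S) ≤ (H ^ k) Y ∧
        (H ^ k) Y ≤ ((t * q ^ k : ℝ) : ℂ) • S := by
      induction k with
      | zero => simpa using ⟨h1, h2⟩
      | succ k ih =>
        have h4 : (H ^ (k + 1)) Y = H ((H ^ k) Y) := by rw [pow_succ']; rfl
        have h5 : H (((t * q ^ k : ℝ) : ℂ) • S) ≤ ((t * q ^ (k + 1) : ℝ) : ℂ) • S := by
          rw [map_smul]
          refine (smul_le_smul_of_le (by positivity) hHS).trans (le_of_eq ?_)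
          rw [smul_smul, ← Complex.ofReal_mul]
          congr 2; ring
        rw [h4]
        refine ⟨?_, (hmono _ _ ih.2).trans h5⟩
        have h6 := hmono _ _ ih.1
        rw [map_neg] at h6
        exact (neg_le_neg h5).trans h6
    have hherm : ((H ^ k) Y).IsHermitian := by
      have h4 : ((H ^ k) Y - -(((t * q ^ k : ℝ) : ℂ) • S)).IsHermitian :=
        (Matrix.le_iff.1 h3.1).isHermitian
      have h5 : (((t * q ^ k : ℝ) : ℂ) • S).IsHermitian :=
        (posSemidef_of_nonneg (smul_nonneg_of_nonneg (by positivity) hS0)).isHermitian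
      have := h4.sub h5
      rwa [sub_neg_eq_add, add_sub_cancel_right] at this
    have h4 := norm_le_norm_of_neg_le_of_le hherm h3.1 h3.2
    rw [norm_smul, Complex.norm_real, Real.norm_of_nonneg (by positivity)] at h4
    calc ‖hsVec ((H ^ k) Y)‖ ≤ n * ‖(H ^ k) Y‖ := norm_hsVec_le _
      _ ≤ n * (t * q ^ k * ‖S‖) := by gcongr
      _ = n * (t * ‖S‖) * q ^ k := by ring
  have hre : ((2 : ℂ)⁻¹ • (X + Xᴴ)).IsHermitian := by
    rw [Matrix.IsHermitian, Matrix.conjTranspose_smul, Matrix.conjTranspose_add,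
      Matrix.conjTranspose_conjTranspose, add_comm]
    simp
  obtain ⟨C₁, hC₁⟩ := key _ hre
  obtain ⟨C₂, hC₂⟩ := key _ (imPart_isHermitian X)
  refine norm_apply_le_of_norm_pow_apply_le hsVec H hsym (C := C₁ + C₂) hq X fun k => ?_
  conv_lhs => rw [re_add_I_smul_imPart X]
  rw [map_add, map_add, map_smul _ Complex.I, map_smul _ Complex.I, add_mul]
  refine (norm_add_le _ _).trans (add_le_add (hC₁ k) ?_)
  rw [norm_smul, Complex.norm_I, one_mul]
  exact hC₂ k

end HilbertSchmidt

/-! ### Lower bounds for an isometry composed with a symmetric contraction. -/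

section AbstractStability

variable {V E : Type*} [AddCommGroup V] [Module ℂ V] [NormedAddCommGroup E]
  [InnerProductSpace ℂ E]

/-- With a_k the norms along the orbit, 2a_{k+1}² ≤ 2a_k a_{k+2} ≤ a_k² + a_{k+2}², so the losses
a_k² - a_{k+1}² never exceed the first one. -/
lemma sq_norm_sub_sq_norm_pow_apply_le (e : V →ₗ[ℂ] E) (F : Module.End ℂ V)
    (hsym : ∀ x y, inner ℂ (e (F x)) (e y) = inner ℂ (e x) (e (F y))) (x : V) (m : ℕ) :
    ‖e x‖ ^ 2 - ‖e ((F ^ m) x)‖ ^ 2 ≤ m * (‖e x‖ ^ 2 - ‖e (F x)‖ ^ 2) := by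
  have hconv := norm_pow_succ_apply_sq_le e F hsym x
  have hdec : ∀ k, ‖e ((F ^ k) x)‖ ^ 2 - ‖e ((F ^ (k + 1)) x)‖ ^ 2 ≤
      ‖e x‖ ^ 2 - ‖e (F x)‖ ^ 2 := by
    intro k
    induction k with
    | zero => simp
    | succ k ih =>
      have := hconv k
      nlinarith [sq_nonneg (‖e ((F ^ k) x)‖ - ‖e ((F ^ (k + 2)) x)‖)]
  induction m with
  | zero => simp
  | succ m ih => have := hdec m; push_cast; linarith

/-- Scalar bookkeeping for the next result: N is the norm of x, a the modulus of its component along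
s, and p the cross term. The cross term is split by the arithmetic–geometric mean inequality; the
case a < N/2 is easy, since then x lies mostly in the direction controlled by the gap. -/
lemma mul_le_of_mul_le_add {N ε δ μ C a p : ℝ} (hN : 0 ≤ N) (hε : 0 ≤ ε) (hδ : 0 ≤ δ)
    (hδ2 : δ ≤ 2) (hμ : 0 ≤ μ) (hC : 0 ≤ C) (ha : 0 ≤ a) (h : a * δ ≤ (1 + 2 * C) * ε + p)
    (hp : p ^ 2 ≤ 2 * δ * (2 * μ * (N * ε))) (haN : N ^ 2 ≤ a ^ 2 + 2 * μ * (N * ε)) :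
    δ * N ≤ (4 * (1 + 2 * C) + 16 * μ) * ε := by
  have h3 : 0 ≤ μ * ε := by positivity
  have h4 : 0 ≤ C * ε := by positivity
  have hprod : p ≤ δ * N / 4 + 4 * μ * ε := by
    refine abs_le_of_sq_le_sq' (hp.trans ?_) (by positivity) |>.2
    linarith [sq_nonneg (δ * N / 4 - 4 * μ * ε)]
  rcases le_total (N / 2) a with h' | h'
  · linarith [mul_le_mul_of_nonneg_right h' hδ]
  · have h1 : 3 / 4 * N ^ 2 ≤ 2 * μ * (N * ε) := by
      have := pow_le_pow_left₀ ha h' 2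
      linarith
    have h2 : 3 / 4 * N ≤ 2 * μ * ε := by
      rcases hN.eq_or_lt with h0 | h0
      · rw [← h0]; linarith
      · refine le_of_mul_le_mul_right ?_ h0
        linarith
    have := mul_le_mul_of_nonneg_right hδ2 hN
    linarith

/-- Quantitative invertibility of `1 - 𝒰 F` for a symmetric contraction `F` with a spectral gap
above an approximate eigenvector `s`, and an isometry `𝒰`. -/
lemma mul_norm_le_norm_sub_comp (e : V →ₗ[ℂ] E) (F : Module.End ℂ V) (𝒰 : V → V)
    (hsym : ∀ x y, inner ℂ (e (F x)) (e y) = inner ℂ (e x) (e (F y)))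
    (h𝒰 : ∀ x, ‖e (𝒰 x)‖ = ‖e x‖) {θ κ C : ℝ} {m : ℕ} {s w : V} (hθ : 0 ≤ θ) (hκ : 0 < κ)
    (hC : 0 ≤ C) (hF : ∀ x, ‖e (F x)‖ ≤ (1 - θ) * ‖e x‖)
    (hgap : ∀ x, ‖e ((F ^ m) x)‖ ^ 2 ≤
      ‖e x‖ ^ 2 - κ * (‖e x‖ ^ 2 - ‖(inner ℂ (e s) (e x) : ℂ)‖ ^ 2))
    (hs : ‖e s‖ = 1) (hsF : ‖e (s - F s)‖ ≤ C * θ) (hw : ‖e w‖ = 1)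
    (hsw : ∀ x, inner ℂ (e s) (e (𝒰 x)) = inner ℂ (e w) (e x)) (x : V) :
    θ * ‖e x‖ ≤ ‖e (x - 𝒰 (F x))‖ ∧
    (1 - (inner ℂ (e w) (e s)).re) * ‖e x‖ ≤
      (4 * (1 + 2 * C) + 16 * m / κ) * ‖e (x - 𝒰 (F x))‖ := by
  set N := ‖e x‖ with hN
  set ε := ‖e (x - 𝒰 (F x))‖ with hε
  set δ := 1 - (inner ℂ (e w) (e s)).re with hδ
  have hN0 : 0 ≤ N := norm_nonneg _
  have hε0 : 0 ≤ ε := norm_nonneg _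
  have hFx : N - ε ≤ ‖e (F x)‖ := by
    have h1 : e x = e (𝒰 (F x)) + e (x - 𝒰 (F x)) := by rw [map_sub]; abel
    have h2 := norm_add_le (e (𝒰 (F x))) (e (x - 𝒰 (F x)))
    rw [← h1, h𝒰] at h2
    linarith
  have hθε : θ * N ≤ ε := by linarith [hF x]
  refine ⟨hθε, ?_⟩
  have hFle : ∀ y, ‖e (F y)‖ ≤ ‖e y‖ := fun y => (hF y).trans (by nlinarith [norm_nonneg (e y)])
  have hinner : |(inner ℂ (e w) (e s)).re| ≤ 1 := by
    refine (Complex.abs_re_le_norm _).trans ((norm_inner_le_norm _ _).trans ?_)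
    rw [hw, hs, one_mul]
  have hδ0 : 0 ≤ δ := by linarith [(abs_le.1 hinner).2]
  have hδ2 : δ ≤ 2 := by linarith [(abs_le.1 hinner).1]
  set α : ℂ := inner ℂ (e s) (e x) with hα
  set y := x - α • s with hy
  have hα' : inner ℂ (e s) (e y) = 0 := by
    rw [hy, map_sub, map_smul, inner_sub_right, inner_smul_right, inner_self_eq_norm_sq_to_K, hs]
    simp [hα]
  have hxy : e x = α • e s + e y := by rw [hy, map_sub, map_smul]; abel
  have hYsq : N ^ 2 = ‖α‖ ^ 2 + ‖e y‖ ^ 2 := by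
    have h1 : inner ℂ (α • e s) (e y) = 0 := by rw [inner_smul_left, hα', mul_zero]
    have h2 := norm_add_sq_eq_norm_sq_add_norm_sq_of_inner_eq_zero _ _ h1
    rw [← hxy, norm_smul, hs, mul_one] at h2
    nlinarith
  have hαN : ‖α‖ ≤ N := by nlinarith [norm_nonneg α, sq_nonneg ‖e y‖]
  have hyN : ‖e y‖ ≤ N := by nlinarith [norm_nonneg (e y), sq_nonneg ‖α‖]
  -- If x is almost fixed by 𝒰F, then F almost preserves its norm, hence so does F^m up to a factor
  -- m in the loss. The gap then makes the component orthogonal to s small.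
  have hY : κ * ‖e y‖ ^ 2 ≤ 2 * m * (N * ε) := by
    have h1 := sq_norm_sub_sq_norm_pow_apply_le e F hsym x m
    have h2 := hgap x
    have h3 : N ^ 2 - ‖e (F x)‖ ^ 2 ≤ 2 * (N * ε) := by
      rcases le_total ε N with h | h
      · nlinarith [norm_nonneg (e (F x))]
      · nlinarith [norm_nonneg (e (F x))]
    have h4 : κ * ‖e y‖ ^ 2 = κ * (N ^ 2 - ‖α‖ ^ 2) := by rw [hYsq]; ring
    rw [h4]
    have h5 := mul_le_mul_of_nonneg_left h3 (Nat.cast_nonneg (α := ℝ) m)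
    linarith
  have hws : ‖e (w - s)‖ ^ 2 = 2 * δ := by
    rw [map_sub, @norm_sub_sq ℂ, hw, hs, hδ]
    simp only [RCLike.re_eq_complex_re]
    ring
  -- Test x - 𝒰F x against s, with w the adjoint image of s under 𝒰. Subtracting ⟨s, F y⟩, which is
  -- small because s is almost F-invariant, leaves w - s in the cross term; its squared norm 2δ is
  -- what permits absorption into δN.
  have hmain : ‖α‖ * δ ≤ (1 + 2 * C) * ε + ‖e (w - s)‖ * ‖e y‖ := by
    have h1 : α * (1 - inner ℂ (e w) (e s)) = inner ℂ (e s) (e (x - 𝒰 (F x)))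
        - α * inner ℂ (e w) (e (s - F s)) + inner ℂ (e (w - s)) (e (F y))
        - inner ℂ (e (s - F s)) (e y) := by
      have e1 : inner ℂ (e s) (e (x - 𝒰 (F x))) = α - inner ℂ (e w) (e (F x)) := by
        rw [map_sub, inner_sub_right, hsw]
      have e2 : inner ℂ (e w) (e (F x)) =
          α * inner ℂ (e w) (e (F s)) + inner ℂ (e w) (e (F y)) := by
        have : F x = α • F s + F y := by rw [hy, map_sub, map_smul]; abel
        rw [this, map_add, map_smul, inner_add_right, inner_smul_right]
      have e3 : inner ℂ (e (s - F s)) (e y) = - inner ℂ (e s) (e (F y)) := by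
        rw [map_sub, inner_sub_left, hα', hsym, zero_sub]
      rw [e1, e2, e3, map_sub e s, map_sub e w, inner_sub_right, inner_sub_left]
      ring
    have h2 : ‖α‖ * δ ≤ ‖α * (1 - inner ℂ (e w) (e s))‖ := by
      rw [norm_mul]
      gcongr
      have := Complex.re_le_norm (1 - inner ℂ (e w) (e s))
      rwa [Complex.sub_re, Complex.one_re] at this
    refine h2.trans ?_
    rw [h1]
    have b1 : ‖(inner ℂ (e s) (e (x - 𝒰 (F x))) : ℂ)‖ ≤ ε := by
      refine (norm_inner_le_norm _ _).trans ?_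
      rw [hs, one_mul]
    have b2 : ‖α * inner ℂ (e w) (e (s - F s))‖ ≤ C * ε := by
      rw [norm_mul]
      have : ‖(inner ℂ (e w) (e (s - F s)) : ℂ)‖ ≤ C * θ := by
        refine (norm_inner_le_norm _ _).trans ?_
        rw [hw, one_mul]; exact hsF
      calc ‖α‖ * ‖(inner ℂ (e w) (e (s - F s)) : ℂ)‖ ≤ N * (C * θ) := by gcongr
        _ = C * (θ * N) := by ring
        _ ≤ C * ε := by gcongr
    have b3 : ‖(inner ℂ (e (w - s)) (e (F y)) : ℂ)‖ ≤ ‖e (w - s)‖ * ‖e y‖ :=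
      (norm_inner_le_norm _ _).trans (by gcongr; exact hFle y)
    have b4 : ‖(inner ℂ (e (s - F s)) (e y) : ℂ)‖ ≤ C * ε := by
      refine (norm_inner_le_norm _ _).trans ?_
      calc ‖e (s - F s)‖ * ‖e y‖ ≤ C * θ * N := by gcongr
        _ = C * (θ * N) := by ring
        _ ≤ C * ε := by gcongr
    refine (norm_sub_le _ _).trans ?_
    refine (add_le_add_left (norm_add_le _ _) _).trans ?_
    refine (add_le_add_left (add_le_add_left (norm_sub_le _ _) _) _).trans ?_
    linarith
  set μ : ℝ := m / κ with hμ
  have hμ0 : 0 ≤ μ := by positivity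
  have hY' : ‖e y‖ ^ 2 ≤ 2 * μ * (N * ε) := by
    rw [hμ]
    have : ‖e y‖ ^ 2 ≤ 2 * m * (N * ε) / κ := by rw [le_div_iff₀ hκ]; linarith
    refine this.trans (le_of_eq ?_)
    ring
  have hgoal : 16 * (m : ℝ) / κ = 16 * μ := by rw [hμ]; ring
  rw [hgoal]
  refine mul_le_of_mul_le_add hN0 hε0 hδ0 hδ2 hμ0 hC (norm_nonneg α) hmain ?_ ?_
  · calc (‖e (w - s)‖ * ‖e y‖) ^ 2 = 2 * δ * ‖e y‖ ^ 2 := by rw [mul_pow, hws]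
      _ ≤ 2 * δ * (2 * μ * (N * ε)) := by gcongr
  · rw [hYsq]; linarith

end AbstractStability

/-! ### Spectral gap of the balanced self-energy -/

section Balanced

variable {n d : ℕ}

/-- A crude substitute for a fourth root, needed because ‖Q‖⁴ is the squared norm of Q*Q. -/
lemma le_one_add_of_pow_four_le {x y : ℝ} (hy : 0 ≤ y) (h : x ^ 4 ≤ y) : x ≤ 1 + y := by
  by_contra! hlt
  have h1 : 1 ≤ x := by linarith
  have h2 : x ≤ x ^ 4 := le_self_pow₀ h1 (by norm_num)
  linarith

lemma norm_sq_eq_norm_conjTranspose_mul (Q : Mat n) : ‖Q‖ ^ 2 = ‖Qᴴ * Q‖ := by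
  rw [sq]; exact (CStarRing.norm_star_mul_self).symm

/-- The balanced polar decomposition of a solution, with bounds on the congruence. -/
lemma exists_balanced {K₀ : Mat n} {Ls : Fin d → Mat n} {z : ℂ} {T : Mat n}
    (hK₀ : K₀.IsHermitian) (h : SolvesAt K₀ (selfEnergy Ls) z T) {a b τ : ℝ} (ha : 0 < a)
    (hb : 0 < b) (hτ : 0 < τ) (hV₁ : ((a * τ : ℝ) : ℂ) • (1 : Mat n) ≤ imPart T)
    (hV₂ : imPart T ≤ ((τ : ℝ) : ℂ) • (1 : Mat n))
    (hN₁ : ((a * τ : ℝ) : ℂ) • (1 : Mat n) ≤ invIm (selfEnergy Ls) z T)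
    (hN₂ : invIm (selfEnergy Ls) z T ≤ ((b * τ : ℝ) : ℂ) • (1 : Mat n)) :
    ∃ Q U : Mat n, IsUnit Q ∧ U * Uᴴ = 1 ∧ Uᴴ * U = 1 ∧ T = Qᴴ * U * Q ∧
      ‖Q‖ ≤ 1 + a⁻¹ + b / a ∧ ‖Q⁻¹‖ ≤ 1 + a⁻¹ + b / a ∧
      imPart T = Qᴴ * imPart U * Q ∧ imPart U = Q * invIm (selfEnergy Ls) z T * Qᴴ := by
  obtain ⟨Q, U, hQ, hU₁, hU₂, hT⟩ := exists_balanced_polar h.1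
  have hQd := (Matrix.isUnit_iff_isUnit_det _).1 hQ
  have hQHd := (Matrix.isUnit_iff_isUnit_det _).1 (isUnit_conjTranspose hQ)
  have hV : imPart T = Qᴴ * imPart U * Q := by
    rw [← imPart_conjTranspose_mul_mul, ← hT]
  have hS : imPart U = Q * invIm (selfEnergy Ls) z T * Qᴴ := by
    rw [← imPart_neg_inv hK₀ h, ← imPart_mul_mul_conjTranspose, hT, Matrix.mul_inv_rev,
      Matrix.mul_inv_rev, Matrix.mul_neg, Matrix.mul_nonsing_inv_cancel_left _ _ hQd,
      Matrix.neg_mul, Matrix.nonsing_inv_mul_cancel_right _ _ hQHd,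
      Matrix.inv_eq_right_inv hU₁, imPart_neg, imPart_conjTranspose, neg_neg]
  -- Then Im T = G N G with N = `invIm`. As both Im T and N are comparable to τ, the positive matrix
  -- G has square bounded above and below, independently of τ.
  set G := Qᴴ * Q with hG
  have hGH : Gᴴ = G := by rw [hG]; simp
  have hGu : IsUnit G := (isUnit_conjTranspose hQ).mul hQ
  have hGd := (Matrix.isUnit_iff_isUnit_det _).1 hGu
  have hVG : imPart T = G * invIm (selfEnergy Ls) z T * Gᴴ := by
    rw [hGH, hV, hS, hG]; simp only [Matrix.mul_assoc]
  have hGG₁ : ‖G‖ ^ 2 ≤ a⁻¹ := by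
    rw [norm_sq_eq_norm_conjTranspose_mul, hGH]
    refine norm_le_of_le_smul_one ?_ (by positivity) ?_
    · have := star_mul_self_nonneg G
      rwa [Matrix.star_eq_conjTranspose, hGH] at this
    · have h1 := (mul_mul_conjTranspose_le hN₁ G).trans (hVG.symm.le.trans hV₂)
      rw [Matrix.mul_smul, Matrix.mul_one, Matrix.smul_mul, hGH] at h1
      have h2 := smul_le_smul_of_le (r := (a * τ)⁻¹) (by positivity) h1
      rw [smul_smul, smul_smul, ← Complex.ofReal_mul, ← Complex.ofReal_mul,
        inv_mul_cancel₀ (by positivity), Complex.ofReal_one, one_smul] at h2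
      refine h2.trans (le_of_eq ?_)
      congr 2; field_simp
  have hGG₂ : ‖G⁻¹‖ ^ 2 ≤ b / a := by
    have hGiH : G⁻¹ᴴ = G⁻¹ := by rw [Matrix.conjTranspose_nonsing_inv, hGH]
    rw [norm_sq_eq_norm_conjTranspose_mul, hGiH]
    refine norm_le_of_le_smul_one ?_ (by positivity) ?_
    · have := star_mul_self_nonneg G⁻¹
      rwa [Matrix.star_eq_conjTranspose, hGiH] at this
    · have h1 := (hV₁.trans hVG.le).trans (mul_mul_conjTranspose_le hN₂ G)
      have h2 := mul_mul_conjTranspose_le h1 G⁻¹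
      rw [hGH, hGiH] at h2
      simp only [Matrix.mul_smul, Matrix.mul_one, Matrix.smul_mul] at h2
      rw [Matrix.nonsing_inv_mul_cancel_left _ _ hGd, Matrix.mul_nonsing_inv _ hGd] at h2
      have h3 := smul_le_smul_of_le (r := (a * τ)⁻¹) (by positivity) h2
      rw [smul_smul, smul_smul, ← Complex.ofReal_mul, ← Complex.ofReal_mul,
        inv_mul_cancel₀ (by positivity), Complex.ofReal_one, one_smul] at h3
      refine h3.trans (le_of_eq ?_)
      congr 2; field_simp
  refine ⟨Q, U, hQ, hU₁, hU₂, hT, ?_, ?_, hV, hS⟩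
  · have h1 : ‖Q‖ ^ 4 ≤ a⁻¹ := by
      calc ‖Q‖ ^ 4 = (‖Q‖ ^ 2) ^ 2 := by ring
        _ = ‖G‖ ^ 2 := by rw [norm_sq_eq_norm_conjTranspose_mul]
        _ ≤ a⁻¹ := hGG₁
    have := le_one_add_of_pow_four_le (by positivity) h1
    have h2 : 0 ≤ b / a := by positivity
    linarith
  · have h1 : ‖Q⁻¹‖ ^ 4 ≤ b / a := by
      have h2 : ‖Q⁻¹‖ ^ 2 = ‖G⁻¹‖ := by
        rw [hG, Matrix.mul_inv_rev, sq, ← CStarRing.norm_self_mul_star (x := Q⁻¹),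
          Matrix.star_eq_conjTranspose, Matrix.conjTranspose_nonsing_inv]
      calc ‖Q⁻¹‖ ^ 4 = (‖Q⁻¹‖ ^ 2) ^ 2 := by ring
        _ ≤ b / a := by rw [h2]; exact hGG₂
    have := le_one_add_of_pow_four_le (by positivity) h1
    have h2 : 0 ≤ a⁻¹ := by positivity
    linarith

lemma inv_sq_smul_one_le_mul_conjTranspose {Q : Mat n} (hQ : IsUnit Q) {k : ℝ} (hk : 0 < k)
    (h : ‖Q⁻¹‖ ≤ k) : (((k ^ 2)⁻¹ : ℝ) : ℂ) • (1 : Mat n) ≤ Q * Qᴴ := by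
  have h1 : (1 : Mat n) ≤ ((k ^ 2 : ℝ) : ℂ) • (Q * Qᴴ) :=
    (one_le_smul_mul_conjTranspose hQ).trans
      (smul_le_smul_of_coeff_le (by gcongr) (mul_star_self_nonneg Q))
  have h2 := smul_le_smul_of_le (r := (k ^ 2)⁻¹) (by positivity) h1
  rwa [smul_smul, ← Complex.ofReal_mul, inv_mul_cancel₀ (by positivity), Complex.ofReal_one,
    one_smul] at h2

lemma pow_apply_nonneg {H : Module.End ℂ (Mat n)} (hpos : ∀ R, 0 ≤ R → 0 ≤ H R) (m : ℕ)
    {R : Mat n} (hR : 0 ≤ R) : 0 ≤ (H ^ m) R := by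
  induction m with
  | zero => simpa using hR
  | succ m ih => rw [pow_succ']; exact hpos _ ih

/-- The power `L + 1` of the balanced self-energy is positivity improving. -/
lemma smul_one_le_pow_apply {Ls : Fin d → Mat n} {Z : Matrix (Fin n) (Fin n) ℕ} {c : ℝ} {L : ℕ}
    (hf : FlatWith (selfEnergy Ls) Z c) (hZ : ∀ k l, 0 < (Z ^ L) k l) {Q : Mat n} (hQ : IsUnit Q)
    {k : ℝ} (hk : 0 < k) (hQk : ‖Q⁻¹‖ ≤ k) {F : Module.End ℂ (Mat n)}
    (hF : F = selfEnergy fun α => Q * Ls α * Qᴴ) {R : Mat n} (hR : 0 ≤ R) :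
    ((c * (c * ((k ^ 2)⁻¹) ^ 2) ^ L * ((k ^ 2)⁻¹) ^ 2 * R.trace.re : ℝ) : ℂ) • (1 : Mat n) ≤
      (F ^ (L + 1)) R := by
  have hc := hf.pos
  have hFpos : ∀ R, 0 ≤ R → 0 ≤ F R := fun R hR => by
    rw [hF]; exact selfEnergy_nonneg _ hR
  have hQQ := inv_sq_smul_one_le_mul_conjTranspose hQ hk hQk
  have hQQ' : (((k ^ 2)⁻¹ : ℝ) : ℂ) • (1 : Mat n) ≤ Qᴴ * Q := by
    have := inv_sq_smul_one_le_mul_conjTranspose (isUnit_conjTranspose hQ) hk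
      (by rwa [← Matrix.conjTranspose_nonsing_inv, Matrix.l2_opNorm_conjTranspose])
    rwa [Matrix.conjTranspose_conjTranspose] at this
  have hstep : ∀ R, 0 ≤ R → (c : ℂ) • (Q * Matrix.diagonal
      (fun l => (flatWeight Z (Qᴴ * R * Q) l : ℂ)) * Qᴴ) ≤ F R := by
    intro R hR
    have h1 := mul_mul_conjTranspose_le (hf.le _ (star_left_conjugate_nonneg hR Q)) Q
    rw [Matrix.mul_smul, Matrix.smul_mul] at h1
    rw [hF, selfEnergy_conj]
    exact h1
  -- Flatness sees only the diagonal of Q* R Q. One application of F bounds this diagonal below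
  -- through Z, using that the diagonal entries of Q*Q are at least k⁻². L applications fill the
  -- diagonal, and one more turns the diagonal bound into a matrix bound.
  set u : ℕ → Fin n → ℝ := fun m l => ((Qᴴ * (F ^ m) R * Q) l l).re with hu
  have hupos : ∀ m l, 0 ≤ u m l := fun m l =>
    diag_re_nonneg (star_left_conjugate_nonneg (pow_apply_nonneg hFpos m hR) Q) l
  have hstep' : ∀ m j, c * ((k ^ 2)⁻¹) ^ 2 * ∑ i, (Z i j : ℝ) * u m i ≤ u (m + 1) j := by
    intro m j
    have h0 := pow_apply_nonneg hFpos m hR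
    have h1 := diag_re_mono (conjTranspose_mul_mul_le (hstep _ h0) Q) j
    have h2 : F ((F ^ m) R) = (F ^ (m + 1)) R := by rw [pow_succ']; rfl
    rw [h2] at h1
    refine le_trans ?_ h1
    have h3 : Qᴴ * ((c : ℂ) • (Q * Matrix.diagonal
        (fun l => (flatWeight Z (Qᴴ * (F ^ m) R * Q) l : ℂ)) * Qᴴ)) * Q =
        (c : ℂ) • ((Qᴴ * Q) * Matrix.diagonal
        (fun l => (flatWeight Z (Qᴴ * (F ^ m) R * Q) l : ℂ)) * (Qᴴ * Q)ᴴ) := by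
      rw [Matrix.conjTranspose_mul, Matrix.conjTranspose_conjTranspose, Matrix.mul_smul,
        Matrix.smul_mul]
      simp only [Matrix.mul_assoc]
    rw [h3, Matrix.smul_apply, smul_eq_mul, Complex.re_ofReal_mul, conj_diagonal_diag_re, mul_assoc]
    refine mul_le_mul_of_nonneg_left ?_ hc.le
    have hw : ∀ l, 0 ≤ flatWeight Z (Qᴴ * (F ^ m) R * Q) l := fun l =>
      flatWeight_nonneg Z (star_left_conjugate_nonneg h0 Q) l
    refine le_trans ?_ (Finset.single_le_sum (f := fun i => ‖(Qᴴ * Q) j i‖ ^ 2 *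
      flatWeight Z (Qᴴ * (F ^ m) R * Q) i) (fun i _ => mul_nonneg (by positivity) (hw i))
      (Finset.mem_univ j))
    have hG : (k ^ 2)⁻¹ ≤ ‖(Qᴴ * Q) j j‖ := by
      have := diag_re_mono hQQ' j
      rw [Matrix.smul_apply, Matrix.one_apply_eq, smul_eq_mul, mul_one, Complex.ofReal_re] at this
      exact this.trans (Complex.re_le_norm _)
    exact mul_le_mul_of_nonneg_right (by gcongr) (hw j)
  have hL := pow_mul_sum_le hZ (by positivity) u (hupos 0) hstep'
  have htr : (k ^ 2)⁻¹ * R.trace.re ≤ ∑ l, u 0 l := by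
    have h1 : ∑ l, u 0 l = (Q * Qᴴ * R).trace.re := by
      rw [Matrix.mul_assoc, Matrix.trace_mul_comm, hu]
      simp [Matrix.trace]
    have h2 := trace_mul_re_nonneg (sub_nonneg.2 hQQ) hR
    rw [Matrix.sub_mul, Matrix.smul_mul, Matrix.one_mul, Matrix.trace_sub, Matrix.trace_smul,
      Complex.sub_re, smul_eq_mul, Complex.re_ofReal_mul] at h2
    rw [h1]; linarith
  have h0 := pow_apply_nonneg hFpos L hR
  have h1 := hstep _ h0
  have h2 : F ((F ^ L) R) = (F ^ (L + 1)) R := by rw [pow_succ']; rfl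
  rw [h2] at h1
  refine le_trans ?_ h1
  set r : ℝ := (c * ((k ^ 2)⁻¹) ^ 2) ^ L * ((k ^ 2)⁻¹ * R.trace.re) with hr
  have hr0 : 0 ≤ r := by have := trace_re_nonneg hR; positivity
  have h3 : (r : ℂ) • (1 : Mat n) ≤ Matrix.diagonal
      (fun l => (flatWeight Z (Qᴴ * (F ^ L) R * Q) l : ℂ)) := by
    refine smul_one_le_diagonal fun l => ?_
    refine le_trans ?_ (diag_le_flatWeight hf (star_left_conjugate_nonneg h0 Q) l)
    refine le_trans ?_ (hL l)
    rw [hr]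
    gcongr
  have h4 := mul_mul_conjTranspose_le h3 Q
  rw [Matrix.mul_smul, Matrix.mul_one, Matrix.smul_mul] at h4
  have h5 := (smul_le_smul_of_le hr0 hQQ).trans h4
  rw [smul_smul, ← Complex.ofReal_mul] at h5
  have h6 := smul_le_smul_of_le hc.le h5
  rw [smul_smul, ← Complex.ofReal_mul] at h6
  refine le_trans (le_of_eq ?_) h6
  rw [hr]
  congr 2; ring

/-- A positivity improving symmetric operator has a spectral gap above a subinvariant positive
matrix. -/
lemma norm_hsVec_pow_apply_sq_le {F : Module.End ℂ (Mat n)} (hpos : ∀ R, 0 ≤ R → 0 ≤ F R)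
    (hsym : ∀ X Y, inner ℂ (hsVec (F X)) (hsVec Y) = inner ℂ (hsVec X) (hsVec (F Y)))
    {s : Mat n} (hs : s.PosDef) (hs1 : ‖hsVec s‖ = 1) (hFs : F s ≤ s) {κ : ℝ} {m : ℕ}
    (hκ0 : 0 ≤ κ) (hκ1 : κ ≤ 1)
    (hκ : ∀ R, 0 ≤ R → ((κ * R.trace.re : ℝ) : ℂ) • (1 : Mat n) ≤ (F ^ (2 * m)) R) (X : Mat n) :
    ‖hsVec ((F ^ m) X)‖ ^ 2 ≤
      ‖hsVec X‖ ^ 2 - κ * (‖hsVec X‖ ^ 2 - ‖(inner ℂ (hsVec s) (hsVec X) : ℂ)‖ ^ 2) := by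
  have hs0 := nonneg_of_posSemidef hs.posSemidef
  have hsymp : ∀ j X Y, inner ℂ (hsVec ((F ^ j) X)) (hsVec Y) =
      inner ℂ (hsVec X) (hsVec ((F ^ j) Y)) := by
    intro j
    induction j with
    | zero => simp
    | succ j ih =>
      intro X Y
      rw [pow_succ', Module.End.mul_apply, hsym, ih, ← Module.End.mul_apply, ← pow_succ,
        pow_succ', Module.End.mul_apply]
  set P : Module.End ℂ (Mat n) :=
    { toFun := fun X => (inner ℂ (hsVec s) (hsVec X) : ℂ) • s
      map_add' := fun X Y => by rw [map_add, inner_add_right, add_smul]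
      map_smul' := fun r X => by
        rw [map_smul, inner_smul_right, mul_smul, RingHom.id_apply] } with hP
  have hPa : ∀ X, P X = (inner ℂ (hsVec s) (hsVec X) : ℂ) • s := fun X => rfl
  -- Removing κ times the projection onto s keeps positivity, because Tr(sR)s ≤ (Tr R)·1. Since H s
  -- ≤ (1 - κ)s, the contraction principle applies to H with rate 1 - κ, and this is the gap.
  set H : Module.End ℂ (Mat n) := F ^ (2 * m) - (κ : ℂ) • P with hH
  have hHa : ∀ X, H X = (F ^ (2 * m)) X - (κ : ℂ) • P X := fun X => rfl
  have hHpos : ∀ R, 0 ≤ R → 0 ≤ H R := by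
    intro R hR
    rw [hHa, sub_nonneg]
    refine le_trans ?_ (hκ R hR)
    rw [Complex.ofReal_mul, mul_smul]
    refine smul_le_smul_of_le hκ0 ?_
    have hsH : sᴴ = s := hs.isHermitian
    have h1 : (inner ℂ (hsVec s) (hsVec R) : ℂ) = (((s * R).trace.re : ℝ) : ℂ) := by
      rw [inner_hsVec, hsH]
      refine (Complex.conj_eq_iff_re.1 ?_).symm
      rw [← Complex.star_def, ← Matrix.trace_conjTranspose, Matrix.conjTranspose_mul, hsH,
        (posSemidef_of_nonneg hR).isHermitian.eq, Matrix.trace_mul_comm]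
    rw [hPa, h1]
    have hs_le : s ≤ 1 := by
      refine (le_norm_smul_one hs.isHermitian).trans ?_
      have := smul_le_smul_of_coeff_le ((norm_le_norm_hsVec s).trans hs1.le)
        (zero_le_one (α := Mat n))
      simpa using this
    refine (smul_le_smul_of_le (trace_mul_re_nonneg hs0 hR) hs_le).trans
      (smul_le_smul_of_coeff_le ?_ zero_le_one)
    have h2 := trace_mul_re_nonneg (sub_nonneg.2 hs_le) hR
    rw [Matrix.sub_mul, Matrix.one_mul, Matrix.trace_sub, Complex.sub_re] at h2
    linarith
  have hHsym : ∀ X Y, inner ℂ (hsVec (H X)) (hsVec Y) = inner ℂ (hsVec X) (hsVec (H Y)) := by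
    intro X Y
    rw [hHa, hHa, hPa, hPa, map_sub, map_sub, inner_sub_left, inner_sub_right, hsymp, map_smul,
      map_smul, map_smul, map_smul, inner_smul_left, inner_smul_left, inner_smul_right,
      inner_smul_right, inner_conj_symm, Complex.conj_ofReal]
    ring
  have hFps : ∀ j, (F ^ j) s ≤ s := by
    intro j
    induction j with
    | zero => simp
    | succ j ih =>
      rw [pow_succ', Module.End.mul_apply]
      refine le_trans ?_ hFs
      rw [← sub_nonneg, ← map_sub]
      exact hpos _ (sub_nonneg.2 ih)
  have hHs : H s ≤ ((1 - κ : ℝ) : ℂ) • s := by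
    rw [hHa, hPa, inner_self_eq_norm_sq_to_K, hs1, Complex.ofReal_sub, sub_smul,
      Complex.ofReal_one, one_smul]
    simpa using hFps (2 * m)
  have h1 := norm_hsVec_apply_le hHpos hHsym hs (by linarith) hHs X
  have h2 : ‖hsVec ((F ^ m) X)‖ ^ 2 =
      (inner ℂ (hsVec X) (hsVec (H X)) : ℂ).re +
        κ * ‖(inner ℂ (hsVec s) (hsVec X) : ℂ)‖ ^ 2 := by
    have e1 : ((‖hsVec ((F ^ m) X)‖ ^ 2 : ℝ) : ℂ) =
        inner ℂ (hsVec X) (hsVec ((F ^ (2 * m)) X)) := by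
      rw [two_mul, pow_add, Module.End.mul_apply, ← hsymp, inner_self_eq_norm_sq_to_K]
      push_cast; rfl
    have e2 : (F ^ (2 * m)) X = H X + (κ : ℂ) • P X := by rw [hHa]; abel
    rw [e2, map_add, inner_add_right, hPa, map_smul, map_smul, inner_smul_right,
      inner_smul_right, ← inner_conj_symm (hsVec X) (hsVec s), Complex.mul_conj'] at e1
    have e3 := congrArg Complex.re e1
    rw [Complex.ofReal_re, Complex.add_re, ← Complex.ofReal_pow, ← Complex.ofReal_mul,
      Complex.ofReal_re] at e3
    exact e3
  have h3 : (inner ℂ (hsVec X) (hsVec (H X)) : ℂ).re ≤ (1 - κ) * ‖hsVec X‖ ^ 2 := by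
    refine (Complex.re_le_norm _).trans ((norm_inner_le_norm _ _).trans ?_)
    nlinarith [norm_nonneg (hsVec X)]
  rw [h2]
  linarith

end Balanced

/-! ### Linear stability at a single spectral parameter -/

section Stability

variable {n d : ℕ} {K₀ : Mat n} {Ls : Fin d → Mat n} {Z : Matrix (Fin n) (Fin n) ℕ} {c : ℝ}

/-- Cauchy–Schwarz for ⟨S, S²⟩ = Tr S³ ≥ r Tr S². -/
lemma smul_norm_hsVec_le_of_smul_one_le {S : Mat n} {r : ℝ} (hr : 0 ≤ r)
    (h : (r : ℂ) • (1 : Mat n) ≤ S) : r * ‖hsVec S‖ ≤ ‖hsVec (S * S)‖ := by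
  have hS : 0 ≤ S := (smul_nonneg_of_nonneg hr zero_le_one).trans h
  have hSH : Sᴴ = S := (posSemidef_of_nonneg hS).isHermitian
  have h1 : r * ‖hsVec S‖ ^ 2 ≤ (inner ℂ (hsVec S) (hsVec (S * S)) : ℂ).re := by
    have h2 := trace_re_mono (conjTranspose_mul_mul_le h S)
    rw [Matrix.mul_smul, Matrix.mul_one, Matrix.smul_mul, Matrix.trace_smul, smul_eq_mul,
      Complex.re_ofReal_mul] at h2
    rwa [norm_hsVec_sq, inner_hsVec, ← Matrix.mul_assoc]
  have h2 := h1.trans ((Complex.re_le_norm _).trans (norm_inner_le_norm _ _))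
  rcases (norm_nonneg (hsVec S)).eq_or_lt with h0 | h0
  · rw [← h0, mul_zero]; exact norm_nonneg _
  · refine le_of_mul_le_mul_left ?_ h0
    linarith

lemma one_le_norm_one (hn : 0 < n) : 1 ≤ ‖(1 : Mat n)‖ := by
  have h := norm_entry_le_norm (1 : Mat n) ⟨0, hn⟩ ⟨0, hn⟩
  rwa [Matrix.one_apply_eq, norm_one] at h

/-- Stability at a spectral parameter with balanced solution. -/
lemma stability_of_balanced {L : ℕ} (hf : FlatWith (selfEnergy Ls) Z c)
    (hZ : ∀ k l, 0 < (Z ^ L) k l) (hn : 0 < n) {a b k τ η : ℝ} (ha : 0 < a) (hb : 0 < b)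
    (hk : 0 < k) (hτ : 0 < τ) (hη : 0 < η) {κ : ℝ}
    (hκ : κ = min 1 ((c * (c * ((k ^ 2)⁻¹) ^ 2) ^ L * ((k ^ 2)⁻¹) ^ 2) ^ 2))
    {N Q U : Mat n} (hQ : IsUnit Q) (hU₁ : U * Uᴴ = 1) (hU₂ : Uᴴ * U = 1) (hQk : ‖Q‖ ≤ k)
    (hQk' : ‖Q⁻¹‖ ≤ k) (hN : N = (η : ℂ) • (1 : Mat n) + selfEnergy Ls (Qᴴ * imPart U * Q))
    (hN₁ : ((a * τ : ℝ) : ℂ) • (1 : Mat n) ≤ N) (hN₂ : N ≤ ((b * τ : ℝ) : ℂ) • (1 : Mat n))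
    (hS : imPart U = Q * N * Qᴴ) (x : Mat n) :
    η / (b * k ^ 4 * τ) * ‖hsVec x‖ ≤
      ‖hsVec (x - U * selfEnergy (fun α => Q * Ls α * Qᴴ) x * U)‖ ∧
    2 * (a * τ * (k ^ 2)⁻¹) ^ 2 * ‖hsVec x‖ ≤
      (4 * (1 + 2 * (b * n * k ^ 8 / a)) + 16 * ((L + 1 : ℕ) : ℝ) / κ) *
        ‖hsVec (x - U * selfEnergy (fun α => Q * Ls α * Qᴴ) x * U)‖ := by
  have hc := hf.pos
  set F : Module.End ℂ (Mat n) := selfEnergy fun α => Q * Ls α * Qᴴ with hF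
  set S := imPart U with hSdef
  have hFpos : ∀ R, 0 ≤ R → 0 ≤ F R := fun R hR => selfEnergy_nonneg _ hR
  have hFsym : ∀ X Y, inner ℂ (hsVec (F X)) (hsVec Y) = inner ℂ (hsVec X) (hsVec (F Y)) :=
    inner_hsVec_selfEnergy _
  set r : ℝ := a * τ * (k ^ 2)⁻¹ with hr
  have hr0 : 0 < r := by positivity
  have hQQ := inv_sq_smul_one_le_mul_conjTranspose hQ hk hQk'
  have hQQ' : Q * Qᴴ ≤ ((k ^ 2 : ℝ) : ℂ) • (1 : Mat n) :=
    (mul_conjTranspose_le Q).trans (smul_le_smul_of_coeff_le (by gcongr) zero_le_one)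
  have hS₁ : (r : ℂ) • (1 : Mat n) ≤ S := by
    have h1 := mul_mul_conjTranspose_le hN₁ Q
    rw [← hS, Matrix.mul_smul, Matrix.mul_one, Matrix.smul_mul] at h1
    refine le_trans (le_of_eq ?_) ((smul_le_smul_of_le (by positivity) hQQ).trans h1)
    rw [smul_smul, ← Complex.ofReal_mul]
  have hS₂ : S ≤ ((b * τ * k ^ 2 : ℝ) : ℂ) • (1 : Mat n) := by
    have h1 := mul_mul_conjTranspose_le hN₂ Q
    rw [← hS, Matrix.mul_smul, Matrix.mul_one, Matrix.smul_mul] at h1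
    refine (h1.trans (smul_le_smul_of_le (by positivity) hQQ')).trans (le_of_eq ?_)
    rw [smul_smul, ← Complex.ofReal_mul]
  have hSpos : S.PosDef := posDef_of_smul_one_le hr0 hS₁
  have hS0 := nonneg_of_posSemidef hSpos.posSemidef
  have hFS : F S = S - (η : ℂ) • (Q * Qᴴ) := by
    have h1 : selfEnergy Ls (Qᴴ * S * Q) = N - (η : ℂ) • (1 : Mat n) := by
      rw [hN, add_sub_cancel_left]
    rw [hF, selfEnergy_conj, h1, Matrix.mul_sub, Matrix.sub_mul, ← hS, Matrix.mul_smul,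
      Matrix.mul_one, Matrix.smul_mul]
  -- Chosen so that θS ≤ θbτk² = η/k² ≤ ηQQ*, the right side being exactly the defect S - F[S].
  set θ : ℝ := η / (b * k ^ 4 * τ) with hθ
  have hθ0 : 0 < θ := by positivity
  have hFSθ : F S ≤ ((1 - θ : ℝ) : ℂ) • S := by
    rw [hFS, Complex.ofReal_sub, sub_smul, Complex.ofReal_one, one_smul]
    refine sub_le_sub_left ?_ S
    refine (smul_le_smul_of_le hθ0.le hS₂).trans ?_
    refine le_trans (le_of_eq ?_) (smul_le_smul_of_le hη.le hQQ)
    rw [smul_smul, smul_smul, ← Complex.ofReal_mul, ← Complex.ofReal_mul]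
    congr 2
    rw [hθ]; field_simp
  have hν0 : r ≤ ‖hsVec S‖ := by
    have h1 := CStarAlgebra.norm_le_norm_of_nonneg_of_le
      (smul_nonneg_of_nonneg hr0.le (zero_le_one (α := Mat n))) hS₁
    rw [norm_smul, Complex.norm_real, Real.norm_of_nonneg hr0.le] at h1
    have h2 := norm_le_norm_hsVec S
    nlinarith [one_le_norm_one hn]
  set ν := ‖hsVec S‖ with hν
  have hν1 : 0 < ν := hr0.trans_le hν0
  -- Compare traces in 0 ≤ F[S] ≤ (1 - θ)S.
  have hθ1 : 0 ≤ 1 - θ := by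
    have h1 := (hFpos S hS0).trans hFSθ
    by_contra! hlt
    have h2 := trace_re_nonneg h1
    rw [Matrix.trace_smul, smul_eq_mul, Complex.re_ofReal_mul] at h2
    have h3 := trace_re_mono hS₁
    rw [Matrix.trace_smul, Matrix.trace_one, smul_eq_mul, Complex.re_ofReal_mul,
      Fintype.card_fin, Complex.natCast_re] at h3
    have h4 : 0 < r * n := by positivity
    nlinarith
  have hcontr : ∀ X, ‖hsVec (F X)‖ ≤ (1 - θ) * ‖hsVec X‖ :=
    norm_hsVec_apply_le hFpos hFsym hSpos hθ1 hFSθ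
  set s : Mat n := ((ν⁻¹ : ℝ) : ℂ) • S with hs
  have hspos : s.PosDef := hSpos.smul (by
    have : 0 < ν⁻¹ := by positivity
    exact_mod_cast this : (0 : ℂ) < ((ν⁻¹ : ℝ) : ℂ))
  have hs1 : ‖hsVec s‖ = 1 := by
    rw [hs, map_smul, norm_smul, Complex.norm_real, Real.norm_of_nonneg (by positivity), ← hν,
      inv_mul_cancel₀ hν1.ne']
  have hsFs : s - F s = ((ν⁻¹ * η : ℝ) : ℂ) • (Q * Qᴴ) := by
    rw [hs, map_smul, ← smul_sub, hFS, sub_sub_cancel, smul_smul, ← Complex.ofReal_mul]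
  have hFs : F s ≤ s := by
    rw [← sub_nonneg, hsFs]
    exact smul_nonneg_of_nonneg (by positivity) (mul_star_self_nonneg Q)
  have hsF : ‖hsVec (s - F s)‖ ≤ b * n * k ^ 8 / a * θ := by
    rw [hsFs, map_smul, norm_smul, Complex.norm_real, Real.norm_of_nonneg (by positivity)]
    have h1 : ‖hsVec (Q * Qᴴ)‖ ≤ n * k ^ 2 := by
      refine (norm_hsVec_le _).trans ?_
      gcongr
      exact norm_le_of_le_smul_one (mul_star_self_nonneg Q) (by positivity) hQQ'
    have h2 : ν⁻¹ ≤ r⁻¹ := by gcongr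
    calc ν⁻¹ * η * ‖hsVec (Q * Qᴴ)‖ ≤ r⁻¹ * η * (n * k ^ 2) := by gcongr
      _ = b * n * k ^ 8 / a * θ := by rw [hθ, hr]; field_simp
  have hκ0 : 0 < κ := by rw [hκ]; positivity
  have hpow : ∀ R, 0 ≤ R → ((κ * R.trace.re : ℝ) : ℂ) • (1 : Mat n) ≤
      (F ^ (2 * (L + 1))) R := by
    intro R hR
    have h1 := smul_one_le_pow_apply hf hZ hQ hk hQk' hF hR
    have h2 := smul_one_le_pow_apply hf hZ hQ hk hQk' hF (pow_apply_nonneg hFpos (L + 1) hR)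
    rw [← Module.End.mul_apply, ← pow_add, ← two_mul] at h2
    refine le_trans (smul_le_smul_of_coeff_le ?_ zero_le_one) h2
    have h3 := trace_re_mono h1
    rw [Matrix.trace_smul, Matrix.trace_one, smul_eq_mul, Complex.re_ofReal_mul,
      Fintype.card_fin, Complex.natCast_re] at h3
    have htr := trace_re_nonneg hR
    set q := c * (c * ((k ^ 2)⁻¹) ^ 2) ^ L * ((k ^ 2)⁻¹) ^ 2 with hq
    have hq0 : 0 < q := by positivity
    have hn1 : (1 : ℝ) ≤ n := by exact_mod_cast hn
    calc κ * R.trace.re ≤ q ^ 2 * R.trace.re := by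
          gcongr; rw [hκ]; exact min_le_right _ _
      _ = q * (q * R.trace.re * 1) := by ring
      _ ≤ q * (q * R.trace.re * n) := by gcongr
      _ ≤ _ := by gcongr
  have hgap := norm_hsVec_pow_apply_sq_le hFpos hFsym hspos hs1 hFs hκ0.le
    (by rw [hκ]; exact min_le_left _ _) hpow
  have hsH : sᴴ = s := hspos.isHermitian
  -- The adjoint of X ↦ U X U applied to s.
  have hw1 : ‖hsVec (Uᴴ * s * Uᴴ)‖ = 1 := by
    rw [norm_hsVec_mul_unitary (by rwa [Matrix.conjTranspose_conjTranspose]),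
      norm_hsVec_unitary_mul (by rwa [Matrix.conjTranspose_conjTranspose]), hs1]
  have hmain := mul_norm_le_norm_sub_comp hsVec F (fun X => U * X * U) hFsym
    (fun X => by rw [norm_hsVec_mul_unitary hU₁, norm_hsVec_unitary_mul hU₂]) hθ0.le hκ0
    (show 0 ≤ b * n * k ^ 8 / a by positivity) hcontr hgap hs1 hsF hw1 (fun X => by
      rw [inner_hsVec, inner_hsVec, Matrix.conjTranspose_mul, Matrix.conjTranspose_mul,
        Matrix.conjTranspose_conjTranspose, hsH, ← Matrix.mul_assoc, Matrix.trace_mul_comm]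
      simp only [Matrix.mul_assoc]) x
  refine ⟨hmain.1, le_trans ?_ hmain.2⟩
  refine mul_le_mul_of_nonneg_right ?_ (norm_nonneg _)
  have hcomm : S * Uᴴ = Uᴴ * S := by
    rw [hSdef, imPart, Matrix.smul_mul, Matrix.mul_smul, Matrix.sub_mul, Matrix.mul_sub, hU₁, hU₂]
  -- S commutes with U*, and U - U* = 2iS. The displacement of s under the adjoint isometry is
  -- therefore of the size of S²/‖S‖, at least 2r with r of order τ; squaring it produces the τ² in
  -- the stability bound.
  have hdiff : Uᴴ * s * Uᴴ - s = (-(2 * Complex.I) * ((ν⁻¹ : ℝ) : ℂ)) • (Uᴴ * (S * S)) := by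
    have h1 : (2 * Complex.I) • S = U - Uᴴ := by
      rw [hSdef, imPart, smul_smul, mul_inv_cancel₀ (by simp), one_smul]
    have h2 : (2 * Complex.I) • (Uᴴ * (S * S)) = S - Uᴴ * S * Uᴴ := by
      rw [← Matrix.mul_assoc, ← Matrix.smul_mul, ← Matrix.mul_smul, h1, Matrix.mul_sub, hU₂,
        Matrix.sub_mul, Matrix.one_mul, Matrix.mul_assoc Uᴴ S, hcomm, ← Matrix.mul_assoc]
    rw [neg_mul, neg_smul, mul_comm, mul_smul, h2, hs, Matrix.mul_smul, Matrix.smul_mul,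
      ← smul_sub, ← smul_neg, neg_sub]
  have hnd : 2 * r ≤ ‖hsVec (Uᴴ * s * Uᴴ - s)‖ := by
    rw [hdiff, map_smul, norm_smul, norm_hsVec_unitary_mul (by
      rwa [Matrix.conjTranspose_conjTranspose])]
    have h1 := smul_norm_hsVec_le_of_smul_one_le hr0.le hS₁
    have h2 : ‖-(2 * Complex.I) * ((ν⁻¹ : ℝ) : ℂ)‖ = 2 * ν⁻¹ := by
      rw [norm_mul, norm_neg, Complex.norm_real, Real.norm_of_nonneg (by positivity)]
      simp
    rw [h2]
    calc 2 * r = 2 * ν⁻¹ * (r * ν) := by field_simp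
      _ ≤ 2 * ν⁻¹ * ‖hsVec (S * S)‖ := by gcongr
  have hsq : ‖hsVec (Uᴴ * s * Uᴴ - s)‖ ^ 2 =
      2 * (1 - (inner ℂ (hsVec (Uᴴ * s * Uᴴ)) (hsVec s)).re) := by
    rw [map_sub, @norm_sub_sq ℂ, hw1, hs1]
    simp only [RCLike.re_eq_complex_re]
    ring
  have h1 : (2 * r) ^ 2 ≤ ‖hsVec (Uᴴ * s * Uᴴ - s)‖ ^ 2 := by gcongr
  linarith

/-- Linear stability for solutions with bounded inverse, with a bound that degenerates only where
`Im T` and `Im T / Im z` do. -/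
lemma exists_stability_of_norm_inv_le {L : ℕ} (hK₀ : K₀.IsHermitian)
    (hf : FlatWith (selfEnergy Ls) Z c) (hZ : ∀ k l, 0 < (Z ^ L) k l) (hn : 0 < n)
    {K : ℝ} (hK : 0 < K) :
    ∃ C : ℝ, 0 < C ∧ ∀ z T, 0 < z.im → SolvesAt K₀ (selfEnergy Ls) z T → ‖T⁻¹‖ ≤ K → ∀ X,
      (imPart T).trace.re ^ 2 * ‖X‖ ≤ C * ‖X - T * selfEnergy Ls X * T‖ ∧
      z.im * ‖X‖ ≤ C * (imPart T).trace.re * ‖X - T * selfEnergy Ls X * T‖ := by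
  obtain ⟨a, b, ha, hb, hab⟩ := exists_comparable_of_norm_inv_le hK₀ hf hZ hn hK
  have hc := hf.pos
  set k : ℝ := 1 + a⁻¹ + b / a with hk
  have hk0 : 0 < k := by positivity
  set κ : ℝ := min 1 ((c * (c * ((k ^ 2)⁻¹) ^ 2) ^ L * ((k ^ 2)⁻¹) ^ 2) ^ 2) with hκ
  have hκ0 : 0 < κ := by positivity
  set C' : ℝ := 4 * (1 + 2 * (b * n * k ^ 8 / a)) + 16 * ((L + 1 : ℕ) : ℝ) / κ with hC'
  have hC'0 : 0 < C' := by positivity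
  have hn' : (0 : ℝ) < n := by exact_mod_cast hn
  refine ⟨(2 * (a * (k ^ 2)⁻¹) ^ 2)⁻¹ * C' * n * k ^ 4 + b * k ^ 8 * n, by positivity,
    fun z T hz h hT X => ?_⟩
  obtain ⟨h1, h2, h3⟩ := hab z T hz h hT
  have hV := nonneg_of_posSemidef h.1.posSemidef
  set τ := (imPart T).trace.re with hτ
  have hτ0 : 0 < τ := by
    have : Nonempty (Fin n) := ⟨⟨0, hn⟩⟩
    exact (Complex.lt_def.1 h.1.trace_pos).1
  obtain ⟨Q, U, hQ, hU₁, hU₂, hTQ, hQk, hQk', hVS, hS⟩ :=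
    exists_balanced hK₀ h ha hb hτ0 h1 (le_trace_smul_one hV) h2 h3
  have hQd := (Matrix.isUnit_iff_isUnit_det _).1 hQ
  have hQHd := (Matrix.isUnit_iff_isUnit_det _).1 (isUnit_conjTranspose hQ)
  -- Balanced coordinates: in them Id - C_T Γ acts as x ↦ x - U F[x] U, and both changes of variable
  -- are bounded by powers of k.
  set x : Mat n := Q⁻¹ᴴ * X * Q⁻¹ with hx
  have hXx : X = Qᴴ * x * Q := by
    rw [hx, ← Matrix.mul_assoc, ← Matrix.mul_assoc, ← Matrix.conjTranspose_mul,
      Matrix.nonsing_inv_mul _ hQd, Matrix.conjTranspose_one, Matrix.one_mul,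
      Matrix.nonsing_inv_mul_cancel_right _ _ hQd]
  obtain ⟨e1, e2⟩ := stability_of_balanced hf hZ hn ha hb hk0 hτ0 hz hκ hQ hU₁ hU₂ hQk hQk'
    (by rw [← hVS]; rfl) h2 h3 hS x
  set y := x - U * selfEnergy (fun α => Q * Ls α * Qᴴ) x * U with hy
  have hyX : y = Q⁻¹ᴴ * (X - T * selfEnergy Ls X * T) * Q⁻¹ := by
    rw [hy, selfEnergy_conj, ← hXx, Matrix.mul_sub, Matrix.sub_mul, ← hx, hTQ,
      Matrix.conjTranspose_nonsing_inv]
    congr 1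
    simp only [← Matrix.mul_assoc]
    rw [Matrix.nonsing_inv_mul _ hQHd, Matrix.one_mul, Matrix.mul_nonsing_inv_cancel_right _ _ hQd]
  have hnX : ‖X‖ ≤ k ^ 2 * ‖hsVec x‖ := by
    rw [hXx]
    calc ‖Qᴴ * x * Q‖ ≤ ‖Qᴴ‖ * ‖x‖ * ‖Q‖ :=
          (norm_mul_le _ _).trans (by gcongr; exact norm_mul_le _ _)
      _ ≤ k * ‖hsVec x‖ * k := by
          rw [Matrix.l2_opNorm_conjTranspose]
          gcongr
          exact norm_le_norm_hsVec x
      _ = k ^ 2 * ‖hsVec x‖ := by ring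
  have hny : ‖hsVec y‖ ≤ n * k ^ 2 * ‖X - T * selfEnergy Ls X * T‖ := by
    refine (norm_hsVec_le _).trans ?_
    rw [hyX, mul_assoc (n : ℝ)]
    refine mul_le_mul_of_nonneg_left ?_ hn'.le
    calc ‖Q⁻¹ᴴ * (X - T * selfEnergy Ls X * T) * Q⁻¹‖
        ≤ ‖Q⁻¹ᴴ‖ * ‖X - T * selfEnergy Ls X * T‖ * ‖Q⁻¹‖ :=
          (norm_mul_le _ _).trans (by gcongr; exact norm_mul_le _ _)
      _ ≤ k * ‖X - T * selfEnergy Ls X * T‖ * k := by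
          rw [Matrix.l2_opNorm_conjTranspose]
          gcongr
      _ = k ^ 2 * ‖X - T * selfEnergy Ls X * T‖ := by ring
  set D := ‖X - T * selfEnergy Ls X * T‖ with hD
  have hD0 : 0 ≤ D := norm_nonneg _
  constructor
  · have e3 : τ ^ 2 * ‖hsVec x‖ ≤ (2 * (a * (k ^ 2)⁻¹) ^ 2)⁻¹ * (C' * ‖hsVec y‖) := by
      rw [le_inv_mul_iff₀ (by positivity)]
      refine le_trans (le_of_eq ?_) e2
      ring
    calc τ ^ 2 * ‖X‖ ≤ τ ^ 2 * (k ^ 2 * ‖hsVec x‖) := by gcongr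
      _ = k ^ 2 * (τ ^ 2 * ‖hsVec x‖) := by ring
      _ ≤ k ^ 2 * ((2 * (a * (k ^ 2)⁻¹) ^ 2)⁻¹ * (C' * (n * k ^ 2 * D))) := by
          refine mul_le_mul_of_nonneg_left (e3.trans ?_) (by positivity)
          gcongr
      _ = (2 * (a * (k ^ 2)⁻¹) ^ 2)⁻¹ * C' * n * k ^ 4 * D := by ring
      _ ≤ _ := by
          gcongr
          exact le_add_of_nonneg_right (by positivity)
  · have e3 : z.im * ‖hsVec x‖ ≤ b * k ^ 4 * τ * ‖hsVec y‖ := by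
      rw [div_mul_eq_mul_div, div_le_iff₀ (by positivity)] at e1
      linarith
    calc z.im * ‖X‖ ≤ z.im * (k ^ 2 * ‖hsVec x‖) := by gcongr
      _ = k ^ 2 * (z.im * ‖hsVec x‖) := by ring
      _ ≤ k ^ 2 * (b * k ^ 4 * τ * (n * k ^ 2 * D)) := by
          refine mul_le_mul_of_nonneg_left (e3.trans ?_) (by positivity)
          gcongr
      _ = b * k ^ 8 * n * τ * D := by ring
      _ ≤ _ := by
          gcongr
          exact le_add_of_nonneg_left (by positivity)

end Stability

/-! ### Stability at all spectral parameters, including large ones. -/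

section GlobalStability

variable {n d : ℕ} {K₀ : Mat n} {Ls : Fin d → Mat n} {Z : Matrix (Fin n) (Fin n) ℕ} {c : ℝ}

/-- For small T the operator is a perturbation of the identity of norm at most 1/2. -/
lemma norm_le_two_mul_norm_sub {g : ℝ} (hg : ∀ X, ‖selfEnergy Ls X‖ ≤ g * ‖X‖) {T : Mat n}
    (hT : g * ‖T‖ ^ 2 ≤ 1 / 2) (X : Mat n) : ‖X‖ ≤ 2 * ‖X - T * selfEnergy Ls X * T‖ := by
  have h1 : ‖T * selfEnergy Ls X * T‖ ≤ 1 / 2 * ‖X‖ := by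
    calc ‖T * selfEnergy Ls X * T‖ ≤ ‖T‖ * ‖selfEnergy Ls X‖ * ‖T‖ :=
          (norm_mul_le _ _).trans (by gcongr; exact norm_mul_le _ _)
      _ ≤ ‖T‖ * (g * ‖X‖) * ‖T‖ := by gcongr; exact hg X
      _ = g * ‖T‖ ^ 2 * ‖X‖ := by ring
      _ ≤ 1 / 2 * ‖X‖ := by gcongr
  have h2 := norm_add_le (X - T * selfEnergy Ls X * T) (T * selfEnergy Ls X * T)
  rw [sub_add_cancel] at h2
  linarith

/-- Linear stability for all solutions of the Dyson equation. -/
lemma exists_stability {L : ℕ} (hK₀ : K₀.IsHermitian)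
    (hf : FlatWith (selfEnergy Ls) Z c) (hZ : ∀ k l, 0 < (Z ^ L) k l) (hn : 0 < n) :
    ∃ C : ℝ, 0 < C ∧ ∀ z T, 0 < z.im → SolvesAt K₀ (selfEnergy Ls) z T → ∀ X,
      (imPart T).trace.re ^ 2 * ‖X‖ ≤ C * ‖X - T * selfEnergy Ls X * T‖ ∧
      (‖X‖ ≤ C * ‖X - T * selfEnergy Ls X * T‖ ∨
        z.im * ‖X‖ ≤ C * (imPart T).trace.re * ‖X - T * selfEnergy Ls X * T‖) := by
  obtain ⟨g, hg0, hg⟩ := exists_norm_apply_le (selfEnergy Ls)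
  obtain ⟨C₀, hC₀, hb⟩ := exists_norm_bounds hK₀ hf
  set R : ℝ := 2 * C₀ + (8 * g + 1) with hR
  have hR0 : 0 < R := by positivity
  obtain ⟨C₁, hC₁, h₁⟩ := exists_stability_of_norm_inv_le hK₀ hf hZ hn
    (show 0 < R + C₀ by positivity)
  refine ⟨C₁ + 2 * (n * C₀) ^ 2 + 2, by positivity, fun z T hz h X => ?_⟩
  obtain ⟨hT, hTi, hzT⟩ := hb z T hz h
  have hV := nonneg_of_posSemidef h.1.posSemidef
  have hτ0 := trace_re_nonneg hV
  have hτ : (imPart T).trace.re ≤ n * C₀ :=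
    (trace_re_le_mul_norm hV).trans (by gcongr; exact (norm_imPart_le T).trans hT)
  set D := ‖X - T * selfEnergy Ls X * T‖ with hD
  have hD0 : 0 ≤ D := norm_nonneg _
  have hle : C₁ ≤ C₁ + 2 * (n * C₀) ^ 2 + 2 := by
    have : 0 ≤ 2 * (n * C₀) ^ 2 := by positivity
    linarith
  rcases le_total ‖z‖ R with hzR | hzR
  · obtain ⟨e1, e2⟩ := h₁ z T hz h (hTi.trans (by linarith)) X
    exact ⟨e1.trans (by gcongr), Or.inr (e2.trans (by gcongr))⟩
  -- At infinity Im T is of order Im z/|z|², so the bound involving Im z/τ could not hold uniformly;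
  -- the perturbative alternative replaces it.
  · have hz0 : 0 < ‖z‖ := hR0.trans_le hzR
    have hT2 : ‖z‖ * ‖T‖ ≤ 2 := by nlinarith [norm_nonneg T]
    have hsmall : g * ‖T‖ ^ 2 ≤ 1 / 2 := by
      have h1 : 8 * g ≤ ‖z‖ ^ 2 := by nlinarith
      have h2 : (‖z‖ * ‖T‖) ^ 2 ≤ 2 ^ 2 := by gcongr
      have h3 : 8 * g * ‖T‖ ^ 2 ≤ ‖z‖ ^ 2 * ‖T‖ ^ 2 := by gcongr
      rw [mul_pow] at h2
      linarith
    have hX : ‖X‖ ≤ 2 * D := norm_le_two_mul_norm_sub hg hsmall X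
    have h2C : 2 ≤ C₁ + 2 * (n * C₀) ^ 2 + 2 := by
      have : 0 ≤ 2 * (n * C₀) ^ 2 := by positivity
      linarith
    refine ⟨?_, Or.inl (hX.trans (by gcongr))⟩
    calc (imPart T).trace.re ^ 2 * ‖X‖ ≤ (n * C₀) ^ 2 * (2 * D) := by gcongr
      _ = 2 * (n * C₀) ^ 2 * D := by ring
      _ ≤ _ := by
        refine mul_le_mul_of_nonneg_right ?_ hD0
        linarith

end GlobalStability

/-! ### Uniqueness of the solution -/

section Uniqueness

variable {n d : ℕ} {K₀ : Mat n} {Ls : Fin d → Mat n}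

/-- The quadratic form of a matrix. -/
def quadRe (V : Mat n) (x : Fin n → ℂ) : ℝ := (star x ⬝ᵥ V *ᵥ x).re

lemma quadRe_mono {A B : Mat n} (h : A ≤ B) (x : Fin n → ℂ) : quadRe A x ≤ quadRe B x := by
  have := (Complex.le_def.1 ((Matrix.le_iff.1 h).dotProduct_mulVec_nonneg x)).1
  rw [Matrix.sub_mulVec, dotProduct_sub, Complex.sub_re] at this
  exact sub_nonneg.1 this

lemma quadRe_smul (r : ℝ) (A : Mat n) (x : Fin n → ℂ) :
    quadRe ((r : ℂ) • A) x = r * quadRe A x := by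
  rw [quadRe, Matrix.smul_mulVec, dotProduct_smul, smul_eq_mul, Complex.re_ofReal_mul, quadRe]

lemma quadRe_one (x : Fin n → ℂ) : quadRe (1 : Mat n) x = ∑ i, ‖x i‖ ^ 2 := by
  rw [quadRe, Matrix.one_mulVec, dotProduct, Complex.re_sum]
  refine Finset.sum_congr rfl fun i _ => ?_
  rw [Pi.star_apply, Complex.star_def, Complex.conj_mul', ← Complex.ofReal_pow, Complex.ofReal_re]

lemma dotProduct_conj_mulVec (A R B : Mat n) (x y : Fin n → ℂ) :
    star x ⬝ᵥ (Aᴴ * R * B) *ᵥ y = star (A *ᵥ x) ⬝ᵥ R *ᵥ (B *ᵥ y) := by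
  rw [Matrix.star_mulVec, ← Matrix.dotProduct_mulVec, Matrix.mulVec_mulVec, Matrix.mulVec_mulVec,
    Matrix.mul_assoc]

/-- Positive definite forms dominate all coordinates. The resulting t may depend on everything, as
it only starts the iteration in `SolvesAt.unique`. -/
lemma exists_norm_dotProduct_le {V₁ V₂ : Mat n} (h₁ : V₁.PosDef) (h₂ : V₂.PosDef) (R : Mat n) :
    ∃ t : ℝ, ∀ x y : Fin n → ℂ,
      ‖star x ⬝ᵥ R *ᵥ y‖ ≤ t * (√(quadRe V₁ x) * √(quadRe V₂ y)) := by
  have hentry : ∀ V : Mat n, V.PosDef → ∃ s : ℝ, 0 ≤ s ∧ ∀ (x : Fin n → ℂ) i,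
      ‖x i‖ ≤ s * √(quadRe V x) := by
    intro V hV
    obtain ⟨r, hr, hrV⟩ := exists_smul_one_le hV
    refine ⟨√r⁻¹, Real.sqrt_nonneg _, fun x i => ?_⟩
    rw [← Real.sqrt_mul (by positivity)]
    refine Real.le_sqrt_of_sq_le ?_
    have h1 := quadRe_mono hrV x
    rw [quadRe_smul, quadRe_one] at h1
    rw [le_inv_mul_iff₀ hr]
    refine le_trans ?_ h1
    exact mul_le_mul_of_nonneg_left (Finset.single_le_sum (f := fun i => ‖x i‖ ^ 2)
      (fun _ _ => by positivity) (Finset.mem_univ i)) hr.le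
  obtain ⟨s₁, hs₁, e₁⟩ := hentry V₁ h₁
  obtain ⟨s₂, hs₂, e₂⟩ := hentry V₂ h₂
  refine ⟨∑ _i : Fin n, ∑ _j : Fin n, s₁ * (‖R‖ * s₂), fun x y => ?_⟩
  rw [Finset.sum_mul, dotProduct]
  refine (norm_sum_le _ _).trans (Finset.sum_le_sum fun i _ => ?_)
  rw [Matrix.mulVec, dotProduct, Finset.mul_sum, Finset.sum_mul]
  refine (norm_sum_le _ _).trans (Finset.sum_le_sum fun j _ => ?_)
  rw [norm_mul, norm_mul, Pi.star_apply, norm_star]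
  calc ‖x i‖ * (‖R i j‖ * ‖y j‖) ≤ s₁ * √(quadRe V₁ x) * (‖R‖ * (s₂ * √(quadRe V₂ y))) := by
        gcongr
        exacts [e₁ x i, norm_entry_le_norm R i j, e₂ y j]
    _ = _ := by ring

/-- The Kraus operators of the self-energy. -/
def krausOp (Ls : Fin d → Mat n) : Fin d ⊕ Fin d → Mat n := Sum.elim Ls fun α => (Ls α)ᴴ

lemma selfEnergy_eq_sum_krausOp (R : Mat n) :
    selfEnergy Ls R = ∑ a, krausOp Ls a * R * (krausOp Ls a)ᴴ := by
  simp [selfEnergy_apply, krausOp, Finset.sum_add_distrib]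

lemma dotProduct_selfEnergy (A R B : Mat n) (x y : Fin n → ℂ) :
    star x ⬝ᵥ (Aᴴ * selfEnergy Ls R * B) *ᵥ y =
      ∑ a, star (((krausOp Ls a)ᴴ * A) *ᵥ x) ⬝ᵥ R *ᵥ (((krausOp Ls a)ᴴ * B) *ᵥ y) := by
  rw [selfEnergy_eq_sum_krausOp, Matrix.mul_sum, Matrix.sum_mul, Matrix.sum_mulVec,
    dotProduct_sum]
  refine Finset.sum_congr rfl fun a _ => ?_
  rw [← dotProduct_conj_mulVec, Matrix.conjTranspose_mul, Matrix.conjTranspose_conjTranspose]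
  simp only [Matrix.mul_assoc]

lemma quadRe_selfEnergy (A V : Mat n) (x : Fin n → ℂ) :
    quadRe (Aᴴ * selfEnergy Ls V * A) x = ∑ a, quadRe V (((krausOp Ls a)ᴴ * A) *ᵥ x) := by
  rw [quadRe, dotProduct_selfEnergy, Complex.re_sum]
  rfl

/-- In finite dimension a strict inequality leaves room for a factor q < 1. -/
lemma exists_le_smul_of_sub_posDef {V W : Mat n} (hV : V.PosDef) (h : (V - W).PosDef) :
    ∃ q : ℝ, 0 ≤ q ∧ q < 1 ∧ W ≤ (q : ℂ) • V := by
  obtain ⟨r, hr, hrY⟩ := exists_smul_one_le h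
  have hV0 := nonneg_of_posSemidef hV.posSemidef
  set v := ‖V‖ + 1 with hv
  have hv0 : 0 < v := by positivity
  refine ⟨max 0 (1 - r / v), le_max_left _ _, max_lt one_pos (by
    have : 0 < r / v := by positivity
    linarith), ?_⟩
  refine le_trans ?_ (smul_le_smul_of_coeff_le (le_max_right _ _) hV0)
  have h1 : V ≤ (v : ℂ) • (1 : Mat n) := (le_norm_smul_one hV.isHermitian).trans
    (smul_le_smul_of_coeff_le (by linarith) zero_le_one)
  have h2 := smul_le_smul_of_le (r := r / v) (by positivity) h1
  rw [smul_smul, ← Complex.ofReal_mul, div_mul_cancel₀ _ hv0.ne'] at h2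
  rw [Complex.ofReal_sub, sub_smul, Complex.ofReal_one, one_smul]
  exact le_sub_comm.1 (h2.trans hrY)

/-- The Dyson equation has at most one solution at a given spectral parameter. -/
lemma SolvesAt.unique (hK₀ : K₀.IsHermitian) {z : ℂ} (hz : 0 < z.im) {T₁ T₂ : Mat n}
    (h₁ : SolvesAt K₀ (selfEnergy Ls) z T₁) (h₂ : SolvesAt K₀ (selfEnergy Ls) z T₂) :
    T₁ = T₂ := by
  have hu₁ := isUnit_of_imPart_posDef h₁.1
  have hu₂ := isUnit_of_imPart_posDef h₂.1
  have hd₁ := (Matrix.isUnit_iff_isUnit_det _).1 hu₁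
  have hd₂ := (Matrix.isUnit_iff_isUnit_det _).1 hu₂
  set R := T₁ - T₂ with hR
  -- Difference of the two equations. The double adjoint puts it in the form A* Γ[R] B with A = T₁*,
  -- as in `dotProduct_selfEnergy`.
  have hRR : R = T₁ᴴᴴ * selfEnergy Ls R * T₂ := by
    have h1 : selfEnergy Ls R = T₂⁻¹ - T₁⁻¹ := by
      have e1 : selfEnergy Ls T₁ = -T₁⁻¹ - (z • (1 : Mat n) - K₀) := by rw [h₁.2]; abel
      have e2 : selfEnergy Ls T₂ = -T₂⁻¹ - (z • (1 : Mat n) - K₀) := by rw [h₂.2]; abel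
      rw [hR, map_sub, e1, e2]; abel
    rw [h1, Matrix.conjTranspose_conjTranspose, Matrix.mul_sub, Matrix.sub_mul,
      Matrix.nonsing_inv_mul_cancel_right _ _ hd₂, Matrix.mul_nonsing_inv _ hd₁, Matrix.one_mul]
  have hz1 : ((z.im : ℂ) • (1 : Mat n)).PosDef :=
    Matrix.PosDef.one.smul (by exact_mod_cast hz : (0 : ℂ) < (z.im : ℂ))
  have hq₁ : ∃ q : ℝ, 0 ≤ q ∧ q < 1 ∧
      T₁ᴴᴴ * selfEnergy Ls (imPart T₁) * T₁ᴴ ≤ (q : ℂ) • imPart T₁ := by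
    refine exists_le_smul_of_sub_posDef h₁.1 ?_
    have e : imPart T₁ - T₁ᴴᴴ * selfEnergy Ls (imPart T₁) * T₁ᴴ =
        T₁ * ((z.im : ℂ) • (1 : Mat n)) * T₁ᴴ := by
      conv_lhs => rw [Matrix.conjTranspose_conjTranspose]
      conv_lhs => enter [1]; rw [imPart_eq_mul_invIm_mul hK₀ h₁, invIm]
      rw [← Matrix.sub_mul, ← Matrix.mul_sub, add_sub_cancel_right]
    rw [e]
    exact (Matrix.IsUnit.posDef_star_right_conjugate_iff hu₁).2 hz1
  have hq₂ : ∃ q : ℝ, 0 ≤ q ∧ q < 1 ∧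
      T₂ᴴ * selfEnergy Ls (imPart T₂) * T₂ ≤ (q : ℂ) • imPart T₂ := by
    refine exists_le_smul_of_sub_posDef h₂.1 ?_
    have e : imPart T₂ - T₂ᴴ * selfEnergy Ls (imPart T₂) * T₂ =
        T₂ᴴ * ((z.im : ℂ) • (1 : Mat n)) * T₂ := by
      conv_lhs => enter [1]; rw [imPart_eq_conjTranspose_mul_invIm_mul hK₀ h₂, invIm]
      rw [← Matrix.sub_mul, ← Matrix.mul_sub, add_sub_cancel_right]
    rw [e]
    exact (Matrix.IsUnit.posDef_star_left_conjugate_iff hu₂).2 hz1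
  obtain ⟨q₁, hq₁0, hq₁1, hq₁⟩ := hq₁
  obtain ⟨q₂, hq₂0, hq₂1, hq₂⟩ := hq₂
  obtain ⟨t₀, ht₀⟩ := exists_norm_dotProduct_le h₁.1 h₂.1 R
  set q := √q₁ * √q₂ with hq
  have hq0 : 0 ≤ q := by positivity
  have hq1 : q < 1 := by
    have e1 : √q₁ < 1 := by rw [Real.sqrt_lt' one_pos]; linarith
    have e2 : √q₂ < 1 := by rw [Real.sqrt_lt' one_pos]; linarith
    exact mul_lt_one_of_nonneg_of_lt_one_left (Real.sqrt_nonneg _) e1 e2.le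
  set t := max t₀ 0 with ht
  -- Each use of the fixed-point relation writes the form of R as a sum over Kraus operators.
  -- Cauchy–Schwarz over that sum reassembles T₁ Γ[Im T₁] T₁* and T₂* Γ[Im T₂] T₂, which are
  -- strictly below Im T₁ and Im T₂ because Im z > 0; hence a factor q < 1 per step.
  have hiter : ∀ (k : ℕ) (x y : Fin n → ℂ),
      ‖star x ⬝ᵥ R *ᵥ y‖ ≤ t * q ^ k * (√(quadRe (imPart T₁) x) * √(quadRe (imPart T₂) y)) := by
    intro k
    induction k with
    | zero =>
      intro x y
      refine (ht₀ x y).trans ?_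
      rw [pow_zero, mul_one]
      gcongr
      exact le_max_left _ _
    | succ k ih =>
      intro x y
      rw [hRR, dotProduct_selfEnergy]
      have hs₁ := quadRe_mono hq₁ x
      have hs₂ := quadRe_mono hq₂ y
      rw [quadRe_smul, quadRe_selfEnergy] at hs₁ hs₂
      have ht0 : 0 ≤ t * q ^ k := by positivity
      refine (norm_sum_le _ _).trans ((Finset.sum_le_sum fun a _ => ih _ _).trans ?_)
      rw [← Finset.mul_sum]
      have hnn : ∀ (T : Mat n), (imPart T).PosDef → ∀ x, 0 ≤ quadRe (imPart T) x := fun T hT x =>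
        (Complex.le_def.1 (hT.posSemidef.dotProduct_mulVec_nonneg x)).1
      refine (mul_le_mul_of_nonneg_left (Real.sum_sqrt_mul_sqrt_le _ (fun a => hnn _ h₁.1 _)
        fun a => hnn _ h₂.1 _) ht0).trans ?_
      calc t * q ^ k * (√(∑ a, quadRe (imPart T₁) (((krausOp Ls a)ᴴ * T₁ᴴ) *ᵥ x)) *
            √(∑ a, quadRe (imPart T₂) (((krausOp Ls a)ᴴ * T₂) *ᵥ y)))
          ≤ t * q ^ k * (√(q₁ * quadRe (imPart T₁) x) * √(q₂ * quadRe (imPart T₂) y)) := by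
            gcongr
        _ = t * q ^ (k + 1) * (√(quadRe (imPart T₁) x) * √(quadRe (imPart T₂) y)) := by
            rw [Real.sqrt_mul hq₁0, Real.sqrt_mul hq₂0, hq]; ring
  have hzero : ∀ x y : Fin n → ℂ, star x ⬝ᵥ R *ᵥ y = 0 := by
    intro x y
    rw [← norm_le_zero_iff]
    have hlim : Tendsto (fun k : ℕ => t * q ^ k *
        (√(quadRe (imPart T₁) x) * √(quadRe (imPart T₂) y))) atTop (𝓝 0) := by
      have := ((tendsto_pow_atTop_nhds_zero_of_lt_one hq0 hq1).const_mul t).mul_const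
        (√(quadRe (imPart T₁) x) * √(quadRe (imPart T₂) y))
      simpa using this
    exact ge_of_tendsto hlim (Filter.Eventually.of_forall fun k => hiter k x y)
  have hR0 : R = 0 := by
    ext i j
    have := hzero (Pi.single i 1) (Pi.single j 1)
    rw [Matrix.mulVec_single_one, ← Pi.single_star, star_one, single_one_dotProduct] at this
    exact this
  exact sub_eq_zero.1 hR0

end Uniqueness

/-! ### Analyticity -/

section Analytic

variable {n d : ℕ}

lemma stability_apply (Γ : Mat n →ₗ[ℂ] Mat n) (T X : Mat n) :
    stability Γ T X = X - T * Γ X * T := rfl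

/-- The map whose value at a solution of the Dyson equation is the spectral parameter. -/
def dysonMap (K₀ : Mat n) (Γ : Mat n →ₗ[ℂ] Mat n) (T : Mat n) : Mat n := K₀ - Γ T - T⁻¹

lemma solvesAt_iff {K₀ : Mat n} {Γ : Mat n →ₗ[ℂ] Mat n} {z : ℂ} {T : Mat n} :
    SolvesAt K₀ Γ z T ↔ (imPart T).PosDef ∧ dysonMap K₀ Γ T = z • (1 : Mat n) := by
  rw [SolvesAt, dysonMap]
  refine and_congr_right fun _ => ⟨fun h => ?_, fun h => ?_⟩
  · rw [sub_eq_add_neg, h]; abel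
  · rw [← h]; abel

lemma eventually_imPart_posDef {T : Mat n} (h : (imPart T).PosDef) :
    ∀ᶠ S in 𝓝 T, (imPart S).PosDef := by
  obtain ⟨r, hr, hrT⟩ := exists_smul_one_le h
  filter_upwards [Metric.ball_mem_nhds T (half_pos hr)] with S hS
  refine posDef_of_smul_one_le (half_pos hr) ?_
  have h1 : -imPart (S - T) ≤ ((r / 2 : ℝ) : ℂ) • (1 : Mat n) := by
    refine (le_norm_smul_one (imPart_isHermitian (S - T)).neg).trans
      (smul_le_smul_of_coeff_le ?_ zero_le_one)
    rw [norm_neg]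
    refine (norm_imPart_le _).trans ?_
    rw [← dist_eq_norm]; exact (Metric.mem_ball.1 hS).le
  have h2 : imPart S = imPart T - -imPart (S - T) := by rw [imPart_sub]; abel
  rw [h2]
  refine le_trans (le_of_eq ?_) (sub_le_sub hrT h1)
  rw [← sub_smul, ← Complex.ofReal_sub, sub_half]

/-- The inverse function theorem for the Dyson equation at a matrix with injective stability
operator. -/
lemma exists_analytic_local_inverse (K₀ : Mat n) (Γ : Mat n →ₗ[ℂ] Mat n) {T₀ : Mat n}
    (hT₀ : IsUnit T₀) (hinj : ∀ X, X - T₀ * Γ X * T₀ = 0 → X = 0) {z₀ : ℂ}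
    (hz₀ : dysonMap K₀ Γ T₀ = z₀ • (1 : Mat n)) :
    ∃ F : ℂ → Mat n, AnalyticAt ℂ F z₀ ∧ F z₀ = T₀ ∧
      (∀ᶠ z in 𝓝 z₀, dysonMap K₀ Γ (F z) = z • (1 : Mat n)) ∧
      ∀ᶠ T in 𝓝 T₀, ∀ z : ℂ, dysonMap K₀ Γ T = z • (1 : Mat n) → F z = T := by
  have hd := (Matrix.isUnit_iff_isUnit_det _).1 hT₀
  have hfun : dysonMap K₀ Γ =
      fun T => K₀ - LinearMap.toContinuousLinearMap Γ T - Ring.inverse T := by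
    funext T
    rw [dysonMap, Matrix.nonsing_inv_eq_ringInverse]; rfl
  obtain ⟨u, hu⟩ := hT₀
  have hui : ((u⁻¹ : (Mat n)ˣ) : Mat n) = T₀⁻¹ := by
    rw [← hu, Matrix.coe_units_inv]
  -- The derivative X ↦ T₀⁻¹XT₀⁻¹ - Γ[X] at T₀. Multiplying by T₀ on both sides yields the stability
  -- operator, so injectivity carries over.
  set D : Mat n →L[ℂ] Mat n := -LinearMap.toContinuousLinearMap Γ -
    -ContinuousLinearMap.mulLeftRight ℂ (Mat n) T₀⁻¹ T₀⁻¹ with hD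
  have hDa : ∀ X, D X = T₀⁻¹ * X * T₀⁻¹ - Γ X := by
    intro X
    simp [hD]
    abel
  have hcd : ContDiffAt ℂ ⊤ (dysonMap K₀ Γ) T₀ := by
    rw [hfun]
    refine (contDiffAt_const.sub
      (LinearMap.toContinuousLinearMap Γ).contDiff.contDiffAt).sub ?_
    rw [← hu]
    exact contDiffAt_ringInverse ℂ u
  have hfd : HasFDerivAt (dysonMap K₀ Γ) D T₀ := by
    rw [hfun]
    refine HasFDerivAt.sub ?_ ?_
    · have := (LinearMap.toContinuousLinearMap Γ).hasFDerivAt (x := T₀)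
      exact this.const_sub K₀
    · rw [← hui, ← hu]
      exact hasFDerivAt_ringInverse u
  have hDinj : Function.Injective D.toLinearMap := by
    refine (injective_iff_map_eq_zero D.toLinearMap).2 fun X hX => hinj X ?_
    have h1 : T₀⁻¹ * X * T₀⁻¹ - Γ X = 0 := by rw [← hDa]; exact hX
    have h2 : T₀ * (T₀⁻¹ * X * T₀⁻¹ - Γ X) * T₀ = X - T₀ * Γ X * T₀ := by
      rw [Matrix.mul_sub, Matrix.sub_mul, Matrix.mul_assoc T₀⁻¹,
        Matrix.mul_nonsing_inv_cancel_left _ _ hd, Matrix.nonsing_inv_mul_cancel_right _ _ hd]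
    rw [← h2, h1, Matrix.mul_zero, Matrix.zero_mul]
  set E : Mat n ≃L[ℂ] Mat n :=
    (LinearEquiv.ofInjectiveEndo D.toLinearMap hDinj).toContinuousLinearEquiv with hE
  have hED : (E : Mat n →L[ℂ] Mat n) = D := by
    ext X : 1
    rfl
  have hfd' : HasFDerivAt (dysonMap K₀ Γ) (E : Mat n →L[ℂ] Mat n) T₀ := by rw [hED]; exact hfd
  have hstrict := hcd.hasStrictFDerivAt' hfd' (by simp)
  have hline : AnalyticAt ℂ (fun z : ℂ => z • (1 : Mat n)) z₀ := by fun_prop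
  refine ⟨fun z => hcd.localInverse hfd' (by simp) (z • (1 : Mat n)), ?_, ?_, ?_, ?_⟩
  · have h1 : AnalyticAt ℂ (hcd.localInverse hfd' (by simp)) (dysonMap K₀ Γ T₀) :=
      (hcd.to_localInverse hfd' (by simp)).analyticAt
    rw [hz₀] at h1
    exact AnalyticAt.comp (f := fun z : ℂ => z • (1 : Mat n)) h1 hline
  · have := hcd.localInverse_apply_image hfd' (by simp)
    rwa [hz₀] at this
  · have h1 := hstrict.eventually_right_inverse
    rw [hz₀] at h1
    exact hline.continuousAt.eventually h1
  · filter_upwards [hstrict.eventually_left_inverse] with T hT z hz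
    change hstrict.localInverse _ _ _ (z • (1 : Mat n)) = T
    rw [← hz]; exact hT

variable {K₀ : Mat n} {Ls : Fin d → Mat n} {Z : Matrix (Fin n) (Fin n) ℕ} {c : ℝ} {L : ℕ}

lemma SolvesAt.trace_pos {Γ : Mat n →ₗ[ℂ] Mat n} (hn : 0 < n) {z : ℂ} {T : Mat n}
    (h : SolvesAt K₀ Γ z T) : 0 < (imPart T).trace.re := by
  have : Nonempty (Fin n) := ⟨⟨0, hn⟩⟩
  exact (Complex.lt_def.1 h.1.trace_pos).1

lemma SolvesAt.stability_injective (hK₀ : K₀.IsHermitian)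
    (hf : FlatWith (selfEnergy Ls) Z c) (hZ : ∀ k l, 0 < (Z ^ L) k l) (hn : 0 < n) {z : ℂ}
    (hz : 0 < z.im) {T : Mat n} (h : SolvesAt K₀ (selfEnergy Ls) z T) (X : Mat n)
    (hX : X - T * selfEnergy Ls X * T = 0) : X = 0 := by
  obtain ⟨C, -, hC⟩ := exists_stability hK₀ hf hZ hn
  have h1 := (hC z T hz h X).1
  rw [hX, norm_zero, mul_zero] at h1
  have h2 := h.trace_pos hn
  rw [← norm_le_zero_iff]
  exact nonpos_of_mul_nonpos_right h1 (by positivity)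

/-- No continuity of M is assumed, so the branch F from the inverse function theorem is matched with
M by uniqueness: near z it solves the equation and keeps a positive definite imaginary part. -/
lemma IsSolution.analyticAt (hK₀ : K₀.IsHermitian)
    (hf : FlatWith (selfEnergy Ls) Z c) (hZ : ∀ k l, 0 < (Z ^ L) k l) (hn : 0 < n)
    {M : ℂ → Mat n} (hM : IsSolution K₀ (selfEnergy Ls) M) {z : ℂ} (hz : 0 < z.im) :
    AnalyticAt ℂ M z := by
  have h : SolvesAt K₀ (selfEnergy Ls) z (M z) := hM z hz
  obtain ⟨F, hFa, hF0, hF1, -⟩ := exists_analytic_local_inverse K₀ (selfEnergy Ls)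
    (isUnit_of_imPart_posDef h.1) (h.stability_injective hK₀ hf hZ hn hz) (solvesAt_iff.1 h).2
  refine hFa.congr ?_
  have hpos : ∀ᶠ w in 𝓝 z, (imPart (F w)).PosDef := by
    have h1 : ∀ᶠ S in 𝓝 (F z), (imPart S).PosDef := by
      rw [hF0]; exact eventually_imPart_posDef h.1
    exact hFa.continuousAt.eventually h1
  have him : ∀ᶠ w in 𝓝 z, 0 < w.im :=
    (isOpen_lt continuous_const Complex.continuous_im).mem_nhds hz
  filter_upwards [hF1, hpos, him] with w h1 h2 h3
  exact SolvesAt.unique hK₀ h3 (solvesAt_iff.2 ⟨h2, h1⟩) (hM w h3)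

lemma IsSolution.deriv_eq (hK₀ : K₀.IsHermitian)
    (hf : FlatWith (selfEnergy Ls) Z c) (hZ : ∀ k l, 0 < (Z ^ L) k l) (hn : 0 < n)
    {M : ℂ → Mat n} (hM : IsSolution K₀ (selfEnergy Ls) M) {z : ℂ} (hz : 0 < z.im) :
    deriv M z - M z * selfEnergy Ls (deriv M z) * M z = M z * M z := by
  have ha := hM.analyticAt hK₀ hf hZ hn hz
  have hslope := ha.differentiableAt.hasDerivAt.tendsto_slope
  have hcont : Tendsto M (𝓝[≠] z) (𝓝 (M z)) := ha.continuousAt.tendsto.mono_left nhdsWithin_le_nhds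
  have hΓ : Continuous (selfEnergy Ls) := LinearMap.continuous_of_finiteDimensional _
  have hlim : Tendsto (fun w => slope M z w - M z * selfEnergy Ls (slope M z w) * M w) (𝓝[≠] z)
      (𝓝 (deriv M z - M z * selfEnergy Ls (deriv M z) * M z)) :=
    hslope.sub ((((hΓ.tendsto _).comp hslope).const_mul _).mul hcont)
  refine tendsto_nhds_unique hlim ((hcont.const_mul (M z)).congr' ?_)
  have him : ∀ᶠ w in 𝓝[≠] z, 0 < w.im :=
    mem_nhdsWithin_of_mem_nhds ((isOpen_lt continuous_const Complex.continuous_im).mem_nhds hz)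
  filter_upwards [him, self_mem_nhdsWithin] with w hw hne
  have hne' : w - z ≠ 0 := sub_ne_zero.2 hne
  have hz' := (Matrix.isUnit_iff_isUnit_det _).1 (isUnit_of_imPart_posDef (hM z hz).1)
  have hw' := (Matrix.isUnit_iff_isUnit_det _).1 (isUnit_of_imPart_posDef (hM w hw).1)
  have h1 : (w - z) • (1 : Mat n) + selfEnergy Ls (M w - M z) = (M z)⁻¹ - (M w)⁻¹ := by
    have e1 := (hM w hw).2
    have e2 := (hM z hz).2
    rw [map_sub, sub_smul]
    have e3 : (M z)⁻¹ - (M w)⁻¹ = -(M w)⁻¹ - -(M z)⁻¹ := by abel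
    rw [e3, e1, e2]; abel
  -- Multiplying by M z on the left and M w on the right makes the difference equation exact, with
  -- no second-order remainder.
  have h2 : M w - M z - M z * selfEnergy Ls (M w - M z) * M w = (w - z) • (M z * M w) := by
    have e1 := congrArg (fun A => M z * A * M w) h1
    simp only [Matrix.mul_add, Matrix.add_mul, Matrix.mul_sub, Matrix.sub_mul, Matrix.mul_smul,
      Matrix.smul_mul, Matrix.mul_one, Matrix.mul_nonsing_inv _ hz', Matrix.one_mul,
      Matrix.nonsing_inv_mul_cancel_right _ _ hw'] at e1
    exact sub_eq_of_eq_add e1.symm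
  rw [slope_def_module, map_smul, Matrix.mul_smul, Matrix.smul_mul, ← smul_sub, h2, smul_smul,
    inv_mul_cancel₀ hne', one_smul]

end Analytic

/-! ### Hölder continuity up to the boundary -/

section Holder

variable {E : Type*} [NormedAddCommGroup E] [NormedSpace ℂ E]

/-- Integrate the derivative bound along the vertical segment: η^{-2/3} has primitive 3η^{1/3}, and
subadditivity of the cube root makes the result uniform in Im z. -/
lemma norm_sub_le_of_deriv_le_vertical {f : ℂ → E} {C : ℝ} (hC : 0 ≤ C)
    (hd : ∀ z : ℂ, 0 < z.im → DifferentiableAt ℂ f z)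
    (hb : ∀ z : ℂ, 0 < z.im → ‖deriv f z‖ ≤ C * (1 + z.im ^ (-(2 / 3) : ℝ)))
    {z : ℂ} (hz : 0 < z.im) {r : ℝ} (hr : 0 ≤ r) (hr1 : r ≤ 1) :
    ‖f (z + r * Complex.I) - f z‖ ≤ 4 * C * r ^ (1 / 3 : ℝ) := by
  set γ : ℝ → ℂ := fun t => z + t * Complex.I with hγ
  have him : ∀ t : ℝ, (γ t).im = z.im + t := fun t => by simp [hγ]
  have hγd : ∀ t, HasDerivAt γ Complex.I t := by
    intro t
    have h1 : HasDerivAt (fun t : ℝ => (t : ℂ)) 1 t := Complex.ofRealCLM.hasDerivAt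
    have h2 := (h1.mul_const Complex.I).const_add z
    rwa [one_mul] at h2
  have hfd : ∀ t, 0 ≤ t → HasDerivAt (fun t => f (γ t) - f z) (Complex.I • deriv f (γ t)) t := by
    intro t ht
    have h1 := (hd (γ t) (by rw [him]; linarith)).hasDerivAt.scomp t (hγd t)
    exact h1.sub_const _
  have hBd : ∀ t, 0 ≤ t → HasDerivAt
      (fun t : ℝ => C * (t + 3 * ((z.im + t) ^ (1 / 3 : ℝ) - z.im ^ (1 / 3 : ℝ))))
      (C * (1 + (z.im + t) ^ (-(2 / 3) : ℝ))) t := by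
    intro t ht
    have h1 : HasDerivAt (fun t : ℝ => z.im + t) 1 t := (hasDerivAt_id t).const_add _
    have h2 := (h1.rpow_const (p := (1 / 3 : ℝ)) (Or.inl (by linarith : z.im + t ≠ 0))).sub_const
      (z.im ^ (1 / 3 : ℝ))
    have h3 := ((hasDerivAt_id' t).fun_add (h2.const_mul 3)).const_mul C
    have e1 : (1 / 3 : ℝ) - 1 = -(2 / 3) := by norm_num
    have e2 : ∀ w : ℝ, 3 * (1 * (1 / 3) * w) = w := fun w => by ring
    rwa [e1, e2] at h3
  have key := image_norm_le_of_norm_deriv_right_le_deriv_boundary'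
    (f := fun t => f (γ t) - f z) (a := 0) (b := r)
    (f' := fun t => Complex.I • deriv f (γ t))
    (fun t ht => (hfd t ht.1).continuousAt.continuousWithinAt)
    (fun t ht => (hfd t ht.1).hasDerivWithinAt)
    (B := fun t : ℝ => C * (t + 3 * ((z.im + t) ^ (1 / 3 : ℝ) - z.im ^ (1 / 3 : ℝ))))
    (B' := fun t => C * (1 + (z.im + t) ^ (-(2 / 3) : ℝ)))
    (by simp [hγ])
    (fun t ht => (hBd t ht.1).continuousAt.continuousWithinAt)
    (fun t ht => (hBd t ht.1).hasDerivWithinAt)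
    (fun t ht => by
      rw [norm_smul, Complex.norm_I, one_mul]
      have := hb (γ t) (by rw [him]; linarith [ht.1])
      rwa [him] at this)
    (Set.right_mem_Icc.2 hr)
  refine key.trans ?_
  have h1 : (z.im + r) ^ (1 / 3 : ℝ) ≤ z.im ^ (1 / 3 : ℝ) + r ^ (1 / 3 : ℝ) :=
    Real.rpow_add_le_add_rpow hz.le hr (by norm_num) (by norm_num)
  have h2 : r ≤ r ^ (1 / 3 : ℝ) := by
    conv_lhs => rw [← Real.rpow_one r]
    exact Real.rpow_le_rpow_of_exponent_ge' hr hr1 (by norm_num) (by norm_num)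
  calc C * (r + 3 * ((z.im + r) ^ (1 / 3 : ℝ) - z.im ^ (1 / 3 : ℝ)))
      ≤ C * (4 * r ^ (1 / 3 : ℝ)) := by gcongr; linarith
    _ = 4 * C * r ^ (1 / 3 : ℝ) := by ring

/-- A bounded holomorphic function on the upper half-plane whose derivative grows at most like
the power `-2/3` of the imaginary part is Hölder continuous with exponent `1/3`. -/
lemma norm_sub_le_rpow_of_deriv_le {f : ℂ → E} {C : ℝ} (hC : 0 ≤ C)
    (hd : ∀ z : ℂ, 0 < z.im → DifferentiableAt ℂ f z)
    (hb : ∀ z : ℂ, 0 < z.im → ‖deriv f z‖ ≤ C * (1 + z.im ^ (-(2 / 3) : ℝ)))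
    (hf : ∀ z : ℂ, 0 < z.im → ‖f z‖ ≤ C) {z₁ z₂ : ℂ} (h₁ : 0 < z₁.im) (h₂ : 0 < z₂.im) :
    ‖f z₁ - f z₂‖ ≤ 10 * C * ‖z₁ - z₂‖ ^ (1 / 3 : ℝ) := by
  set r := ‖z₁ - z₂‖ with hr
  have hr0 : 0 ≤ r := norm_nonneg _
  rcases le_total r 1 with hr1 | hr1
  · rcases hr0.eq_or_lt with h0 | h0
    · have : z₁ = z₂ := sub_eq_zero.1 (norm_eq_zero.1 (by rw [← hr, ← h0]))
      rw [this, sub_self, norm_zero]; positivity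
    have e1 := norm_sub_le_of_deriv_le_vertical hC hd hb h₁ hr0 hr1
    have e2 := norm_sub_le_of_deriv_le_vertical hC hd hb h₂ hr0 hr1
    -- Lift both points by their distance r. At heights at least r the derivative is bounded by C(1
    -- + r^{-2/3}), so crossing costs 2C r^{1/3}; with 4C for each vertical segment the total is
    -- 10C.
    have e3 : ‖f (z₁ + r * Complex.I) - f (z₂ + r * Complex.I)‖ ≤ 2 * C * r ^ (1 / 3 : ℝ) := by
      have hconv : Convex ℝ {w : ℂ | r ≤ w.im} := convex_halfSpace_im_ge r
      have h3 := hconv.norm_image_sub_le_of_norm_deriv_le (𝕜 := ℂ) (f := f)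
        (C := C * (1 + r ^ (-(2 / 3) : ℝ))) (x := z₂ + r * Complex.I) (y := z₁ + r * Complex.I)
        (fun w hw => hd w (h0.trans_le hw)) (fun w hw => ?_) ?_ ?_
      · refine h3.trans ?_
        have h4 : z₁ + r * Complex.I - (z₂ + r * Complex.I) = z₁ - z₂ := by ring
        have h5 : r ≤ r ^ (1 / 3 : ℝ) := by
          conv_lhs => rw [← Real.rpow_one r]
          exact Real.rpow_le_rpow_of_exponent_ge' hr0 hr1 (by norm_num) (by norm_num)
        have h6 : r ^ (-(2 / 3) : ℝ) * r = r ^ (1 / 3 : ℝ) := by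
          rw [← Real.rpow_add_one h0.ne']; norm_num
        rw [h4, ← hr]
        calc C * (1 + r ^ (-(2 / 3) : ℝ)) * r = C * (r + r ^ (-(2 / 3) : ℝ) * r) := by ring
          _ ≤ C * (r ^ (1 / 3 : ℝ) + r ^ (1 / 3 : ℝ)) := by rw [h6]; gcongr
          _ = 2 * C * r ^ (1 / 3 : ℝ) := by ring
      · refine (hb w (h0.trans_le hw)).trans ?_
        have : w.im ^ (-(2 / 3) : ℝ) ≤ r ^ (-(2 / 3) : ℝ) :=
          Real.rpow_le_rpow_of_nonpos h0 hw (by norm_num)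
        gcongr
      · change r ≤ (z₂ + r * Complex.I).im
        simpa using h₂.le
      · change r ≤ (z₁ + r * Complex.I).im
        simpa using h₁.le
    have e4 : f z₁ - f z₂ = -(f (z₁ + r * Complex.I) - f z₁) +
        (f (z₁ + r * Complex.I) - f (z₂ + r * Complex.I)) + (f (z₂ + r * Complex.I) - f z₂) := by
      abel
    rw [e4]
    refine (norm_add_le _ _).trans ((add_le_add_left (norm_add_le _ _) _).trans ?_)
    rw [norm_neg]
    linarith
  · have h3 : 1 ≤ r ^ (1 / 3 : ℝ) := Real.one_le_rpow hr1 (by norm_num)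
    calc ‖f z₁ - f z₂‖ ≤ C + C := (norm_sub_le _ _).trans (add_le_add (hf _ h₁) (hf _ h₂))
      _ ≤ 10 * C * 1 := by linarith
      _ ≤ 10 * C * r ^ (1 / 3 : ℝ) := by gcongr

end Holder

/-! ### Extension to the closed half-plane by vertical limits. -/

lemma tendsto_norm_sub_rpow (z : ℂ) :
    Tendsto (fun w : ℂ => ‖w - z‖ ^ (1 / 3 : ℝ)) (𝓝 z) (𝓝 0) := by
  have h : Continuous fun w : ℂ => ‖w - z‖ ^ (1 / 3 : ℝ) :=
    (continuous_id.sub continuous_const).norm.rpow_const fun _ => Or.inr (by norm_num)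
  have := h.tendsto z
  simpa using this

lemma tendsto_add_mul_I (z : ℂ) :
    Tendsto (fun y : ℝ => z + y * Complex.I) (𝓝[>] (0 : ℝ)) (𝓝 z) := by
  have h : Continuous fun y : ℝ => z + y * Complex.I := by fun_prop
  have := (h.tendsto 0).mono_left (nhdsWithin_le_nhds (s := Set.Ioi 0))
  simpa using this

/-- A Hölder continuous function on the upper half-plane extends to the closed half-plane. -/
lemma exists_holder_extension {E : Type*} [NormedAddCommGroup E] [CompleteSpace E] {f : ℂ → E} {C : ℝ} (hC : 0 ≤ C)
    (hf : ∀ z₁ z₂ : ℂ, 0 < z₁.im → 0 < z₂.im →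
      ‖f z₁ - f z₂‖ ≤ C * ‖z₁ - z₂‖ ^ (1 / 3 : ℝ)) :
    ∃ g : ℂ → E, (∀ z : ℂ, 0 < z.im → g z = f z) ∧ ContinuousOn g {z : ℂ | 0 ≤ z.im} ∧
      (∀ z₁ z₂ : ℂ, 0 ≤ z₁.im → 0 ≤ z₂.im →
        ‖g z₁ - g z₂‖ ≤ C * ‖z₁ - z₂‖ ^ (1 / 3 : ℝ)) ∧
      ∀ z : ℂ, 0 ≤ z.im →
        Tendsto (fun y : ℝ => f (z + y * Complex.I)) (𝓝[>] (0 : ℝ)) (𝓝 (g z)) := by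
  have hlim : ∀ z : ℂ, 0 ≤ z.im → ∃ a,
      Tendsto (fun y : ℝ => f (z + y * Complex.I)) (𝓝[>] (0 : ℝ)) (𝓝 a) := by
    intro z hz
    refine cauchy_map_iff_exists_tendsto.1 (Metric.cauchy_iff.2 ⟨inferInstance, fun ε hε => ?_⟩)
    have h1 : Tendsto (fun p : ℝ => C * p ^ (1 / 3 : ℝ)) (𝓝[>] (0 : ℝ)) (𝓝 0) := by
      have h2 : Continuous fun p : ℝ => C * p ^ (1 / 3 : ℝ) :=
        continuous_const.mul (continuous_id.rpow_const fun _ => Or.inr (by norm_num))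
      have := (h2.tendsto 0).mono_left (nhdsWithin_le_nhds (s := Set.Ioi 0))
      simpa using this
    obtain ⟨δ, hδ, hδ0⟩ := ((h1.eventually_lt_const hε).and self_mem_nhdsWithin).exists
    have hδ0' : 0 < δ := hδ0
    refine ⟨(fun y : ℝ => f (z + y * Complex.I)) '' Set.Ioo 0 δ,
      image_mem_map (Ioo_mem_nhdsGT hδ0'), ?_⟩
    rintro _ ⟨y₁, hy₁, rfl⟩ _ ⟨y₂, hy₂, rfl⟩
    rw [dist_eq_norm]
    refine (hf _ _ (by simpa using by linarith [hy₁.1]) (by simpa using by linarith [hy₂.1])).trans_lt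
      (lt_of_le_of_lt ?_ hδ)
    have h3 : ‖z + y₁ * Complex.I - (z + y₂ * Complex.I)‖ ≤ δ := by
      have : z + y₁ * Complex.I - (z + y₂ * Complex.I) = ((y₁ - y₂ : ℝ) : ℂ) * Complex.I := by
        push_cast; ring
      rw [this, norm_mul, Complex.norm_I, mul_one, Complex.norm_real, Real.norm_eq_abs, abs_le]
      constructor <;> linarith [hy₁.1, hy₁.2, hy₂.1, hy₂.2]
    gcongr
  choose! g hg using hlim
  have hhol : ∀ z₁ z₂ : ℂ, 0 ≤ z₁.im → 0 ≤ z₂.im →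
      ‖g z₁ - g z₂‖ ≤ C * ‖z₁ - z₂‖ ^ (1 / 3 : ℝ) := by
    intro z₁ z₂ h₁ h₂
    refine le_of_tendsto ((hg z₁ h₁).sub (hg z₂ h₂)).norm ?_
    filter_upwards [self_mem_nhdsWithin] with y hy
    have hy' : 0 < y := hy
    have := hf (z₁ + y * Complex.I) (z₂ + y * Complex.I) (by simpa using by linarith)
      (by simpa using by linarith)
    rwa [add_sub_add_right_eq_sub] at this
  refine ⟨g, fun z hz => ?_, fun z hz => ?_, hhol, hg⟩
  · refine tendsto_nhds_unique (hg z hz.le) ?_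
    rw [tendsto_iff_norm_sub_tendsto_zero]
    have h1 := ((tendsto_norm_sub_rpow z).comp (tendsto_add_mul_I z)).const_mul C
    rw [mul_zero] at h1
    refine squeeze_zero' (Filter.Eventually.of_forall fun _ => norm_nonneg _) ?_ h1
    filter_upwards [self_mem_nhdsWithin] with y hy
    have hy' : 0 < y := hy
    exact hf _ _ (by simpa using by linarith) hz
  · rw [ContinuousWithinAt, tendsto_iff_norm_sub_tendsto_zero]
    have h1 := ((tendsto_norm_sub_rpow z).mono_left
      (nhdsWithin_le_nhds (s := {z : ℂ | 0 ≤ z.im}))).const_mul C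
    rw [mul_zero] at h1
    refine squeeze_zero' (Filter.Eventually.of_forall fun _ => norm_nonneg _) ?_ h1
    filter_upwards [self_mem_nhdsWithin] with w hw
    exact hhol w z hw hz

/-! ### The derivative bound and the Hölder estimate for solutions. -/

section DerivBound

variable {n d : ℕ} {K₀ : Mat n} {Ls : Fin d → Mat n} {Z : Matrix (Fin n) (Fin n) ℕ} {c : ℝ} {L : ℕ}

lemma le_mul_rpow_of_sq_mul_cube_le {x η B : ℝ} (hη : 0 < η) (hB : 0 ≤ B)
    (h : η ^ 2 * x ^ 3 ≤ B ^ 3) : x ≤ B * η ^ (-(2 / 3) : ℝ) := by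
  refine le_of_pow_le_pow_left₀ (n := 3) (by norm_num) (by positivity) ?_
  have h1 : (η ^ (-(2 / 3) : ℝ)) ^ 3 = (η ^ 2)⁻¹ := by
    rw [← Real.rpow_natCast, ← Real.rpow_mul hη.le, ← Real.rpow_natCast η 2,
      ← Real.rpow_neg hη.le]
    norm_num
  rw [mul_pow, h1, ← div_eq_mul_inv, le_div_iff₀ (by positivity)]
  linarith

/-- For x = ‖M'‖ stability gives τ²x ≤ B and, in the main case, (Im z)x ≤ Bτ. Squaring the second
and inserting the first eliminates τ and leaves (Im z)²x³ ≤ B³. -/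
lemma exists_norm_deriv_le (hK₀ : K₀.IsHermitian)
    (hf : FlatWith (selfEnergy Ls) Z c) (hZ : ∀ k l, 0 < (Z ^ L) k l) (hn : 0 < n) :
    ∃ C : ℝ, 0 < C ∧ ∀ M : ℂ → Mat n, IsSolution K₀ (selfEnergy Ls) M → ∀ z : ℂ, 0 < z.im →
      ‖deriv M z‖ ≤ C * (1 + z.im ^ (-(2 / 3) : ℝ)) := by
  obtain ⟨C₀, hC₀, hb⟩ := exists_norm_bounds hK₀ hf
  obtain ⟨C₁, hC₁, hst⟩ := exists_stability hK₀ hf hZ hn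
  set B : ℝ := C₁ * (C₀ * C₀) with hB
  have hB0 : 0 < B := by positivity
  refine ⟨B, hB0, fun M hM z hz => ?_⟩
  have h : SolvesAt K₀ (selfEnergy Ls) z (M z) := hM z hz
  obtain ⟨h1, h2⟩ := hst z (M z) hz h (deriv M z)
  rw [hM.deriv_eq hK₀ hf hZ hn hz] at h1 h2
  have hMM : ‖M z * M z‖ ≤ C₀ * C₀ :=
    (norm_mul_le _ _).trans (by gcongr <;> exact (hb z (M z) hz h).1)
  have hτ := h.trace_pos hn
  set τ := (imPart (M z)).trace.re
  set x := ‖deriv M z‖ with hx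
  have hx0 : 0 ≤ x := norm_nonneg _
  have hrp : 0 ≤ z.im ^ (-(2 / 3) : ℝ) := by positivity
  have h1' : τ ^ 2 * x ≤ B := h1.trans (by rw [hB]; gcongr)
  rcases h2 with h2 | h2
  · have : x ≤ B := h2.trans (by rw [hB]; gcongr)
    nlinarith
  · have h2' : z.im * x ≤ B * τ := by
      refine h2.trans ?_
      calc C₁ * τ * ‖M z * M z‖ ≤ C₁ * τ * (C₀ * C₀) := by gcongr
        _ = B * τ := by rw [hB]; ring
    have h3 : x ≤ B * z.im ^ (-(2 / 3) : ℝ) := by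
      refine le_mul_rpow_of_sq_mul_cube_le hz hB0.le ?_
      calc z.im ^ 2 * x ^ 3 = (z.im * x) ^ 2 * x := by ring
        _ ≤ (B * τ) ^ 2 * x := by gcongr
        _ = B ^ 2 * (τ ^ 2 * x) := by ring
        _ ≤ B ^ 2 * B := by gcongr
        _ = B ^ 3 := by ring
    nlinarith

/-- Solutions of the Dyson equation are uniformly Hölder continuous with exponent `1/3`. -/
lemma exists_holder (hK₀ : K₀.IsHermitian)
    (hf : FlatWith (selfEnergy Ls) Z c) (hZ : ∀ k l, 0 < (Z ^ L) k l) (hn : 0 < n) :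
    ∃ C : ℝ, 0 < C ∧ ∀ M : ℂ → Mat n, IsSolution K₀ (selfEnergy Ls) M →
      ∀ z₁ z₂ : ℂ, 0 < z₁.im → 0 < z₂.im →
        ‖M z₁ - M z₂‖ ≤ C * ‖z₁ - z₂‖ ^ (1 / 3 : ℝ) := by
  obtain ⟨C₀, hC₀, hb⟩ := exists_norm_bounds hK₀ hf
  obtain ⟨C₁, hC₁, hd⟩ := exists_norm_deriv_le hK₀ hf hZ hn
  refine ⟨10 * (C₀ + C₁), by positivity, fun M hM z₁ z₂ h₁ h₂ => ?_⟩
  refine norm_sub_le_rpow_of_deriv_le (by positivity)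
    (fun z hz => (hM.analyticAt hK₀ hf hZ hn hz).differentiableAt) (fun z hz => ?_)
    (fun z hz => ?_) h₁ h₂
  · refine (hd M hM z hz).trans ?_
    have : 0 ≤ z.im ^ (-(2 / 3) : ℝ) := by positivity
    gcongr
    linarith
  · exact (hb z (M z) hz (hM z hz)).1.trans (by linarith)

end DerivBound

/-! ### The density of states -/

section Barrier

/-- A nonnegative harmonic function on the upper half-plane that vanishes on a real interval
grows at most linearly above the centre of that interval. -/
lemma im_le_of_im_eq_zero_on_interval {m : ℂ → ℂ} {C δ η x₀ : ℝ} (hδ : 0 < δ)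
    (hc : ContinuousOn m {z : ℂ | 0 ≤ z.im})
    (hd : ∀ z : ℂ, 0 < z.im → DifferentiableAt ℂ m z)
    (hC : ∀ z : ℂ, 0 ≤ z.im → (m z).im ≤ C) (hC0 : 0 ≤ C)
    (h0 : ∀ x : ℝ, |x - x₀| < δ → (m x).im ≤ 0) (hη : 0 < η) (hηδ : η < δ) :
    (m (x₀ + η * Complex.I)).im ≤ 2 * C * η / δ := by
  -- The barrier Im g = ((x - x₀)² - y² + 2δy)/δ² is harmonic, nonnegative on the base of the
  -- rectangle, at least 1 on its other three sides, and at most 2η/δ above the centre.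
  set g : ℂ → ℂ := fun z => (Complex.I * (z - x₀) ^ 2 + 2 * δ * (z - x₀)) / (δ : ℂ) ^ 2 with hg
  have hgim : ∀ z : ℂ, (g z).im = ((z.re - x₀) ^ 2 - z.im ^ 2 + 2 * δ * z.im) / δ ^ 2 := by
    intro z
    have : g z = (Complex.I * (z - x₀) ^ 2 + 2 * δ * (z - x₀)) / ((δ ^ 2 : ℝ) : ℂ) := by
      simp [hg]
    rw [this, Complex.div_ofReal_im]
    congr 1
    simp [pow_two]
  set f : ℂ → ℂ := fun z => Complex.exp (-Complex.I * (m z - C * g z)) with hf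
  have hfn : ∀ z, ‖f z‖ = Real.exp ((m z).im - C * (g z).im) := by
    intro z
    rw [hf, Complex.norm_exp]
    congr 1
    simp
  set U : Set ℂ := Set.Ioo (x₀ - δ) (x₀ + δ) ×ℂ Set.Ioo 0 δ with hU
  have hcl : closure U = Set.Icc (x₀ - δ) (x₀ + δ) ×ℂ Set.Icc 0 δ := by
    rw [hU, Complex.closure_reProdIm, closure_Ioo (by linarith), closure_Ioo hδ.ne]
  have hUo : IsOpen U := isOpen_Ioo.reProdIm isOpen_Ioo
  have hgd : Differentiable ℂ g := by fun_prop
  have hdc : DiffContOnCl ℂ f U := by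
    constructor
    · intro z hz
      have h1 : DifferentiableAt ℂ m z := hd z hz.2.1
      have h2 := hgd z
      exact DifferentiableAt.differentiableWithinAt (by fun_prop)
    · have h1 : ContinuousOn m (closure U) := hc.mono fun z hz => by
        rw [hcl] at hz; exact hz.2.1
      have h2 := hgd.continuous.continuousOn (s := closure U)
      exact ((continuousOn_const.mul (h1.sub (continuousOn_const.mul h2)))).cexp
  have hb : Bornology.IsBounded U :=
    Bornology.IsBounded.reProdIm (Metric.isBounded_Ioo _ _) (Metric.isBounded_Ioo _ _)
  have hfr : ∀ z ∈ frontier U, ‖f z‖ ≤ 1 := by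
    intro z hz
    rw [hUo.frontier_eq, hcl] at hz
    obtain ⟨⟨⟨hx1, hx2⟩, ⟨hy1, hy2⟩⟩, hz2⟩ := hz
    rw [hfn, Real.exp_le_one_iff, sub_nonpos]
    by_cases hbase : z.im = 0 ∧ |z.re - x₀| < δ
    · have h1 : (m z).im ≤ 0 := by
        have : z = ((z.re : ℝ) : ℂ) := Complex.ext (by simp) (by simpa using hbase.1)
        rw [this]
        exact h0 _ hbase.2
      refine h1.trans (mul_nonneg hC0 ?_)
      rw [hgim, hbase.1]
      simp only [ne_eq, OfNat.ofNat_ne_zero, not_false_eq_true, zero_pow, sub_zero, mul_zero,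
        add_zero]
      positivity
    · have h1 : 1 ≤ (g z).im := by
        rw [hgim, le_div_iff₀ (by positivity)]
        by_cases hx : |z.re - x₀| < δ
        · have hy0 : 0 < z.im := lt_of_le_of_ne hy1 fun h => hbase ⟨h.symm, hx⟩
          rw [abs_lt] at hx
          have : z.im = δ := by
            refine le_antisymm hy2 (not_lt.1 fun h => hz2 ⟨⟨?_, ?_⟩, hy0, h⟩) <;> linarith
          rw [this]
          nlinarith [sq_nonneg (z.re - x₀)]
        · have : δ ^ 2 ≤ (z.re - x₀) ^ 2 := by
            rw [← sq_abs (z.re - x₀)]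
            exact pow_le_pow_left₀ hδ.le (not_lt.1 hx) 2
          nlinarith
      calc (m z).im ≤ C * 1 := by rw [mul_one]; exact hC z hy1
        _ ≤ C * (g z).im := by gcongr
  have key := Complex.norm_le_of_forall_mem_frontier_norm_le hb hdc hfr
    (z := x₀ + η * Complex.I) (subset_closure ⟨by simp [hδ], by simp [hη, hηδ]⟩)
  rw [hfn, Real.exp_le_one_iff, sub_nonpos] at key
  refine key.trans ?_
  rw [hgim, mul_div_assoc']
  rw [div_le_div_iff₀ (by positivity) hδ]
  simp only [Complex.add_re, Complex.ofReal_re, Complex.mul_re, Complex.I_re, mul_zero,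
    Complex.ofReal_im, Complex.I_im, mul_one, sub_self, add_zero, Complex.add_im, Complex.mul_im,
    zero_add]
  nlinarith [mul_nonneg hC0 (mul_nonneg hδ.le (sq_nonneg η))]

end Barrier

section Density

variable {n d : ℕ} {K₀ : Mat n} {Ls : Fin d → Mat n} {Z : Matrix (Fin n) (Fin n) ℕ} {c : ℝ} {L : ℕ}

/-- The trace divided by `π n`, as a continuous linear functional. -/
def scaledTrace (n : ℕ) : Mat n →L[ℂ] ℂ :=
  LinearMap.toContinuousLinearMap
    (((Real.pi⁻¹ * (n : ℝ)⁻¹ : ℝ) : ℂ) • Matrix.traceLinearMap (Fin n) ℂ ℂ)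

lemma scaledTrace_apply (A : Mat n) :
    scaledTrace n A = ((Real.pi⁻¹ * (n : ℝ)⁻¹ : ℝ) : ℂ) * A.trace := rfl

lemma rho_eq_im_scaledTrace (M : ℂ → Mat n) (z : ℂ) : rho M z = (scaledTrace n (M z)).im := by
  rw [rho, scaledTrace_apply, Complex.im_ofReal_mul, trace_imPart_re, mul_assoc]

lemma abs_rho_sub_le (M N : ℂ → Mat n) (z w : ℂ) :
    |rho M z - rho N w| ≤ ‖scaledTrace n‖ * ‖M z - N w‖ := by
  rw [rho_eq_im_scaledTrace, rho_eq_im_scaledTrace, ← Complex.sub_im, ← map_sub]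
  exact (Complex.abs_im_le_norm _).trans ((scaledTrace n).le_opNorm _)

lemma tendsto_rho {ι : Type*} {l : Filter ι} {M N : ℂ → Mat n} {u : ι → ℂ} {w : ℂ}
    (h : Tendsto (fun i => M (u i)) l (𝓝 (N w))) :
    Tendsto (fun i => rho M (u i)) l (𝓝 (rho N w)) := by
  simp only [rho_eq_im_scaledTrace]
  exact ((Complex.continuous_im.comp (scaledTrace n).continuous).tendsto _).comp h

lemma density_eq_of_tendsto {M N : ℂ → Mat n} {x : ℝ}
    (h : Tendsto (fun y : ℝ => M (x + y * Complex.I)) (𝓝[>] (0 : ℝ)) (𝓝 (N x))) :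
    density M x = rho N x :=
  (tendsto_rho h).limUnder_eq

lemma trace_re_eq_mul_rho (hn : 0 < n) (M : ℂ → Mat n) (z : ℂ) :
    (imPart (M z)).trace.re = Real.pi * n * rho M z := by
  have := Real.pi_pos
  have : (0 : ℝ) < n := by exact_mod_cast hn
  rw [rho]
  field_simp

/-- The density is bounded by the imaginary part of the spectral parameter divided by the
distance to the support of the density of states. -/
lemma exists_rho_mul_infDist_le (hK₀ : K₀.IsHermitian)
    (hf : FlatWith (selfEnergy Ls) Z c) (hZ : ∀ k l, 0 < (Z ^ L) k l) (hn : 0 < n) :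
    ∃ C : ℝ, 0 < C ∧ ∀ M : ℂ → Mat n, IsSolution K₀ (selfEnergy Ls) M → ∀ z : ℂ, 0 < z.im →
      rho M z * Metric.infDist z (densitySupport M) ≤ C * z.im := by
  obtain ⟨C₀, hC₀, hb⟩ := exists_norm_bounds hK₀ hf
  obtain ⟨C₁, hC₁, hH⟩ := exists_holder hK₀ hf hZ hn
  set C₂ : ℝ := ‖scaledTrace n‖ * C₀ with hC₂
  have hC₂0 : 0 ≤ C₂ := by positivity
  refine ⟨4 * C₂ + 1, by positivity, fun M hM z hz => ?_⟩
  obtain ⟨N, hN, hNc, -, hNt⟩ := exists_holder_extension hC₁.le (hH M hM)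
  have hdens : ∀ x : ℝ, density M x = rho N x := fun x => density_eq_of_tendsto (hNt x (by simp))
  have hNb : ∀ w : ℂ, 0 < w.im → rho N w ≤ C₂ := by
    intro w hw
    rw [rho_eq_im_scaledTrace, hN w hw]
    refine (Complex.im_le_norm _).trans (((scaledTrace n).le_opNorm _).trans ?_)
    rw [hC₂]
    gcongr
    exact (hb w (M w) hw (hM w hw)).1
  have hNb' : ∀ w : ℂ, 0 ≤ w.im → rho N w ≤ C₂ := by
    intro w hw
    refine le_of_tendsto (tendsto_rho (hNt w hw)) ?_
    filter_upwards [self_mem_nhdsWithin] with y hy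
    have hy' : 0 < y := hy
    have h1 : 0 < (w + y * Complex.I).im := by simpa using by linarith
    have := hNb _ h1
    rwa [rho, hN _ h1] at this
  have hρ : rho M z = rho N z := by rw [rho, rho, hN z hz]
  set D := Metric.infDist z (densitySupport M) with hD
  have hD0 : 0 ≤ D := Metric.infDist_nonneg
  have hρ2 : rho M z ≤ C₂ := hρ ▸ hNb z hz
  -- The first case also covers an empty support, for which `Metric.infDist` is 0.
  rcases le_or_gt D (2 * z.im) with h | h
  · calc rho M z * D ≤ C₂ * (2 * z.im) := by gcongr
      _ ≤ (4 * C₂ + 1) * z.im := by nlinarith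
  · have hδ : 0 < D / 2 := by linarith
    -- Here Im z < D/2, so such an x is closer to z than D and lies outside the support.
    have h0 : ∀ x : ℝ, |x - z.re| < D / 2 → (scaledTrace n (N x)).im ≤ 0 := by
      intro x hx
      rw [← rho_eq_im_scaledTrace, ← hdens]
      by_contra hne
      have hmem : (x : ℂ) ∈ densitySupport M :=
        ⟨x, subset_closure (Function.mem_support.2 fun h0 => hne h0.le), rfl⟩
      have h1 : D ≤ dist z x := Metric.infDist_le_dist_of_mem hmem
      rw [dist_comm, Complex.dist_eq] at h1
      have h2 := Complex.norm_le_abs_re_add_abs_im ((x : ℂ) - z)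
      have h3 : |((x : ℂ) - z).im| = z.im := by simp [abs_of_pos hz]
      have h4 : ((x : ℂ) - z).re = x - z.re := by simp
      rw [h3, h4] at h2
      linarith
    have key := im_le_of_im_eq_zero_on_interval (m := fun w => scaledTrace n (N w)) (C := C₂)
      (x₀ := z.re) hδ ((scaledTrace n).continuous.comp_continuousOn hNc)
      (fun w hw => ?_) (fun w hw => ?_) hC₂0 h0 hz (by linarith)
    · rw [Complex.re_add_im, ← rho_eq_im_scaledTrace, ← hρ] at key
      rw [le_div_iff₀ hδ] at key
      nlinarith
    · have h1 : N =ᶠ[𝓝 w] M := by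
        filter_upwards [(isOpen_lt continuous_const Complex.continuous_im).mem_nhds hw] with v hv
        exact hN v hv
      exact (scaledTrace n).differentiableAt.comp w
        ((hM.analyticAt hK₀ hf hZ hn hw).differentiableAt.congr_of_eventuallyEq h1)
    · rw [← rho_eq_im_scaledTrace]
      exact hNb' w hw

end Density

/-! ### The estimates on the upper half-plane -/

/-- A lower bound gives injectivity, which suffices for invertibility in finite dimension. -/
lemma isUnit_and_norm_inverse_le {E : Type*} [NormedAddCommGroup E] [NormedSpace ℂ E]
    [FiniteDimensional ℂ E] (T : E →L[ℂ] E) {K : ℝ} (hK : 0 ≤ K) (h : ∀ x, ‖x‖ ≤ K * ‖T x‖) :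
    IsUnit T ∧ ‖Ring.inverse T‖ ≤ K := by
  have hinj : Function.Injective T.toLinearMap := by
    refine (injective_iff_map_eq_zero _).2 fun x hx => ?_
    have hx' : T x = 0 := hx
    have := h x
    rw [hx', norm_zero, mul_zero] at this
    exact norm_le_zero_iff.1 this
  have hT : IsUnit T := by
    let e := (LinearEquiv.ofInjectiveEndo T.toLinearMap hinj).toContinuousLinearEquiv
    exact ⟨ContinuousLinearEquiv.toUnit e, by ext x; rfl⟩
  refine ⟨hT, ContinuousLinearMap.opNorm_le_bound _ hK fun x => ?_⟩
  have h1 : T (Ring.inverse T x) = x := by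
    have := Ring.mul_inverse_cancel T hT
    exact congrArg (fun S : E →L[ℂ] E => S x) this
  have := h (Ring.inverse T x)
  rwa [h1] at this

section Estimates

variable {n d : ℕ} {K₀ : Mat n} {Ls : Fin d → Mat n} {Z : Matrix (Fin n) (Fin n) ℕ} {c : ℝ} {L : ℕ}

lemma rho_pos (hn : 0 < n) {Γ : Mat n →ₗ[ℂ] Mat n} {M : ℂ → Mat n} (hM : IsSolution K₀ Γ M)
    {z : ℂ} (hz : 0 < z.im) : 0 < rho M z := by
  have h : SolvesAt K₀ Γ z (M z) := hM z hz
  have h1 := h.trace_pos hn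
  have h2 : (0 : ℝ) < n := by exact_mod_cast hn
  have := Real.pi_pos
  rw [rho]
  positivity

/-- The linear stability estimate in terms of the density and the distance to its support. -/
lemma exists_norm_inverse_stability_le (hK₀ : K₀.IsHermitian)
    (hf : FlatWith (selfEnergy Ls) Z c) (hZ : ∀ k l, 0 < (Z ^ L) k l) (hn : 0 < n) :
    ∃ C : ℝ, 0 < C ∧ ∀ M : ℂ → Mat n, IsSolution K₀ (selfEnergy Ls) M → ∀ z : ℂ, 0 < z.im →
      IsUnit (stability (selfEnergy Ls) (M z)) ∧
      ‖Ring.inverse (stability (selfEnergy Ls) (M z))‖ ≤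
        C * (1 + 1 / (rho M z + Metric.infDist z (densitySupport M)) ^ 2) := by
  obtain ⟨C₁, hC₁, hst⟩ := exists_stability hK₀ hf hZ hn
  obtain ⟨C₂, hC₂, hdist⟩ := exists_rho_mul_infDist_le hK₀ hf hZ hn
  have hn' : (0 : ℝ) < n := by exact_mod_cast hn
  set p : ℝ := Real.pi * n with hp
  have hp0 : 0 < p := mul_pos Real.pi_pos hn'
  set C : ℝ := 4 * (C₁ + C₁ / p ^ 2 + C₁ * p * C₂) with hC
  have hC0 : 0 < C := by positivity
  refine ⟨C, hC0, fun M hM z hz => ?_⟩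
  have h : SolvesAt K₀ (selfEnergy Ls) z (M z) := hM z hz
  have hρ := rho_pos hn hM hz
  have hd := hdist M hM z hz
  set ρ := rho M z with hρd
  set D := Metric.infDist z (densitySupport M) with hD
  have hD0 : 0 ≤ D := Metric.infDist_nonneg
  refine isUnit_and_norm_inverse_le _ (by positivity) fun X => ?_
  obtain ⟨h1, h2⟩ := hst z (M z) hz h X
  rw [trace_re_eq_mul_rho hn] at h1 h2
  rw [stability_apply]
  set Y := ‖X - M z * selfEnergy Ls X * M z‖
  have hY : 0 ≤ Y := norm_nonneg _
  set x := ‖X‖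
  have hx : 0 ≤ x := norm_nonneg _
  have hs : 0 < ρ + D := by linarith
  change ((p * ρ) ^ 2 * x ≤ C₁ * Y) at h1
  change (x ≤ C₁ * Y ∨ z.im * x ≤ C₁ * (p * ρ) * Y) at h2
  have e1 : C₁ ≤ C / 4 := by
    rw [hC]
    have : 0 ≤ C₁ / p ^ 2 + C₁ * p * C₂ := by positivity
    linarith
  have e2 : C₁ / p ^ 2 ≤ C / 4 := by
    rw [hC]
    have : 0 ≤ C₁ + C₁ * p * C₂ := by positivity
    linarith
  have e3 : C₁ * p * C₂ ≤ C / 4 := by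
    rw [hC]
    have : 0 ≤ C₁ + C₁ / p ^ 2 := by positivity
    linarith
  rcases h2 with h2 | h2
  · calc x ≤ C₁ * Y := h2
      _ ≤ C * (1 + 1 / (ρ + D) ^ 2) * Y := by
        gcongr
        have : 0 ≤ 1 / (ρ + D) ^ 2 := by positivity
        nlinarith
  -- If ρ dominates D, the bound with τ² is used. If D dominates, ρD ≤ C₂ Im z turns the bound with
  -- Im z/τ into one with D; its first power in the inverse is absorbed by 1/s ≤ 2(1 + 1/s²).
  rcases le_total D ρ with hDρ | hDρ
  · have h3 : ρ ^ 2 * x ≤ C / 4 * Y := by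
      calc ρ ^ 2 * x = (p * ρ) ^ 2 * x / p ^ 2 := by field_simp
        _ ≤ C₁ * Y / p ^ 2 := by gcongr
        _ = C₁ / p ^ 2 * Y := by ring
        _ ≤ C / 4 * Y := by gcongr
    have h4 : (ρ + D) ^ 2 * x ≤ C * Y := by
      calc (ρ + D) ^ 2 * x ≤ (ρ + ρ) ^ 2 * x := by gcongr
        _ = 4 * (ρ ^ 2 * x) := by ring
        _ ≤ 4 * (C / 4 * Y) := by gcongr
        _ = C * Y := by ring
    calc x ≤ C * Y / (ρ + D) ^ 2 := by rw [le_div_iff₀ (by positivity)]; linarith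
      _ ≤ C * Y + C * Y / (ρ + D) ^ 2 := by linarith [mul_nonneg hC0.le hY]
      _ = C * (1 + 1 / (ρ + D) ^ 2) * Y := by ring
  · have hDpos : 0 < D := hρ.trans_le hDρ
    have h3 : D * x ≤ C / 4 * Y := by
      have h5 : z.im * (D * x) ≤ z.im * (C / 4 * Y) := by
        calc z.im * (D * x) = z.im * x * D := by ring
          _ ≤ C₁ * (p * ρ) * Y * D := by gcongr
          _ = C₁ * p * Y * (ρ * D) := by ring
          _ ≤ C₁ * p * Y * (C₂ * z.im) := by gcongr
          _ = z.im * (C₁ * p * C₂ * Y) := by ring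
          _ ≤ z.im * (C / 4 * Y) := by gcongr
      exact le_of_mul_le_mul_left h5 hz
    have h4 : (ρ + D) * x ≤ C / 2 * Y := by
      calc (ρ + D) * x ≤ (D + D) * x := by gcongr
        _ = 2 * (D * x) := by ring
        _ ≤ 2 * (C / 4 * Y) := by gcongr
        _ = C / 2 * Y := by ring
    have h6 : 1 / (ρ + D) ≤ 2 * (1 + 1 / (ρ + D) ^ 2) := by
      have : 1 / (ρ + D) ^ 2 = (1 / (ρ + D)) ^ 2 := by rw [div_pow, one_pow]
      rw [this]
      nlinarith [sq_nonneg (1 / (ρ + D) - 1), sq_nonneg (1 / (ρ + D))]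
    calc x ≤ C / 2 * Y * (1 / (ρ + D)) := by
          rw [mul_one_div, le_div_iff₀ hs]; linarith
      _ ≤ C / 2 * Y * (2 * (1 + 1 / (ρ + D) ^ 2)) := by gcongr
      _ = C * (1 + 1 / (ρ + D) ^ 2) * Y := by ring

/-- The imaginary part of the solution is comparable to its trace. -/
lemma exists_imPart_comparable (hK₀ : K₀.IsHermitian)
    (hf : FlatWith (selfEnergy Ls) Z c) (hZ : ∀ k l, 0 < (Z ^ L) k l) (hn : 0 < n) :
    ∃ C₀ : ℝ, 0 < C₀ ∧ ∀ C : ℝ, C₀ ≤ C → ∀ M : ℂ → Mat n, IsSolution K₀ (selfEnergy Ls) M →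
      ∀ z : ℂ, 0 < z.im →
        (imPart (M z) - ((C⁻¹ * rho M z : ℝ) : ℂ) • (1 : Mat n)).PosSemidef ∧
        (((C * rho M z : ℝ) : ℂ) • (1 : Mat n) - imPart (M z)).PosSemidef := by
  obtain ⟨a, ha, hlow⟩ := exists_mul_trace_smul_one_le hK₀ hf hZ hn
  have hn' : (0 : ℝ) < n := by exact_mod_cast hn
  have hp0 : 0 < Real.pi * n := mul_pos Real.pi_pos hn'
  set p : ℝ := Real.pi * n with hp
  have hap : 0 < (a * p)⁻¹ := by positivity
  -- Here τ = pρ. The upper bound needs C ≥ p, from Im T ≤ τ, and the lower one C⁻¹ ≤ ap; both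
  -- persist when C grows, so this constant can later be merged with the others.
  refine ⟨p + (a * p)⁻¹, by positivity, fun C hC M hM z hz => ?_⟩
  have h : SolvesAt K₀ (selfEnergy Ls) z (M z) := hM z hz
  have hρ := rho_pos hn hM hz
  constructor
  · refine Matrix.le_iff.1 (le_trans (smul_le_smul_of_coeff_le ?_ zero_le_one)
      (hlow z (M z) hz h))
    have e : C⁻¹ ≤ a * p := inv_le_of_inv_le₀ (by positivity) (by linarith)
    calc C⁻¹ * rho M z ≤ a * p * rho M z := by gcongr
      _ = a * (imPart (M z)).trace.re := by rw [trace_re_eq_mul_rho hn, mul_assoc]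
  · refine Matrix.le_iff.1 ((le_trace_smul_one (nonneg_of_posSemidef h.1.posSemidef)).trans
      (smul_le_smul_of_coeff_le ?_ zero_le_one))
    rw [trace_re_eq_mul_rho hn]
    exact mul_le_mul_of_nonneg_right (by linarith) hρ.le

end Estimates

/-! ### Analytic continuation across the bulk -/

section Bulk

variable {n d : ℕ} {K₀ : Mat n} {Ls : Fin d → Mat n} {Z : Matrix (Fin n) (Fin n) ℕ} {c : ℝ} {L : ℕ}

lemma eventually_add_mul_I_im_pos {z : ℂ} (hz : 0 ≤ z.im) :
    ∀ᶠ y : ℝ in 𝓝[>] (0 : ℝ), 0 < (z + y * Complex.I).im := by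
  filter_upwards [self_mem_nhdsWithin] with y hy
  have hy' : 0 < y := hy
  simpa using by linarith

/-- Boundary values of a solution are invertible and satisfy the Dyson equation. -/
lemma IsSolution.dysonMap_eq_of_tendsto {Γ : Mat n →ₗ[ℂ] Mat n} {M : ℂ → Mat n}
    (hM : IsSolution K₀ Γ M) {z : ℂ} (hz : 0 ≤ z.im) {T : Mat n}
    (hT : Tendsto (fun y : ℝ => M (z + y * Complex.I)) (𝓝[>] (0 : ℝ)) (𝓝 T)) :
    IsUnit T ∧ dysonMap K₀ Γ T = z • (1 : Mat n) := by
  have hΓ : Continuous Γ := LinearMap.continuous_of_finiteDimensional _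
  have hlim : Tendsto (fun y : ℝ => M (z + y * Complex.I) *
      (K₀ - Γ (M (z + y * Complex.I)) - (z + y * Complex.I) • (1 : Mat n))) (𝓝[>] (0 : ℝ))
      (𝓝 (T * (K₀ - Γ T - z • (1 : Mat n)))) :=
    hT.mul ((tendsto_const_nhds.sub ((hΓ.tendsto _).comp hT)).sub
      ((tendsto_add_mul_I z).smul_const _))
  -- In multiplied form the equation passes to the limit without presupposing that the limit is
  -- invertible; invertibility is then a consequence.
  have h1 : T * (K₀ - Γ T - z • (1 : Mat n)) = 1 := by
    refine tendsto_nhds_unique hlim (tendsto_const_nhds.congr' ?_)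
    filter_upwards [eventually_add_mul_I_im_pos hz] with y hy
    have h := hM _ hy
    have hu := (Matrix.isUnit_iff_isUnit_det _).1 (isUnit_of_imPart_posDef h.1)
    have e : K₀ - Γ (M (z + y * Complex.I)) - (z + y * Complex.I) • (1 : Mat n) =
        (M (z + y * Complex.I))⁻¹ := by
      rw [← neg_neg (M (z + y * Complex.I))⁻¹, h.2]; abel
    rw [e, Matrix.mul_nonsing_inv _ hu]
  refine ⟨IsUnit.of_mul_eq_one _ h1, ?_⟩
  rw [dysonMap, Matrix.inv_eq_right_inv h1]
  abel

/-- Where the boundary density is positive, the solution continues analytically. -/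
lemma IsSolution.exists_analyticAt_eq (hK₀ : K₀.IsHermitian)
    (hf : FlatWith (selfEnergy Ls) Z c) (hZ : ∀ k l, 0 < (Z ^ L) k l) (hn : 0 < n)
    {M N : ℂ → Mat n} (hM : IsSolution K₀ (selfEnergy Ls) M)
    (hNc : ContinuousOn N {z : ℂ | 0 ≤ z.im})
    (hN : ∀ z : ℂ, 0 ≤ z.im →
      Tendsto (fun y : ℝ => M (z + y * Complex.I)) (𝓝[>] (0 : ℝ)) (𝓝 (N z)))
    {z₀ : ℂ} (hz₀ : 0 ≤ z₀.im) (hρ : 0 < rho N z₀) :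
    ∃ F : ℂ → Mat n, AnalyticAt ℂ F z₀ ∧ ∀ᶠ z in 𝓝 z₀, 0 ≤ z.im → F z = N z := by
  obtain ⟨C, -, hst⟩ := exists_stability hK₀ hf hZ hn
  obtain ⟨hu, hD⟩ := hM.dysonMap_eq_of_tendsto hz₀ (hN z₀ hz₀)
  have hΓ : Continuous (selfEnergy Ls) := LinearMap.continuous_of_finiteDimensional _
  have hinj : ∀ X, X - N z₀ * selfEnergy Ls X * N z₀ = 0 → X = 0 := by
    intro X hX
    -- The bound with τ² contains no Im z and survives the limit, so at positive density the
    -- stability operator stays injective.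
    have h1 : Tendsto (fun y : ℝ => (Real.pi * n * rho M (z₀ + y * Complex.I)) ^ 2 * ‖X‖)
        (𝓝[>] (0 : ℝ)) (𝓝 ((Real.pi * n * rho N z₀) ^ 2 * ‖X‖)) :=
      (((tendsto_rho (hN z₀ hz₀)).const_mul _).pow 2).mul_const _
    have h2 : Tendsto (fun y : ℝ => C * ‖X - M (z₀ + y * Complex.I) * selfEnergy Ls X *
        M (z₀ + y * Complex.I)‖) (𝓝[>] (0 : ℝ))
        (𝓝 (C * ‖X - N z₀ * selfEnergy Ls X * N z₀‖)) :=
      ((tendsto_const_nhds.sub (((hN z₀ hz₀).mul_const _).mul (hN z₀ hz₀))).norm).const_mul C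
    have h3 := le_of_tendsto_of_tendsto h1 h2 (by
      filter_upwards [eventually_add_mul_I_im_pos hz₀] with y hy
      have := (hst _ _ hy (hM _ hy) X).1
      rwa [trace_re_eq_mul_rho hn] at this)
    rw [hX, norm_zero, mul_zero] at h3
    have hn' : (0 : ℝ) < n := by exact_mod_cast hn
    have := Real.pi_pos
    exact norm_le_zero_iff.1 (nonpos_of_mul_nonpos_right h3 (by positivity))
  obtain ⟨F, hFa, -, -, hF⟩ := exists_analytic_local_inverse K₀ (selfEnergy Ls) hu hinj hD
  refine ⟨F, hFa, ?_⟩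
  -- Continuity of N brings its values into the neighbourhood where F inverts the Dyson map, so F
  -- agrees with N up to and including the real line.
  have h1 : ∀ᶠ z in 𝓝[{z : ℂ | 0 ≤ z.im}] z₀,
      ∀ w : ℂ, dysonMap K₀ (selfEnergy Ls) (N z) = w • (1 : Mat n) → F w = N z :=
    (hNc z₀ hz₀).eventually hF
  rw [eventually_nhdsWithin_iff] at h1
  filter_upwards [h1] with z hz him
  exact hz him z (hM.dysonMap_eq_of_tendsto him (hN z him)).2

/-- The imaginary part is only real linear, hence the passage to real scalars before it is taken. -/
lemma analyticAt_im_scaledTrace_ofReal {F : ℂ → Mat n} {x₀ : ℝ} (hF : AnalyticAt ℂ F (x₀ : ℂ)) :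
    AnalyticAt ℝ (fun x : ℝ => (scaledTrace n (F x)).im) x₀ := by
  have h1 : AnalyticAt ℂ (fun z => scaledTrace n (F z)) (x₀ : ℂ) :=
    (scaledTrace n).analyticAt _ |>.comp hF
  have h2 : AnalyticAt ℝ (fun x : ℝ => scaledTrace n (F x)) x₀ :=
    AnalyticAt.comp (f := fun x : ℝ => (x : ℂ)) (g := fun z => scaledTrace n (F z))
      (h1.restrictScalars (𝕜 := ℝ)) (Complex.ofRealCLM.analyticAt x₀)
  exact (Complex.imCLM.analyticAt _).comp h2

end Bulk

end MDE

end

/-! ### Choice of a common constant and proof of the statement. -/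

theorem propositionA1 {n d : ℕ} (hn : 0 < n) (L : ℕ)
    (K₀ : MDE.Mat n) (hK₀ : K₀.IsHermitian) (Ls : Fin d → MDE.Mat n)
    (hflat : MDE.IsFlat (MDE.selfEnergy Ls) L) :
    ∃ C : ℝ, 0 < C ∧
      ∀ M : ℂ → MDE.Mat n, MDE.IsSolution K₀ (MDE.selfEnergy Ls) M →
        -- (i) boundedness of `M` and `M⁻¹`
        (∀ z : ℂ, 0 < z.im →
          ‖M z‖ ≤ C ∧ IsUnit (M z) ∧ ‖(M z)⁻¹‖ ≤ C * (1 + ‖z‖)) ∧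
        -- (ii) `Im M` is comparable to `ρ`
        (∀ z : ℂ, 0 < z.im →
          (MDE.imPart (M z) - ((C⁻¹ * MDE.rho M z : ℝ) : ℂ) • (1 : MDE.Mat n)).PosSemidef ∧
          (((C * MDE.rho M z : ℝ) : ℂ) • (1 : MDE.Mat n) - MDE.imPart (M z)).PosSemidef) ∧
        -- (iii) linear stability
        (∀ z : ℂ, 0 < z.im →
          IsUnit (MDE.stability (MDE.selfEnergy Ls) (M z)) ∧
          ‖Ring.inverse (MDE.stability (MDE.selfEnergy Ls) (M z))‖ ≤
            C * (1 + 1 / (MDE.rho M z + Metric.infDist z (MDE.densitySupport M)) ^ 2)) ∧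
        -- (iv) Hölder continuous extension of `M` to the closed upper half-plane
        (∃ Mext : ℂ → MDE.Mat n,
          (∀ z : ℂ, 0 < z.im → Mext z = M z) ∧
          ContinuousOn Mext {z : ℂ | 0 ≤ z.im} ∧
          (∀ z₁ z₂ : ℂ, 0 ≤ z₁.im → 0 ≤ z₂.im →
            ‖Mext z₁ - Mext z₂‖ ≤ C * ‖z₁ - z₂‖ ^ (1 / 3 : ℝ)) ∧
          (∀ x : ℝ, MDE.density M x = MDE.rho Mext (x : ℂ))) ∧
        -- existence and Hölder continuity of the density of states
        (∀ x : ℝ, Filter.Tendsto (fun y : ℝ => MDE.rho M ((x : ℂ) + (y : ℂ) * Complex.I))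
          (𝓝[>] (0 : ℝ)) (𝓝 (MDE.density M x))) ∧
        (∀ x₁ x₂ : ℝ,
          |MDE.density M x₁ - MDE.density M x₂| ≤ C * |x₁ - x₂| ^ (1 / 3 : ℝ)) ∧
        -- real analyticity of the density of states where it is positive
        IsOpen {x : ℝ | 0 < MDE.density M x} ∧
        AnalyticOnNhd ℝ (MDE.density M) {x : ℝ | 0 < MDE.density M x} ∧
        -- (v) analytic continuation of `M` across the bulk
        (∀ x₀ : ℝ, 0 < MDE.density M x₀ →
          ∃ (U : Set ℂ) (F : ℂ → MDE.Mat n), IsOpen U ∧ (x₀ : ℂ) ∈ U ∧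
            AnalyticOnNhd ℂ F U ∧ ∀ z ∈ U, 0 < z.im → F z = M z) := by
  obtain ⟨Z, c, hf, hZ⟩ := MDE.IsFlat.exists_flatWith hflat
  obtain ⟨C₁, hC₁, hb⟩ := MDE.exists_norm_bounds hK₀ hf
  obtain ⟨C₂, hC₂, him⟩ := MDE.exists_imPart_comparable hK₀ hf hZ hn
  obtain ⟨C₃, hC₃, hst⟩ := MDE.exists_norm_inverse_stability_le hK₀ hf hZ hn
  obtain ⟨C₄, hC₄, hH⟩ := MDE.exists_holder hK₀ hf hZ hn
  set C₅ : ℝ := ‖MDE.scaledTrace n‖ * C₄ with hC₅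
  have hC₅0 : 0 ≤ C₅ := by positivity
  -- The summand 1 ensures C ≥ 1, needed to pass from ‖z‖ + C₁ to C(1 + ‖z‖).
  set C : ℝ := 1 + C₁ + C₂ + C₃ + C₄ + C₅ with hC
  have hC0 : 0 < C := by positivity
  refine ⟨C, hC0, fun M hM => ?_⟩
  obtain ⟨N, hN, hNc, hNH, hNt⟩ := MDE.exists_holder_extension hC₄.le (hH M hM)
  have htend : ∀ x : ℝ, Filter.Tendsto (fun y : ℝ => MDE.rho M ((x : ℂ) + (y : ℂ) * Complex.I))
      (𝓝[>] (0 : ℝ)) (𝓝 (MDE.rho N (x : ℂ))) := fun x => MDE.tendsto_rho (hNt x (by simp))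
  have hdens : ∀ x : ℝ, MDE.density M x = MDE.rho N (x : ℂ) := fun x => (htend x).limUnder_eq
  have hdensc : Continuous (MDE.density M) := by
    have h1 : Continuous fun x : ℝ => N (x : ℂ) :=
      hNc.comp_continuous Complex.continuous_ofReal fun x => by simp
    have h2 : MDE.density M = fun x : ℝ => (MDE.scaledTrace n (N x)).im := by
      funext x
      rw [hdens, MDE.rho_eq_im_scaledTrace]
    rw [h2]
    exact Complex.continuous_im.comp ((MDE.scaledTrace n).continuous.comp h1)
  have hopen : IsOpen {x : ℝ | 0 < MDE.density M x} := isOpen_lt continuous_const hdensc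
  have hbulk : ∀ x₀ : ℝ, 0 < MDE.density M x₀ → ∃ F : ℂ → MDE.Mat n, AnalyticAt ℂ F x₀ ∧
      ∀ᶠ z in 𝓝 (x₀ : ℂ), 0 ≤ z.im → F z = N z := fun x₀ hx₀ =>
    hM.exists_analyticAt_eq hK₀ hf hZ hn hNc hNt (by simp) (by rwa [← hdens])
  refine ⟨fun z hz => ?_, fun z hz => ?_, fun z hz => ?_, ⟨N, hN, hNc, fun z₁ z₂ h₁ h₂ => ?_, hdens⟩,
    fun x => ?_, fun x₁ x₂ => ?_, hopen, fun x₀ hx₀ => ?_, fun x₀ hx₀ => ?_⟩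
  · obtain ⟨h1, h2, -⟩ := hb z (M z) hz (hM z hz)
    refine ⟨h1.trans (by linarith), MDE.isUnit_of_imPart_posDef (hM z hz).1, h2.trans ?_⟩
    have h3 : 1 ≤ C := by linarith
    have h4 : C₁ ≤ C := by linarith
    nlinarith [norm_nonneg z]
  · exact him C (by linarith) M hM z hz
  · obtain ⟨h1, h2⟩ := hst M hM z hz
    refine ⟨h1, h2.trans ?_⟩
    gcongr
    linarith
  · refine (hNH z₁ z₂ h₁ h₂).trans ?_
    gcongr
    linarith
  · rw [hdens]
    exact htend x
  · rw [hdens, hdens]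
    refine (MDE.abs_rho_sub_le N N _ _).trans ?_
    have h1 := hNH x₁ x₂ (by simp) (by simp)
    rw [← Complex.ofReal_sub, Complex.norm_real, Real.norm_eq_abs] at h1
    calc ‖MDE.scaledTrace n‖ * ‖N x₁ - N x₂‖
        ≤ ‖MDE.scaledTrace n‖ * (C₄ * |x₁ - x₂| ^ (1 / 3 : ℝ)) := by gcongr
      _ = C₅ * |x₁ - x₂| ^ (1 / 3 : ℝ) := by rw [hC₅, mul_assoc]
      _ ≤ C * |x₁ - x₂| ^ (1 / 3 : ℝ) := by gcongr; linarith
  · obtain ⟨F, hFa, hF⟩ := hbulk x₀ hx₀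
    refine (MDE.analyticAt_im_scaledTrace_ofReal hFa).congr ?_
    filter_upwards [Complex.continuous_ofReal.continuousAt.eventually hF] with x hx
    rw [hdens, MDE.rho_eq_im_scaledTrace, hx (by simp)]
  · obtain ⟨F, hFa, hF⟩ := hbulk x₀ hx₀
    obtain ⟨U, hU, hUo, hxU⟩ := eventually_nhds_iff.1 (hFa.eventually_analyticAt.and hF)
    refine ⟨U, F, hUo, hxU, fun z hz => (hU z hz).1, fun z hz hz0 => ?_⟩
    rw [(hU z hz).2 hz0.le, hN z hz0]
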